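/- Let $\bar{\mathfrak g}$ be a simple finite-dimensional complex Lie algebra, not of type $G_2$, with simple roots numbered $1,\dots,r$, Cartan matrix $(a_{\alpha\beta})$ and positive integers $d_\alpha$ such that $(d_\alpha a_{\alpha\beta})$ is symmetric. Let $q$ be a nonzero complex number, and $q_\alpha=q^{d_\alpha}$. Let $U_q\mathfrak n_+$ be the algebra with generators $e_\alpha[m]$ ($1\le\alpha\le r$, $m\in\mathbb Z$) and, for $e_\alpha(z)=\sum_m e_\alpha[m]z^{-m}$, the relations $$(q_\alpha^{a_{\alpha\beta}}z-w)\,e_\alpha(z)e_\beta(w)=(z-q_\alpha^{a_{\alpha\beta}}w)\,e_\beta(w)e_\alpha(z)\quad\text{for all }\alpha,\beta,$$ $$\sum_{s=0}^{N}(-1)^s\begin{bmatrix}N\\ s\end{bmatrix}_{q_\alpha}\mathrm{Sym}_{z_1,\dots,z_N}\; e_\alpha(z_1)\cdots e_\alpha(z_s)\,e_\beta(w)\,e_\alpha(z_{s+1})\cdots e_\alpha(z_N)=0\quad\text{for }\alpha\ne\beta,\ N=1-a_{\alpha\beta},$$ where $\mathrm{Sym}$ is the sum over all permutations and the Gaussian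 binomial coefficients are symmetric under $q\leftrightarrow q^{-1}$ and understood as values of Laurent polynomials in $q$. Let $V$, $v\in V$ and $\xi\in V^*$ be as in one of the following two cases. (a) $q_\alpha^2\neq1$ for all $\alpha$; $V$ is a highest weight module over the quantum affine algebra $U_q\mathfrak g$ of $\bar{\mathfrak g}$, given by Drinfeld's new realization together with the homogeneous degree operator, in which the currents $e_\alpha(z)$ satisfy the relations above; and $v$, $\xi$ are weight vectors. Here "highest weight" means that $V$ is generated by a nonzero weight vector annihilated by $e_\alpha[m]$ for $m\ge0$ and, for $m>0$, by the modes of degree $m$ of the currents $f_\alpha(z)$ and of the Cartan currents. (b) $q\ne0$ is arbitrary; $V=\bigoplus_{k\in\mathbb Z}V_k$ is a graded $U_q\mathfrak n_+$-module, $e_\alpha[m]V_k\subset V_{k+m}$, with $V_k=0$ for all $k$ larger than some integer; $v$ is homogeneous, and $\xi$ is homogeneous, that is, zero on all the $V_k$ but one. For integers $n_1,\dots,n_r\ge0$ put $I_\alpha=\{1,\dots,n_\alpha\}$, and consider the formal series $$f(z_i^{(\alpha)})=\Big\langle\xi,\ \prod_{\alpha=1}^r\prod_{i\in I_\alpha}e_\alpha(z_i^{(\alpha)})\,v\Big\rangle\in\mathbb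 C[[z_i^{(\alpha)},z_i^{(\alpha)-1}]],$$ with the factors written from left to right in increasing order of $\alpha$, then of $i$. Then: 1) $f$ belongs to the ring of iterated Laurent series $\mathbb C((z^{(1)}_1))((z^{(1)}_2))\cdots((z^{(r)}_{n_r}))$. 2) $f$ is the expansion in this ring of a rational function, again denoted $f$. On $\prod_\alpha(\mathbb C^\times)^{I_\alpha}$ it is regular except for at most simple poles on the shifted diagonals $q_\alpha^{a_{\alpha\beta}}z_i^{(\alpha)}=z_j^{(\beta)}$ with $\alpha<\beta$, or $\alpha=\beta$ and $i<j$. It satisfies the twisted symmetry relations $$(q_\alpha^2z_i^{(\alpha)}-z_{i+1}^{(\alpha)})\,f=(z_i^{(\alpha)}-q_\alpha^2z_{i+1}^{(\alpha)})\,\sigma f\qquad(1\le i<n_\alpha),$$ where $\sigma$ is the interchange of $z_i^{(\alpha)}$ and $z_{i+1}^{(\alpha)}$. It has the form $$f=\frac{\prod_\alpha\prod_{i<j\in I_\alpha}(z_i^{(\alpha)}-z_j^{(\alpha)})}{\prod_{\alpha\le\beta}\ \prod_{i\in I_\alpha,\,j\in I_\beta,\ i<j\text{ if }\alpha=\beta}(q_\alpha^{a_{\alpha\beta}}z_i^{(\alpha)}-z_j^{(\beta)})}\;A,$$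 where $A$ is a Laurent polynomial in the $z_i^{(\alpha)}$, symmetric in the variables $(z_i^{(\alpha)})_{i\in I_\alpha}$ for each $\alpha$. 3) For all $\alpha\ne\beta$, all pairwise different $i_1,\dots,i_{1-a_{\alpha\beta}}\in I_\alpha$ and all $j\in I_\beta$, the Laurent polynomial $A$ vanishes at all points of $\prod_\alpha(\mathbb C^\times)^{I_\alpha}$ with $$z_{i_1}^{(\alpha)}=q_\alpha^2z_{i_2}^{(\alpha)}=\cdots=q_\alpha^{-2a_{\alpha\beta}}z_{i_{1-a_{\alpha\beta}}}^{(\alpha)}=q_\alpha^{-a_{\alpha\beta}}z_j^{(\beta)}.$$ Moreover, $$f=\frac{\prod_\alpha\prod_{i<j\in I_\alpha}(z_i^{(\alpha)}-z_j^{(\alpha)})}{\prod_{\alpha\le\beta,\ a_{\alpha\beta}\ne0}\ \prod_{i\in I_\alpha,\,j\in I_\beta,\ i<j\text{ if }\alpha=\beta}(q_\alpha^{a_{\alpha\beta}}z_i^{(\alpha)}-z_j^{(\beta)})}\;B,$$ where $B$ is a Laurent polynomial which satisfies these vanishing conditions for all $\alpha\ne\beta$ with $a_{\alpha\beta}\ne0$.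 -/

import Mathlib

noncomputable section

namespace DrinfeldCurrents

universe u v

/-! ### Variables, Laurent polynomials and rational functions -/

/-- The index set of the variables `z_i^{(α)}`, where `α` runs over the simple roots
`0, …, r - 1` and `i` over `I_α = {0, …, n α - 1}`. -/
abbrev Var {r : ℕ} (n : Fin r → ℕ) : Type := Σ α : Fin r, Fin (n α)

/-- The order in which the variables are written,
`z_1^{(1)}, z_2^{(1)}, …, z_{n_r}^{(r)}`. -/
def Before {r : ℕ} {n : Fin r → ℕ} (x y : Var n) : Prop :=
  x.1 < y.1 ∨ (x.1 = y.1 ∧ (x.2 : ℕ) < (y.2 : ℕ))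

/-- The ring `ℂ[z_x, z_x⁻¹ : x ∈ ι]` of Laurent polynomials. -/
abbrev Laurent (ι : Type) : Type := AddMonoidAlgebra ℂ (ι → ℤ)

/-- The field of rational functions in the variables `z_x`, `x ∈ ι`. -/
abbrev RatFun (ι : Type) [Finite ι] : Type := FractionRing (Laurent ι)

/-- The variable `z_x` as a Laurent polynomial. -/
def Z {ι : Type} [DecidableEq ι] (x : ι) : Laurent ι :=
  AddMonoidAlgebra.single (Pi.single x 1) 1

/-- The value of a Laurent polynomial at a point of the torus `(ℂ^×)^ι`. -/
def Laurent.value {ι : Type} [Fintype ι] (A : Laurent ι) (z : ι → ℂˣ) : ℂ :=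
  A.coeff.sum fun m c => c * ∏ x, ((z x ^ m x : ℂˣ) : ℂ)

/-- The automorphism `z_x ↦ z_{σ x}` of the ring of Laurent polynomials. -/
def permute {ι : Type} (σ : Equiv.Perm ι) : Laurent ι ≃ₐ[ℂ] Laurent ι :=
  AddMonoidAlgebra.domCongr ℂ ℂ (AddEquiv.arrowCongr σ (AddEquiv.refl ℤ))

/-- The automorphism `z_x ↦ z_{σ x}` of the field of rational functions. -/
def permuteRat {ι : Type} [Finite ι] (σ : Equiv.Perm ι) : RatFun ι ≃+* RatFun ι :=
  IsFractionRing.ringEquivOfRingEquiv (permute σ).toRingEquiv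

/-! ### Formal series and iterated Laurent series -/

/-- `ℂ[[z_x, z_x⁻¹ : x ∈ ι]]`: all formal series `∑ f m * ∏ z_x ^ (m x)`, given by their
coefficients. -/
abbrev FormalSeries (ι : Type) : Type := (ι → ℤ) → ℂ

/-- The product of a Laurent polynomial and a formal series. -/
def mulSeries {ι : Type} (P : Laurent ι) (f : FormalSeries ι) : FormalSeries ι :=
  fun m => P.coeff.sum fun k c => c * f (m - k)

/-- Membership in `ℂ((z_1^{(1)}))((z_2^{(1)})) ⋯ ((z_{n_r}^{(r)}))`, where `R((z))` is the ring
of Laurent series `∑ c_k z^k` with `c_k ∈ R`, and `c_k = 0` for `k` smaller than some integer: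
once the exponents of all the variables after `x` are fixed, the exponents of `z_x` that occur are
bounded from below. -/
def IsIteratedLaurent {r : ℕ} {n : Fin r → ℕ} (f : FormalSeries (Var n)) : Prop :=
  ∀ (x : Var n) (m : Var n → ℤ), ∃ N : ℤ, ∀ k : Var n → ℤ,
    (∀ y, Before x y → k y = m y) → k x < N → f k = 0

/-- `f` is the expansion of the rational function `R` in the ring (in fact, field)
`ℂ((z_1^{(1)})) ⋯ ((z_{n_r}^{(r)}))`: writing `R = P / Q` with Laurent polynomials `P` and
`Q ≠ 0`, it is the element `f` of that ring with `Q * f = P`. -/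
def IsExpansionOf {r : ℕ} {n : Fin r → ℕ} (f : FormalSeries (Var n)) (R : RatFun (Var n)) :
    Prop :=
  IsIteratedLaurent f ∧ ∃ P Q : Laurent (Var n), Q ≠ 0 ∧
    R = algebraMap (Laurent (Var n)) (RatFun (Var n)) P /
      algebraMap (Laurent (Var n)) (RatFun (Var n)) Q ∧
    mulSeries Q f = fun m => P.coeff m

/-! ### The algebra `U_q 𝔫₊` -/

/-- The Gaussian binomial coefficient, symmetric under `q ↔ q⁻¹`: the value at `q` of the
Laurent polynomial `[n]! / ([k]! [n - k]!)`, with `[n]! = [1] ⋯ [n]` and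
`[m] = (q^m - q^(-m)) / (q - q⁻¹)`. It is given by its Pascal rule, so that it makes sense for
every `q ≠ 0`. -/
def qBinom (q : ℂ) : ℕ → ℕ → ℂ
  | _, 0 => 1
  | 0, _ + 1 => 0
  | n + 1, k + 1 => q ^ (k + 1) * qBinom q n (k + 1) + q⁻¹ ^ (n - k) * qBinom q n k

/-- `q_α ^ a_{αβ}`, where `q_α = q ^ d_α`. -/
def qExp {r : ℕ} (a : Fin r → Fin r → ℤ) (d : Fin r → ℕ) (q : ℂ) (α β : Fin r) : ℂ :=
  (q ^ d α) ^ a α β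

section Relations

variable {A : Type v} [Ring A] [Algebra ℂ A]

/-- The coefficient of `z^(-m) w^(-k)` in
`(c z - g w) x(z) y(w) - (z - c g w) y(w) x(z)`, where `x(z) = ∑ x[m] z^(-m)`,
`y(w) = ∑ y[k] w^(-k)`. -/
def exchange (c : ℂ) (g : A) (x y : ℤ → A) (m k : ℤ) : A :=
  (c • (x (m + 1) * y k) - g * x m * y (k + 1)) -
    (y k * x (m + 1) - c • (g * y (k + 1) * x m))

/-- The coefficient of `z_1^(-k 1) ⋯ z_N^(-k N) w^(-l)` in
`∑_s (-1)^s [N choose s] Sym_z (x(z_1) ⋯ x(z_s) y(w) x(z_{s+1}) ⋯ x(z_N))`, where `Sym` is the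
sum over all permutations of `z_1, …, z_N` and the binomial coefficient is taken at `p`. -/
def serre (p : ℂ) (N : ℕ) (x y : ℤ → A) (k : Fin N → ℤ) (l : ℤ) : A :=
  ∑ s ∈ Finset.range (N + 1), ((-1) ^ s * qBinom p N s) •
    ∑ σ : Equiv.Perm (Fin N),
      (((List.finRange N).take s).map fun t => x (k (σ t))).prod * y l *
        (((List.finRange N).drop s).map fun t => x (k (σ t))).prod

end Relations

/-- The generators `e_α[m]` of `U_q 𝔫₊`. -/
abbrev freeE {r : ℕ} (α : Fin r) (m : ℤ) : FreeAlgebra ℂ (Fin r × ℤ) :=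
  FreeAlgebra.ι ℂ (α, m)

/-- The vertex relations
`(q_α^{a_{αβ}} z - w) e_α(z) e_β(w) = (z - q_α^{a_{αβ}} w) e_β(w) e_α(z)`
and the quantum Serre relations. -/
inductive NPlusRel {r : ℕ} (a : Fin r → Fin r → ℤ) (d : Fin r → ℕ) (q : ℂ) :
    FreeAlgebra ℂ (Fin r × ℤ) → FreeAlgebra ℂ (Fin r × ℤ) → Prop
  | vertex (α β : Fin r) (m k : ℤ) :
      NPlusRel a d q (exchange (qExp a d q α β) 1 (freeE α) (freeE β) m k) 0
  | serre (α β : Fin r) (hαβ : α ≠ β) (k : Fin (1 - a α β).toNat → ℤ) (l : ℤ) :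
      NPlusRel a d q (serre (q ^ d α) (1 - a α β).toNat (freeE α) (freeE β) k l) 0

/-- The algebra `U_q 𝔫₊`. -/
abbrev NPlus {r : ℕ} (a : Fin r → Fin r → ℤ) (d : Fin r → ℕ) (q : ℂ) : Type :=
  RingQuot (NPlusRel a d q)

/-- The generator `e_α[m]` of `U_q 𝔫₊`. -/
def NPlus.e {r : ℕ} (a : Fin r → Fin r → ℤ) (d : Fin r → ℕ) (q : ℂ) (α : Fin r) (m : ℤ) :
    NPlus a d q :=
  RingQuot.mkAlgHom ℂ (NPlusRel a d q) (freeE α m)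

/-! ### The quantum affine algebra, in Drinfeld's new realization -/

/-- The generators of the quantum affine algebra: `e α m` and `f α m` are the modes of
`e_α(z) = ∑ e_α[m] z^(-m)` and `f_α(z) = ∑ f_α[m] z^(-m)`; `Kp α m` and `Km α m` stand for
`K_α^+[m]` and `K_α^-[-m]`, `m ≥ 0`, the modes of the Cartan currents
`K_α^+(z) = ∑_{m ≥ 0} K_α^+[m] z^(-m)` and `K_α^-(z) = ∑_{m ≥ 0} K_α^-[-m] z^m`;
`γ`, `γinv` are the square root of the central element and its inverse;
`D` is the homogeneous degree operator. -/
inductive AffGen (r : ℕ) : Type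
  | e (α : Fin r) (m : ℤ)
  | f (α : Fin r) (m : ℤ)
  | Kp (α : Fin r) (m : ℕ)
  | Km (α : Fin r) (m : ℕ)
  | γ
  | γinv
  | D

namespace AffGen

variable {r : ℕ}

/-- `e_α[m]`. -/
abbrev fe (α : Fin r) (m : ℤ) : FreeAlgebra ℂ (AffGen r) := FreeAlgebra.ι ℂ (e α m)

/-- `f_α[m]`. -/
abbrev ff (α : Fin r) (m : ℤ) : FreeAlgebra ℂ (AffGen r) := FreeAlgebra.ι ℂ (f α m)

/-- `K_α^+[m]`, which is `0` for `m < 0`. -/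
def fKp (α : Fin r) (m : ℤ) : FreeAlgebra ℂ (AffGen r) :=
  if 0 ≤ m then FreeAlgebra.ι ℂ (Kp α m.toNat) else 0

/-- `K_α^-[m]`, which is `0` for `m > 0`. -/
def fKm (α : Fin r) (m : ℤ) : FreeAlgebra ℂ (AffGen r) :=
  if m ≤ 0 then FreeAlgebra.ι ℂ (Km α (-m).toNat) else 0

/-- The square root `γ` of the central element. -/
abbrev fγ : FreeAlgebra ℂ (AffGen r) := FreeAlgebra.ι ℂ γ

/-- The inverse of `γ`. -/
abbrev fγinv : FreeAlgebra ℂ (AffGen r) := FreeAlgebra.ι ℂ γinv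

/-- The degree operator. -/
abbrev fD : FreeAlgebra ℂ (AffGen r) := FreeAlgebra.ι ℂ D

/-- `γ ^ m` for an integer `m`. -/
def fγpow (m : ℤ) : FreeAlgebra ℂ (AffGen r) :=
  if 0 ≤ m then fγ ^ m.toNat else fγinv ^ (-m).toNat

end AffGen

open AffGen in
/-- The defining relations of the quantum affine algebra. With `b = q_α^{a_{αβ}}` they read:
* `γ` is central and invertible; the `K_α^+[m]` commute with each other, so do the `K_α^-[m]`,
  and `K_α^-[0]` is the inverse of `K_α^+[0]`;
* `(b z - γ^{-2} w) (z - b γ^2 w) K_α^+(z) K_β^-(w)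
    = (b z - γ^2 w) (z - b γ^{-2} w) K_β^-(w) K_α^+(z)`;
* `(b z - γ^{∓1} w) K_α^±(z) e_β(w) = (z - b γ^{∓1} w) e_β(w) K_α^±(z)`;
* `(b^{-1} z - γ^{±1} w) K_α^±(z) f_β(w) = (z - b^{-1} γ^{±1} w) f_β(w) K_α^±(z)`;
* `(b z - w) e_α(z) e_β(w) = (z - b w) e_β(w) e_α(z)`, and the same with `f` and `b^{-1}`;
* `(q_α - q_α^{-1}) [e_α[m], f_β[k]]
    = δ_{αβ} (γ^{m - k} K_α^+[m + k] - γ^{k - m} K_α^-[m + k])`, written for `q_α^2 ≠ 1`;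
* the quantum Serre relations for `e` and for `f`;
* `[D, x[m]] = m x[m]` for `x = e_α, f_α, K_α^±`. -/
inductive AffRel {r : ℕ} (a : Fin r → Fin r → ℤ) (d : Fin r → ℕ) (q : ℂ) :
    FreeAlgebra ℂ (AffGen r) → FreeAlgebra ℂ (AffGen r) → Prop
  | γ_mul_γinv : AffRel a d q (fγ * fγinv) 1
  | γinv_mul_γ : AffRel a d q (fγinv * fγ) 1
  | γ_central (g : AffGen r) :
      AffRel a d q (fγ * FreeAlgebra.ι ℂ g) (FreeAlgebra.ι ℂ g * fγ)
  | Kp_mul_Km (α : Fin r) : AffRel a d q (fKp α 0 * fKm α 0) 1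
  | Km_mul_Kp (α : Fin r) : AffRel a d q (fKm α 0 * fKp α 0) 1
  | Kp_comm (α β : Fin r) (m k : ℤ) : AffRel a d q (fKp α m * fKp β k) (fKp β k * fKp α m)
  | Km_comm (α β : Fin r) (m k : ℤ) : AffRel a d q (fKm α m * fKm β k) (fKm β k * fKm α m)
  | Kp_Km (α β : Fin r) (m k : ℤ) :
      AffRel a d q
        (qExp a d q α β • (fKp α (m + 2) * fKm β k) -
          (qExp a d q α β ^ 2 • fγ ^ 2 + fγinv ^ 2) * fKp α (m + 1) * fKm β (k + 1) +
          qExp a d q α β • (fKp α m * fKm β (k + 2)))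
        (qExp a d q α β • (fKm β k * fKp α (m + 2)) -
          (qExp a d q α β ^ 2 • fγinv ^ 2 + fγ ^ 2) * fKm β (k + 1) * fKp α (m + 1) +
          qExp a d q α β • (fKm β (k + 2) * fKp α m))
  | Kp_e (α β : Fin r) (m k : ℤ) :
      AffRel a d q (exchange (qExp a d q α β) fγinv (fKp α) (fe β) m k) 0
  | Km_e (α β : Fin r) (m k : ℤ) :
      AffRel a d q (exchange (qExp a d q α β) fγ (fKm α) (fe β) m k) 0
  | Kp_f (α β : Fin r) (m k : ℤ) :
      AffRel a d q (exchange (qExp a d q α β)⁻¹ fγ (fKp α) (ff β) m k) 0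
  | Km_f (α β : Fin r) (m k : ℤ) :
      AffRel a d q (exchange (qExp a d q α β)⁻¹ fγinv (fKm α) (ff β) m k) 0
  | e_e (α β : Fin r) (m k : ℤ) :
      AffRel a d q (exchange (qExp a d q α β) 1 (fe α) (fe β) m k) 0
  | f_f (α β : Fin r) (m k : ℤ) :
      AffRel a d q (exchange (qExp a d q α β)⁻¹ 1 (ff α) (ff β) m k) 0
  | e_f_same (α : Fin r) (m k : ℤ) :
      AffRel a d q (fe α m * ff α k - ff α k * fe α m)
        ((q ^ d α - (q ^ d α)⁻¹)⁻¹ •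
          (fγpow (m - k) * fKp α (m + k) - fγpow (k - m) * fKm α (m + k)))
  | e_f_ne (α β : Fin r) (hαβ : α ≠ β) (m k : ℤ) :
      AffRel a d q (fe α m * ff β k) (ff β k * fe α m)
  | serre_e (α β : Fin r) (hαβ : α ≠ β) (k : Fin (1 - a α β).toNat → ℤ) (l : ℤ) :
      AffRel a d q (serre (q ^ d α) (1 - a α β).toNat (fe α) (fe β) k l) 0
  | serre_f (α β : Fin r) (hαβ : α ≠ β) (k : Fin (1 - a α β).toNat → ℤ) (l : ℤ) :
      AffRel a d q (serre (q ^ d α) (1 - a α β).toNat (ff α) (ff β) k l) 0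
  | D_e (α : Fin r) (m : ℤ) :
      AffRel a d q (fD * fe α m - fe α m * fD) ((m : ℂ) • fe α m)
  | D_f (α : Fin r) (m : ℤ) :
      AffRel a d q (fD * ff α m - ff α m * fD) ((m : ℂ) • ff α m)
  | D_Kp (α : Fin r) (m : ℤ) :
      AffRel a d q (fD * fKp α m - fKp α m * fD) ((m : ℂ) • fKp α m)
  | D_Km (α : Fin r) (m : ℤ) :
      AffRel a d q (fD * fKm α m - fKm α m * fD) ((m : ℂ) • fKm α m)

/-- The quantum affine algebra `U_q 𝔤`, for `q` with `q_α^2 ≠ 1` for all `α`. -/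
abbrev QAffine {r : ℕ} (a : Fin r → Fin r → ℤ) (d : Fin r → ℕ) (q : ℂ) : Type :=
  RingQuot (AffRel a d q)

namespace QAffine

variable {r : ℕ} (a : Fin r → Fin r → ℤ) (d : Fin r → ℕ) (q : ℂ)

/-- The image of a generator in `U_q 𝔤`. -/
def gen (g : AffGen r) : QAffine a d q :=
  RingQuot.mkAlgHom ℂ (AffRel a d q) (FreeAlgebra.ι ℂ g)

/-- The mode `e_α[m]` of the current `e_α(z)`. -/
def e (α : Fin r) (m : ℤ) : QAffine a d q := gen a d q (.e α m)

section Modules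

variable {V : Type u} [AddCommGroup V] [Module ℂ V] [Module (QAffine a d q) V]

/-- A weight vector of a `U_q 𝔤`-module: a common eigenvector of the `K_α^+[0]`, of the square
root of the central element, and of the degree operator. -/
def IsWeightVector (v : V) : Prop :=
  (∀ α, ∃ c : ℂ, gen a d q (.Kp α 0) • v = c • v) ∧
  (∃ c : ℂ, gen a d q .γ • v = c • v) ∧
  (∃ c : ℂ, gen a d q .D • v = c • v)

/-- A weight vector of the dual of a `U_q 𝔤`-module. -/
def IsWeightCovector (ξ : Module.Dual ℂ V) : Prop :=
  (∀ α, ∃ c : ℂ, ∀ u : V, ξ (gen a d q (.Kp α 0) • u) = c * ξ u) ∧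
  (∃ c : ℂ, ∀ u : V, ξ (gen a d q .γ • u) = c * ξ u) ∧
  (∃ c : ℂ, ∀ u : V, ξ (gen a d q .D • u) = c * ξ u)

variable (V) in
/-- `V` is a highest weight module over `U_q 𝔤`: it is generated by a nonzero weight vector which
is annihilated by the `e_α[m]`, `m ≥ 0`, and by the `f_α[m]` and `K_α^+[m]`, `m > 0`. -/
def IsHighestWeightModule : Prop :=
  ∃ v₀ : V, v₀ ≠ 0 ∧ IsWeightVector a d q v₀ ∧
    (∀ α, ∀ m : ℤ, 0 ≤ m → gen a d q (.e α m) • v₀ = 0) ∧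
    (∀ α, ∀ m : ℤ, 0 < m → gen a d q (.f α m) • v₀ = 0) ∧
    (∀ α, ∀ m : ℕ, 0 < m → gen a d q (.Kp α m) • v₀ = 0) ∧
    Submodule.span (QAffine a d q) {v₀} = ⊤

end Modules

end QAffine

/-! ### Correlation functions and their properties -/

/-- The series `⟨ξ, ∏_{α = 1}^r ∏_{i ∈ I_α} e_α(z_i^{(α)}) v⟩`, where
`e_α(z) = ∑ e_α[m] z^(-m)` and the factors are in the order `Before`: the coefficient of
`∏ z_x ^ (m x)` is the matrix coefficient of the product of the `e_α[-m x]`. -/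
def correlation {r : ℕ} (n : Fin r → ℕ) {U : Type v} [Ring U] {V : Type u} [AddCommGroup V]
    [Module ℂ V] [Module U V] (e : Fin r → ℤ → U) (ξ : Module.Dual ℂ V) (v : V) :
    FormalSeries (Var n) :=
  fun m => ξ (((List.finRange r).map fun α =>
    ((List.finRange (n α)).map fun i => e α (-m ⟨α, i⟩)).prod).prod • v)

section Properties

variable {r : ℕ} (a : Fin r → Fin r → ℤ) (d : Fin r → ℕ) (q : ℂ) (n : Fin r → ℕ)

open Classical in
/-- `∏_α ∏_{i < j in I_α} (z_i^{(α)} - z_j^{(α)})`. -/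
def numer : Laurent (Var n) :=
  ∏ p : Var n × Var n with Before p.1 p.2 ∧ p.1.1 = p.2.1, (Z p.1 - Z p.2)

open Classical in
/-- The product of the `q_α^{a_{αβ}} z_i^{(α)} - z_j^{(β)}` over `i ∈ I_α`, `j ∈ I_β`, with
`α < β`, or `α = β` and `i < j`. -/
def denom : Laurent (Var n) :=
  ∏ p : Var n × Var n with Before p.1 p.2, (qExp a d q p.1.1 p.2.1 • Z p.1 - Z p.2)

open Classical in
/-- The same product, restricted to the `α`, `β` with `a_{αβ} ≠ 0`. -/
def denomNonzero : Laurent (Var n) :=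
  ∏ p : Var n × Var n with Before p.1 p.2 ∧ a p.1.1 p.2.1 ≠ 0,
    (qExp a d q p.1.1 p.2.1 • Z p.1 - Z p.2)

variable {n}

/-- The vanishing condition for a pair `α ≠ β` of simple roots: `A = 0` at all points of
the torus such that
`z_{i_1}^{(α)} = q_α^2 z_{i_2}^{(α)} = ⋯ = q_α^{-2 a_{αβ}} z_{i_{1 - a_{αβ}}}^{(α)}
  = q_α^{-a_{αβ}} z_j^{(β)}`,
for pairwise different `i_1, …, i_{1 - a_{αβ}}` in `I_α`, and `j` in `I_β`. -/
def VanishesFor (A : Laurent (Var n)) (α β : Fin r) : Prop :=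
  ∀ (i : Fin (1 - a α β).toNat → Fin (n α)) (j : Fin (n β)), Function.Injective i →
    ∀ z : Var n → ℂˣ,
      (∀ t : Fin (1 - a α β).toNat, (q ^ d α) ^ (2 * (t : ℕ)) * (z ⟨α, i t⟩ : ℂ) =
        (q ^ d α) ^ (-a α β) * (z ⟨β, j⟩ : ℂ)) →
      A.value z = 0

/-- Invariance under the permutations of the variables `(z_i^{(α)})_{i ∈ I_α}`, for each `α`. -/
def IsColorSymmetric (A : Laurent (Var n)) : Prop :=
  ∀ σ : Equiv.Perm (Var n), (∀ x, (σ x).1 = x.1) → permute σ A = A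

/-- Twisted symmetry of a rational function, for neighbouring variables `z_i^{(α)}`,
`z_{i+1}^{(α)}` of the same colour: with `σ` the interchange of these two variables,
`(q_α^2 z_i - z_{i+1}) R = (z_i - q_α^2 z_{i+1}) (σ R)`. -/
def IsTwistedSymmetric (R : RatFun (Var n)) : Prop :=
  ∀ (α : Fin r) (i j : Fin (n α)), (j : ℕ) = (i : ℕ) + 1 →
    algebraMap (Laurent (Var n)) (RatFun (Var n))
        ((q ^ d α) ^ 2 • Z ⟨α, i⟩ - Z ⟨α, j⟩) * R =
      algebraMap (Laurent (Var n)) (RatFun (Var n))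
        (Z ⟨α, i⟩ - (q ^ d α) ^ 2 • Z ⟨α, j⟩) *
          permuteRat (Equiv.swap (⟨α, i⟩ : Var n) ⟨α, j⟩) R

/-- The functional properties of a correlation function `f`. -/
structure HasCorrelationProperties (f : FormalSeries (Var n)) : Prop where
  /-- `f` is an iterated Laurent series. -/
  iteratedLaurent : IsIteratedLaurent f
  /-- `f` is the expansion of a rational function `R`, which is regular on the torus except for at
  most simple poles at the shifted diagonals, and which is twisted symmetric; `R` has the form
  `(numer / denom) A`, where the Laurent polynomial `A` is symmetric in each group of variables and
  satisfies all the vanishing conditions, and also the form `(numer / denomNonzero) B`, where `B`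
  is a Laurent polynomial satisfying the vanishing conditions with `a_{αβ} ≠ 0`. -/
  rational : ∃ R : RatFun (Var n), IsExpansionOf f R ∧
    (∃ P : Laurent (Var n),
      R = algebraMap (Laurent (Var n)) (RatFun (Var n)) P /
        algebraMap (Laurent (Var n)) (RatFun (Var n)) (denom a d q n)) ∧
    IsTwistedSymmetric d q R ∧
    (∃ A : Laurent (Var n),
      R = algebraMap (Laurent (Var n)) (RatFun (Var n)) (numer n) /
          algebraMap (Laurent (Var n)) (RatFun (Var n)) (denom a d q n) *
        algebraMap (Laurent (Var n)) (RatFun (Var n)) A ∧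
      IsColorSymmetric A ∧
      ∀ α β, α ≠ β → VanishesFor a d q A α β) ∧
    (∃ B : Laurent (Var n),
      R = algebraMap (Laurent (Var n)) (RatFun (Var n)) (numer n) /
          algebraMap (Laurent (Var n)) (RatFun (Var n)) (denomNonzero a d q n) *
        algebraMap (Laurent (Var n)) (RatFun (Var n)) B ∧
      ∀ α β, α ≠ β → a α β ≠ 0 → VanishesFor a d q B α β)

end Properties

end DrinfeldCurrents

end

noncomputable section

namespace DrinfeldCurrents

universe u v

/-! ### Evaluation of Laurent polynomials -/

section Evaluation

variable {ι : Type} {R : Type*} [CommRing R] [Algebra ℂ R]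

/-! All orders of the factors are considered at once. For a word `l` in the variables, the series
`wordCorr` of matrix coefficients is multiplied by the product `wordDenom` of the linear forms
attached to the pairs of letters. The vertex relation says exactly that exchanging two neighbouring
letters changes the sign of this product (`wordNumer_swap`), so up to sign it does not depend on the
word (`exists_wordNumer_eq`). With `z_x` in the rightmost place, smoothness bounds its exponents
from below. This applies to every `x`, and homogeneity fixes the total degree, so the product is a
Laurent polynomial `P` (`exists_coeff_eq_wordNumer`). It is antisymmetric in the variables of one
colour, hence divisible by `numer`, with symmetric quotient `A`.

The vanishing conditions come from the Serre relations. If `e_α[k]` kills `w`, a single term of the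
relation with all modes of `α` equal to `k` survives on `w`, whence `e_α[k]^N e_β[l] w = 0`
(`pow_apply_apply_eq_zero_of_serre`). Put the variables of the condition at the right end of the
word: the coefficients in which the exponents of the `z_{i_t}` are equal and very negative then
vanish. On the other hand, the series has simple poles along a chain of linear forms. Expanding pole
after pole shows that, after multiplication by the denominators outside the chain, it agrees at low
exponents with a nonzero multiple of the remaining numerator times a delta function carried by the
locus (`chain_expansion`). The linear forms of the chain spread the Serre vanishing to all low
exponents (`vanishBelow_of_chain`), so the delta term is zero there, and the numerator vanishes on
the locus (`value_eq_zero_of_chain`). Linear forms are cancelled from series because of the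
direction of expansion, not because they are nonzero at the points in question; no genericity of `q`
is needed. The leftover differences of variables are cancelled because the locus is irreducible
(`locusCancelable`).

When `a α β = 0`, the condition says that `A` vanishes on `z_i^{(α)} = z_j^{(β)}`. The corresponding
forms are those missing from `denomNonzero`, and dividing them out gives `B`.

Both kinds of modules enter through `IsSmoothAction` and homogeneity only. In a highest weight
module, smoothness spreads from the generating vector by the defining relations
(`IsSmoothVector.gen`). -/

instance : IsDomain (Laurent ι) := NoZeroDivisors.to_isDomain _

section Fintype

variable [Fintype ι]

/-- The algebra homomorphism sending the variable `z_x` to the unit `g x`. -/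
def evalUnits (g : ι → Rˣ) : Laurent ι →ₐ[ℂ] R :=
  AddMonoidAlgebra.lift ℂ R (ι → ℤ)
    { toFun := fun m => ((∏ x, g x ^ (m.toAdd x) : Rˣ) : R)
      map_one' := by simp
      map_mul' := fun m k => by
        rw [← Units.val_mul, ← Finset.prod_mul_distrib]
        simp only [toAdd_mul, Pi.add_apply, zpow_add] }

theorem evalUnits_single (g : ι → Rˣ) (m : ι → ℤ) (c : ℂ) :
    evalUnits g (AddMonoidAlgebra.single m c) = c • ((∏ x, g x ^ m x : Rˣ) : R) := by
  simp [evalUnits, AddMonoidAlgebra.lift_single]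

theorem evalUnits_Z [DecidableEq ι] (g : ι → Rˣ) (x : ι) : evalUnits g (Z x) = g x := by
  rw [Z, evalUnits_single, one_smul, Finset.prod_eq_single x] <;> simp +contextual

theorem evalUnits_eq_value (z : ι → ℂˣ) (P : Laurent ι) : evalUnits z P = P.value z := by
  simp [evalUnits, AddMonoidAlgebra.lift_apply, Laurent.value]

theorem value_mul (z : ι → ℂˣ) (P Q : Laurent ι) : (P * Q).value z = P.value z * Q.value z := by
  simp only [← evalUnits_eq_value, map_mul]

theorem value_neg (z : ι → ℂˣ) (P : Laurent ι) : (-P).value z = -P.value z := by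
  simp only [← evalUnits_eq_value, map_neg]

theorem value_Z_sub [DecidableEq ι] (z : ι → ℂˣ) (x y : ι) :
    (Z x - Z y : Laurent ι).value z = z x - z y := by
  simp only [← evalUnits_eq_value, map_sub, evalUnits_Z]

/-- A Laurent polynomial which vanishes on the torus is zero. -/
theorem eq_zero_of_value_eq_zero [DecidableEq ι] (P : Laurent ι)
    (h : ∀ z : ι → ℂˣ, P.value z = 0) : P = 0 := by
  -- Monomials are characters of the torus. Different exponents give different characters, as
  -- evaluation at 2 in one coordinate shows, so Dedekind's theorem makes them linearly independent.
  let χ : (ι → ℤ) → ((ι → ℂˣ) →* ℂ) := fun m =>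
    { toFun := fun z => ((∏ x, z x ^ m x : ℂˣ) : ℂ)
      map_one' := by simp
      map_mul' := fun z w => by simp [mul_zpow, Finset.prod_mul_distrib] }
  have hχ : Function.Injective χ := by
    intro m k hmk
    ext x
    let t : ℂˣ := Units.mk0 2 two_ne_zero
    have := DFunLike.congr_fun hmk (Pi.mulSingle x t)
    simp only [χ, MonoidHom.coe_mk, OneHom.coe_mk] at this
    rw [Finset.prod_eq_single x, Finset.prod_eq_single x] at this
    · simp only [Pi.mulSingle_eq_same, Units.val_zpow_eq_zpow_val, t, Units.val_mk0] at this
      have h2 : ((2 : ℝ) : ℂ) ^ m x = ((2 : ℝ) : ℂ) ^ k x := by simpa using this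
      rw [← Complex.ofReal_zpow, ← Complex.ofReal_zpow] at h2
      exact zpow_right_injective₀ (by norm_num) (by norm_num) (Complex.ofReal_injective h2)
    all_goals simp +contextual
  have li := (linearIndependent_monoidHom (ι → ℂˣ) ℂ).comp χ hχ
  rw [linearIndependent_iff] at li
  have := li P.coeff (by
    ext z
    have := h z
    simp only [Laurent.value, Finsupp.sum] at this
    simp only [Finsupp.linearCombination_apply, Finsupp.sum, Function.comp, Finset.sum_apply,
      Pi.smul_apply, smul_eq_mul, Pi.zero_apply, χ, MonoidHom.coe_mk, OneHom.coe_mk,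
      Units.coe_prod]
    exact this)
  exact AddMonoidAlgebra.coeff_eq_zero.1 this

end Fintype

/-- The variable `z_x` as a unit. -/
def unitZ [DecidableEq ι] (x : ι) : (Laurent ι)ˣ :=
  (AddMonoidAlgebra.of ℂ (ι → ℤ)).toHomUnits (Multiplicative.ofAdd (Pi.single x 1))

theorem val_unitZ [DecidableEq ι] (x : ι) : (unitZ x : Laurent ι) = Z x := rfl

/-- Every monomial is a product of integer powers of variables; comparing in the groups of units
takes care of the negative powers. -/
theorem algHom_ext_Z [Finite ι] [DecidableEq ι] {φ ψ : Laurent ι →ₐ[ℂ] R}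
    (h : ∀ x, φ (Z x) = ψ (Z x)) : φ = ψ := by
  have := Fintype.ofFinite ι
  refine AddMonoidAlgebra.algHom_ext (fun m => ?_) (Subsingleton.elim _ _)
  have hm : Multiplicative.ofAdd m =
      ∏ x, (Multiplicative.ofAdd (Pi.single x (1 : ℤ) : ι → ℤ)) ^ (m x) := by
    apply Multiplicative.toAdd.injective
    rw [toAdd_prod]
    ext y
    simp [Finset.sum_apply, Pi.single_apply]
  have key : (Units.map (φ : Laurent ι →* R)).comp (AddMonoidAlgebra.of ℂ (ι → ℤ)).toHomUnits
        (.ofAdd m) =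
      (Units.map (ψ : Laurent ι →* R)).comp (AddMonoidAlgebra.of ℂ (ι → ℤ)).toHomUnits
        (.ofAdd m) := by
    rw [hm, map_prod, map_prod]
    refine Finset.prod_congr rfl fun x _ => ?_
    rw [map_zpow, map_zpow]
    congr 1
    exact Units.ext (h x)
  exact congrArg Units.val key

theorem permute_Z [DecidableEq ι] (σ : Equiv.Perm ι) (x : ι) :
    permute σ (Z x : Laurent ι) = Z (σ x) := by
  rw [permute, Z, AddMonoidAlgebra.domCongr_single, Z]
  congr 1
  ext y
  simp [AddEquiv.arrowCongr, Pi.single_apply, Equiv.symm_apply_eq]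

theorem permute_coeff (σ : Equiv.Perm ι) (P : Laurent ι) (m : ι → ℤ) :
    (permute σ P).coeff m = P.coeff (m ∘ σ) := by
  rw [permute, AddMonoidAlgebra.coeff_domCongr]
  rfl

theorem value_permute [Fintype ι] [DecidableEq ι] (σ : Equiv.Perm ι) (P : Laurent ι)
    (z : ι → ℂˣ) : (permute σ P).value z = P.value (z ∘ σ) := by
  have : (evalUnits z).comp (permute σ : Laurent ι →ₐ[ℂ] Laurent ι) = evalUnits (z ∘ σ) :=
    algHom_ext_Z fun x => by
      change evalUnits z (permute σ (Z x)) = _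
      rw [permute_Z, evalUnits_Z, evalUnits_Z]; rfl
  rw [← evalUnits_eq_value, ← evalUnits_eq_value, ← this]
  rfl

end Evaluation

/-! ### Divisibility by linear forms -/

section Divisibility

variable {ι : Type} [Fintype ι] [DecidableEq ι]

/-- Substituting `z_x` for `z_y` kills `P`, because a Laurent polynomial is determined by its
values. Modulo the ideal of `z_x - z_y` this substitution is the identity, so `P` lies in that
ideal. -/
theorem Z_sub_dvd_iff (x y : ι) (P : Laurent ι) :
    Z x - Z y ∣ P ↔ ∀ z : ι → ℂˣ, z x = z y → P.value z = 0 := by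
  constructor
  · rintro ⟨Q, rfl⟩ z hz
    rw [value_mul, value_Z_sub, hz, sub_self, zero_mul]
  · intro h
    let φ : Laurent ι →ₐ[ℂ] Laurent ι := evalUnits fun t => if t = y then unitZ x else unitZ t
    have hφ : φ P = 0 := by
      refine eq_zero_of_value_eq_zero _ fun z => ?_
      have : (evalUnits z).comp φ = evalUnits fun t => if t = y then z x else z t := by
        refine algHom_ext_Z fun t => ?_
        rw [AlgHom.comp_apply, evalUnits_Z, evalUnits_Z]
        split_ifs <;> rw [val_unitZ, evalUnits_Z]
      rw [← evalUnits_eq_value, ← AlgHom.comp_apply, this, evalUnits_eq_value]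
      apply h
      simp
    have hq : ((Ideal.Quotient.mkₐ ℂ (Ideal.span {(Z x - Z y : Laurent ι)})).comp φ) =
        Ideal.Quotient.mkₐ ℂ _ := by
      refine algHom_ext_Z fun t => ?_
      rw [AlgHom.comp_apply, evalUnits_Z]
      split_ifs with ht
      · rw [val_unitZ, ht, Ideal.Quotient.mkₐ_eq_mk, Ideal.Quotient.eq]
        exact Ideal.mem_span_singleton_self _
      · rw [val_unitZ]
    have := DFunLike.congr_fun hq P
    rw [AlgHom.comp_apply, hφ, map_zero, Ideal.Quotient.mkₐ_eq_mk, eq_comm,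
      Ideal.Quotient.eq_zero_iff_mem, Ideal.mem_span_singleton] at this
    exact this

/-- If the product of two Laurent polynomials vanishes on the points `z` with `z_x = λ_x z_{π x}`,
so does one of them. -/
theorem value_eq_zero_or_of_mul (π : ι → ι) (c : ι → ℂˣ) {P Q : Laurent ι}
    (h : ∀ z : ι → ℂˣ, (P * Q).value (fun x => c x * z (π x)) = 0) :
    (∀ z : ι → ℂˣ, P.value (fun x => c x * z (π x)) = 0) ∨
      ∀ z : ι → ℂˣ, Q.value (fun x => c x * z (π x)) = 0 := by
  -- Pulling back along the parametrization of these points reduces the claim to the absence of zero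
  -- divisors in the ring of Laurent polynomials.
  let φ : Laurent ι →ₐ[ℂ] Laurent ι := evalUnits fun t =>
    Units.map (algebraMap ℂ (Laurent ι)).toMonoidHom (c t) * unitZ (π t)
  have hφ : ∀ (S : Laurent ι) (z : ι → ℂˣ),
      (φ S).value z = S.value (fun x => c x * z (π x)) := by
    intro S z
    have : (evalUnits z).comp φ = evalUnits (fun x => c x * z (π x)) := by
      refine algHom_ext_Z fun t => ?_
      rw [AlgHom.comp_apply, evalUnits_Z, evalUnits_Z, Units.val_mul, map_mul, val_unitZ,
        evalUnits_Z, Units.val_mul]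
      congr 1
      exact (evalUnits z).commutes _
    rw [← evalUnits_eq_value, ← AlgHom.comp_apply, this, evalUnits_eq_value]
  have h0 : φ P * φ Q = 0 := by
    rw [← map_mul]
    exact eq_zero_of_value_eq_zero _ fun z => by rw [hφ, h]
  refine (mul_eq_zero.1 h0).imp ?_ ?_ <;>
  · intro h z
    rw [← hφ, h, ← evalUnits_eq_value, map_zero]

theorem linear_ne_zero {x y : ι} (hxy : x ≠ y) (c : ℂ) : (c • Z x - Z y : Laurent ι) ≠ 0 := by
  intro h
  have h1 := congrArg (fun P => evalUnits (R := ℂ) (Function.update 1 y (Units.mk0 2 two_ne_zero)) P) h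
  have h2 := congrArg (fun P => evalUnits (R := ℂ) 1 P) h
  simp only [map_sub, map_smul, evalUnits_Z, map_zero, Function.update_self,
    Function.update_of_ne hxy, Pi.one_apply, Units.val_one, Units.val_mk0] at h1 h2
  have := h1.trans h2.symm
  norm_num at this

/-- The diagonal `z_x = z_y` is parametrized by a torus, hence irreducible. -/
theorem Z_sub_prime {x y : ι} (hxy : x ≠ y) : Prime (Z x - Z y : Laurent ι) := by
  refine ⟨by simpa using linear_ne_zero hxy 1, ?_, ?_⟩
  · intro h
    have := (Z_sub_dvd_iff x y 1).1 (isUnit_iff_dvd_one.1 h) 1 rfl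
    rw [← evalUnits_eq_value, map_one] at this
    exact one_ne_zero this
  · intro P Q h
    simp only [Z_sub_dvd_iff] at h ⊢
    let π : ι → ι := fun t => if t = y then x else t
    have hπ : ∀ z : ι → ℂˣ, z x = z y → (fun t => (1 : ι → ℂˣ) t * z (π t)) = z := by
      intro z hz
      ext t
      by_cases ht : t = y <;> simp [π, ht, hz]
    refine (value_eq_zero_or_of_mul π 1 (P := P) (Q := Q) fun z => h _ ?_).imp ?_ ?_
    · simp [π]
    all_goals
      intro h z hz
      have := h z
      rwa [hπ z hz] at this

/-- A Laurent polynomial which is divisible by several different `z_x - z_y` is divisible by their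
product. -/
theorem prod_Z_sub_dvd (s : Finset (ι × ι)) (P : Laurent ι) (hne : ∀ p ∈ s, p.1 ≠ p.2)
    (hs : ∀ p ∈ s, p.swap ∉ s) (h : ∀ p ∈ s, Z p.1 - Z p.2 ∣ P) :
    ∏ p ∈ s, (Z p.1 - Z p.2) ∣ P := by
  induction s using Finset.induction_on with
  | empty => simp
  | insert p s hp ih =>
    obtain ⟨Q, hQ⟩ := ih (fun p hp => hne p (Finset.mem_insert_of_mem hp))
      (fun p hp hp' => hs p (Finset.mem_insert_of_mem hp) (Finset.mem_insert_of_mem hp'))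
      (fun p hp => h p (Finset.mem_insert_of_mem hp))
    have hpp := Z_sub_prime (hne p (Finset.mem_insert_self p s))
    rw [Finset.prod_insert hp, hQ, mul_comm]
    refine mul_dvd_mul_left _ (((hQ ▸ h p (Finset.mem_insert_self p s) :
      Z p.1 - Z p.2 ∣ (∏ p ∈ s, (Z p.1 - Z p.2)) * Q) |> hpp.dvd_or_dvd).resolve_left ?_)
    intro hd
    obtain ⟨r, hr, hd⟩ := hpp.exists_mem_finset_dvd hd
    rw [Z_sub_dvd_iff] at hd
    have h1 := hne p (Finset.mem_insert_self p s)
    have h2 := hne r (Finset.mem_insert_of_mem hr)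
    have h3 := hs p (Finset.mem_insert_self p s)
    let t : ℂˣ := Units.mk0 2 two_ne_zero
    have ht : (2 : ℂ) ≠ 1 := by norm_num
    have hrp : r ≠ p := fun h => hp (h ▸ hr)
    have hrp' : r ≠ p.swap := fun h => h3 (h ▸ Finset.mem_insert_of_mem hr)
    -- Some coordinate of `r` lies outside `p`. The point with 2 there and 1 elsewhere is on the
    -- diagonal of `p` but not on that of `r`.
    by_cases hr1 : r.1 = p.1 ∨ r.1 = p.2
    · have hr2 : r.2 ≠ p.1 ∧ r.2 ≠ p.2 := by
        constructor <;> intro h <;> rcases hr1 with h' | h'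
        · exact h2 (h'.trans h.symm)
        · exact hrp' (Prod.ext h' h)
        · exact hrp (Prod.ext h' h)
        · exact h2 (h'.trans h.symm)
      have := hd (Function.update 1 r.2 t) (by
        rw [Function.update_of_ne hr2.1.symm, Function.update_of_ne hr2.2.symm]; rfl)
      rw [value_Z_sub, Function.update_self, Function.update_of_ne h2] at this
      exact ht (sub_eq_zero.1 this).symm
    · push Not at hr1
      have := hd (Function.update 1 r.1 t) (by
        rw [Function.update_of_ne hr1.1.symm, Function.update_of_ne hr1.2.symm]; rfl)
      rw [value_Z_sub, Function.update_self, Function.update_of_ne h2.symm] at this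
      exact ht (sub_eq_zero.1 this)

end Divisibility

/-! ### The action of Laurent polynomials on formal series -/

section Action

variable {ι : Type}

/-- The action of Laurent polynomials on formal series. -/
def act : Laurent ι →ₐ[ℂ] Module.End ℂ (FormalSeries ι) :=
  AddMonoidAlgebra.lift ℂ _ (ι → ℤ)
    { toFun := fun k =>
        { toFun := fun f m => f (m - k.toAdd)
          map_add' := fun _ _ => rfl
          map_smul' := fun _ _ => rfl }
      map_one' := by ext; simp
      map_mul' := fun k l => by
        ext f m
        simp [sub_sub] }

theorem act_single (k : ι → ℤ) (c : ℂ) (f : FormalSeries ι) (m : ι → ℤ) :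
    act (AddMonoidAlgebra.single k c) f m = c * f (m - k) := by
  simp [act, AddMonoidAlgebra.lift_single]

theorem act_apply (P : Laurent ι) (f : FormalSeries ι) (m : ι → ℤ) :
    act P f m = ∑ k ∈ P.coeff.support, P.coeff k * f (m - k) := by
  simp [act, AddMonoidAlgebra.lift_apply, Finsupp.sum]

theorem act_eq_mulSeries (P : Laurent ι) (f : FormalSeries ι) : act P f = mulSeries P f := by
  ext m
  rw [act_apply]
  rfl

theorem act_mul (P Q : Laurent ι) (f : FormalSeries ι) : act (P * Q) f = act P (act Q f) := by
  rw [map_mul]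
  rfl

theorem act_one_series [DecidableEq (ι → ℤ)] (P : Laurent ι) :
    act P (Pi.single 0 1) = P.coeff := by
  ext m
  rw [act_apply, Finset.sum_eq_single m]
  · simp
  · intro k _ hk
    rw [Pi.single_eq_of_ne (sub_ne_zero.2 hk.symm), mul_zero]
  · intro hm
    simp only [Finsupp.mem_support_iff, not_not] at hm
    rw [hm, zero_mul]

theorem act_linear [DecidableEq ι] (c : ℂ) (x y : ι) (f : FormalSeries ι) (m : ι → ℤ) :
    act (c • Z x - Z y) f m = c * f (m - Pi.single x 1) - f (m - Pi.single y 1) := by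
  rw [map_sub, map_smul, LinearMap.sub_apply, LinearMap.smul_apply, Pi.sub_apply, Pi.smul_apply,
    Z, Z, act_single, act_single, one_mul, one_mul, smul_eq_mul]

theorem act_eq_zero {P : Laurent ι} {f : FormalSeries ι} {m : ι → ℤ}
    (h : ∀ k ∈ P.coeff.support, f (m - k) = 0) : act P f m = 0 := by
  rw [act_apply]
  exact Finset.sum_eq_zero fun k hk => by rw [h k hk, mul_zero]

theorem exists_support_bound [Fintype ι] (P : Laurent ι) :
    ∃ L : ℤ, 0 ≤ L ∧ ∀ k ∈ P.coeff.support, ∀ x, |k x| ≤ L := by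
  refine ⟨∑ k ∈ P.coeff.support, ∑ x, |k x|, by positivity, fun k hk x => ?_⟩
  calc |k x| ≤ ∑ x, |k x| :=
        Finset.single_le_sum (f := fun x => |k x|) (fun _ _ => abs_nonneg _) (Finset.mem_univ x)
    _ ≤ _ := Finset.single_le_sum (f := fun k : ι → ℤ => ∑ x, |k x|)
        (fun _ _ => by positivity) hk

/-! ### Series vanishing at low exponents, and cancellation of linear forms -/

/-- The coefficients of `f` vanish as soon as the exponents of all the `z_x`, `x ∈ S`, are small. -/
def VanishBelow (S : Set ι) (f : FormalSeries ι) : Prop :=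
  ∃ B : ℤ, ∀ m : ι → ℤ, (∀ x ∈ S, m x < B) → f m = 0

theorem VanishBelow.mono {S T : Set ι} (h : S ⊆ T) {f : FormalSeries ι} (hf : VanishBelow S f) :
    VanishBelow T f :=
  hf.imp fun _ hB m hm => hB m fun x hx => hm x (h hx)

theorem VanishBelow.act [Fintype ι] {S : Set ι} {f : FormalSeries ι} (hf : VanishBelow S f)
    (P : Laurent ι) : VanishBelow S (act P f) := by
  obtain ⟨B, hB⟩ := hf
  obtain ⟨L, -, hL⟩ := exists_support_bound P
  refine ⟨B - L, fun m hm => act_eq_zero fun k hk => hB _ fun x hx => ?_⟩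
  have := (abs_le.1 (hL k hk x)).1
  have := hm x hx
  simp only [Pi.sub_apply]
  omega

theorem VanishBelow.add {S : Set ι} {f g : FormalSeries ι} (hf : VanishBelow S f)
    (hg : VanishBelow S g) : VanishBelow S (f + g) := by
  obtain ⟨B, hB⟩ := hf
  obtain ⟨B', hB'⟩ := hg
  refine ⟨min B B', fun m hm => ?_⟩
  rw [Pi.add_apply, hB m fun x hx => (hm x hx).trans_le (min_le_left _ _),
    hB' m fun x hx => (hm x hx).trans_le (min_le_right _ _), add_zero]

theorem VanishBelow.smul {S : Set ι} {f : FormalSeries ι} (hf : VanishBelow S f) (c : ℂ) :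
    VanishBelow S (c • f) :=
  hf.imp fun _ hB m hm => by rw [Pi.smul_apply, hB m hm, smul_zero]

theorem VanishBelow.sub {S : Set ι} {f g : FormalSeries ι} (hf : VanishBelow S f)
    (hg : VanishBelow S g) : VanishBelow S (f - g) := by
  simpa [sub_eq_add_neg] using hf.add (hg.smul (-1))

variable [DecidableEq ι]

/-- The coefficients of `f` vanish far out in the direction `z_a / z_b`. -/
def DecaysAlong (a b : ι) (f : FormalSeries ι) : Prop :=
  ∀ m : ι → ℤ, ∃ T : ℕ, ∀ t : ℕ, T ≤ t → f (m + t • (Pi.single a 1 - Pi.single b 1)) = 0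

theorem DecaysAlong.act {a b : ι} {f : FormalSeries ι} (hf : DecaysAlong a b f) (P : Laurent ι) :
    DecaysAlong a b (act P f) := by
  intro m
  choose T hT using hf
  refine ⟨∑ k ∈ P.coeff.support, T (m - k), fun t ht => act_eq_zero fun k hk => ?_⟩
  rw [add_sub_right_comm]
  exact hT _ _ ((Finset.single_le_sum (f := fun k => T (m - k)) (fun _ _ => Nat.zero_le _) hk).trans
    ht)

theorem DecaysAlong.add {a b : ι} {f g : FormalSeries ι} (hf : DecaysAlong a b f)
    (hg : DecaysAlong a b g) : DecaysAlong a b (f + g) := by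
  intro m
  obtain ⟨T, hT⟩ := hf m
  obtain ⟨T', hT'⟩ := hg m
  exact ⟨max T T', fun t ht => by
    rw [Pi.add_apply, hT t ((le_max_left _ _).trans ht), hT' t ((le_max_right _ _).trans ht),
      add_zero]⟩

theorem DecaysAlong.smul {a b : ι} {f : FormalSeries ι} (hf : DecaysAlong a b f) (c : ℂ) :
    DecaysAlong a b (c • f) := fun m =>
  (hf m).imp fun _ hT t ht => by rw [Pi.smul_apply, hT t ht, smul_zero]

theorem DecaysAlong.sub {a b : ι} {f g : FormalSeries ι} (hf : DecaysAlong a b f)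
    (hg : DecaysAlong a b g) : DecaysAlong a b (f - g) := by
  simpa [sub_eq_add_neg] using hf.add (hg.smul (-1))

/-- The coefficients of the product with `c z_a - z_b` compare `f` at neighbouring points of a line
in the direction `z_a / z_b`; where they vanish, `f` is geometric with ratio `c` along that line. -/
theorem eq_of_act_linear_eq_zero {a b : ι} {c : ℂ} {f : FormalSeries ι} {m : ι → ℤ} (t : ℕ)
    (h : ∀ s < t, act (c • Z a - Z b) f
      (m + s • (Pi.single a 1 - Pi.single b 1) + Pi.single a 1) = 0) :
    f (m + t • (Pi.single a 1 - Pi.single b 1)) = c ^ t * f m := by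
  induction t with
  | zero => simp
  | succ t ih =>
    have h1 := h t (Nat.lt_succ_self t)
    rw [act_linear, add_sub_cancel_right, ih fun s hs => h s (hs.trans (Nat.lt_succ_self t)),
      sub_eq_zero] at h1
    rw [pow_succ', mul_assoc, h1, succ_nsmul]
    congr 1
    abel

/-- Moving in the direction `z_a / z_b` raises no exponent in `S`, since `a ∉ S`. The geometric
recursion is therefore valid along the whole ray, and the decay at its far end forces the initial
coefficient to vanish. -/
theorem VanishBelow.of_act_linear {S : Set ι} {a b : ι} {c : ℂ} {f : FormalSeries ι} (hc : c ≠ 0)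
    (ha : a ∉ S) (hf : DecaysAlong a b f) (h : VanishBelow S (DrinfeldCurrents.act (c • Z a - Z b) f)) :
    VanishBelow S f := by
  obtain ⟨B, hB⟩ := h
  refine ⟨B, fun m hm => ?_⟩
  obtain ⟨T, hT⟩ := hf m
  have := eq_of_act_linear_eq_zero (a := a) (b := b) (c := c) (f := f) (m := m) T
    fun s _ => hB _ fun x hx => by
      have hxa : x ≠ a := fun h => ha (h ▸ hx)
      have h1 := hm x hx
      have h2 : 0 ≤ (Pi.single b 1 : ι → ℤ) x := by
        by_cases h : x = b
        · subst h; simp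
        · simp [h]
      simp only [Pi.add_apply, Pi.smul_apply, Pi.sub_apply, Pi.single_eq_of_ne hxa, zero_sub,
        add_zero]
      rw [nsmul_eq_mul]
      nlinarith [Int.natCast_nonneg s]
  rw [hT T le_rfl, eq_comm, mul_eq_zero] at this
  exact this.resolve_left (pow_ne_zero _ hc)

/-- The Laurent polynomials which can be cancelled, modulo series vanishing at low exponents in
`S`, from series which decay in the directions given by the relation `r`. -/
def cancelable (r : ι → ι → Prop) (S : Set ι) : Submonoid (Laurent ι) where
  carrier := {Q | ∀ f : FormalSeries ι, (∀ a b, r a b → DecaysAlong a b f) →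
    VanishBelow S (act Q f) → VanishBelow S f}
  one_mem' := fun f _ h => by simpa using h
  mul_mem' := fun {P Q} hP hQ f hf h => by
    rw [act_mul] at h
    exact hQ f hf (hP _ (fun a b hab => (hf a b hab).act Q) h)

theorem linear_mem_cancelable {r : ι → ι → Prop} {S : Set ι} {a b : ι} {c : ℂ} (hc : c ≠ 0)
    (ha : a ∉ S) (hab : r a b) : c • Z a - Z b ∈ cancelable r S :=
  fun _ hf h => VanishBelow.of_act_linear hc ha (hf a b hab) h

theorem Z_sub_mem_cancelable {r : ι → ι → Prop} {S : Set ι} {a b : ι}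
    (ha : a ∉ S) (hab : r a b) : (Z a - Z b : Laurent ι) ∈ cancelable r S := by
  simpa using linear_mem_cancelable (c := 1) one_ne_zero ha hab

end Action

/-! ### Chains of simple poles -/

section Chain

variable {ι : Type}

/-- The variables `z 0, …, z k`. -/
def chainBlock (z : ℕ → ι) (k : ℕ) : Set ι := z '' Set.Iic k

/-- The variables `z 1, …, z k`. -/
def chainTail (z : ℕ → ι) (k : ℕ) : Set ι := z '' Set.Ioc 0 k

theorem chainTail_subset_chainBlock (z : ℕ → ι) (k : ℕ) : chainTail z k ⊆ chainBlock z k :=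
  Set.image_mono fun _ h => h.2

theorem chainTail_mono (z : ℕ → ι) {k l : ℕ} (h : k ≤ l) : chainTail z k ⊆ chainTail z l :=
  Set.image_mono fun _ hx => ⟨hx.1, hx.2.trans h⟩

theorem chainBlock_mono (z : ℕ → ι) {k l : ℕ} (h : k ≤ l) : chainBlock z k ⊆ chainBlock z l :=
  Set.image_mono fun _ hx => Set.mem_Iic.2 ((Set.mem_Iic.1 hx).trans h)

theorem mem_chainBlock_succ {z : ℕ → ι} {k : ℕ} {x : ι} :
    x ∈ chainBlock z (k + 1) ↔ x ∈ chainBlock z k ∨ x = z (k + 1) := by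
  simp only [chainBlock, Set.mem_image, Set.mem_Iic]
  constructor
  · rintro ⟨j, hj, rfl⟩
    rcases Nat.le_succ_iff.1 hj with h | h
    · exact .inl ⟨j, h, rfl⟩
    · exact .inr (by rw [h])
  · rintro (⟨j, hj, rfl⟩ | rfl)
    · exact ⟨j, by omega, rfl⟩
    · exact ⟨k + 1, le_rfl, rfl⟩

variable [Fintype ι] [DecidableEq ι]

open Classical in
/-- The delta function supported at the points which are multiples of `ζ` in the variables
`z 0, …, z k`. -/
def chainDelta (z : ℕ → ι) (ζ : ι → ℂˣ) (k : ℕ) : FormalSeries ι := fun m =>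
  if (∀ x, x ∉ chainBlock z k → m x = 0) ∧ ∑ x, m x = -k then
    ∏ x, ((ζ x ^ (-m x) : ℂˣ) : ℂ) else 0

theorem chainDelta_decaysAlong (z : ℕ → ι) (ζ : ι → ℂˣ) (k : ℕ) {a b : ι} (hab : a ≠ b)
    (ha : a ∉ chainBlock z k) : DecaysAlong a b (chainDelta z ζ k) := by
  intro m
  refine ⟨(m a).natAbs + 1, fun t ht => if_neg fun h => ?_⟩
  have := h.1 a ha
  simp only [Pi.add_apply, Pi.smul_apply, Pi.sub_apply, Pi.single_eq_same,
    Pi.single_eq_of_ne hab, sub_zero] at this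
  rw [nsmul_eq_mul, mul_one] at this
  omega

theorem prod_zpow_neg_sub_single (ζ : ι → ℂˣ) (m : ι → ℤ) (y : ι) :
    ∏ x, ((ζ x ^ (-(m - Pi.single y 1 : ι → ℤ) x) : ℂˣ) : ℂ) = ζ y * ∏ x, ((ζ x ^ (-m x) : ℂˣ) : ℂ) := by
  rw [← Units.coe_prod, ← Units.coe_prod, ← Units.val_mul]
  congr 1
  have : ∀ x, ζ x ^ (-(m - Pi.single y 1 : ι → ℤ) x) = ζ x ^ (-m x) * ζ x ^ (Pi.single y 1 : ι → ℤ) x := by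
    intro x
    rw [← zpow_add]
    congr 1
    simp only [Pi.sub_apply]
    ring
  rw [Finset.prod_congr rfl fun x _ => this x, Finset.prod_mul_distrib, mul_comm,
    Finset.prod_eq_single y (f := fun x => ζ x ^ (Pi.single y 1 : ι → ℤ) x)]
  · simp
  · intro x _ hx
    simp [hx]
  · simp

theorem sum_sub_single (m : ι → ℤ) (y : ι) : ∑ x, (m - Pi.single y 1 : ι → ℤ) x = ∑ x, m x - 1 := by
  simp [Finset.sum_sub_distrib]

open Classical in
/-- Half of the delta function: the expansion of a simple pole. -/
theorem act_linear_half_chainDelta {z : ℕ → ι} {ζ : ι → ℂˣ} {k : ℕ} {c : ℂ}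
    (hz : z (k + 1) ∉ chainBlock z k) (hζ : c * ζ (z (k + 1)) = ζ (z k)) :
    act (c • Z (z (k + 1)) - Z (z k))
      (fun m => if m (z (k + 1)) < 0 then chainDelta z ζ (k + 1) m else 0) =
      (ζ (z k) : ℂ) • chainDelta z ζ k := by
  have hne : z (k + 1) ≠ z k := fun h => hz (h ▸ ⟨k, Set.mem_Iic.2 le_rfl, rfl⟩)
  have hzk : z k ∈ chainBlock z (k + 1) := ⟨k, Set.mem_Iic.2 (by omega), rfl⟩
  have hzk1 : z (k + 1) ∈ chainBlock z (k + 1) := ⟨k + 1, Set.mem_Iic.2 le_rfl, rfl⟩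
  have hsupp : ∀ (m : ι → ℤ) (y : ι), y ∈ chainBlock z (k + 1) →
      ((∀ x, x ∉ chainBlock z (k + 1) → (m - Pi.single y 1 : ι → ℤ) x = 0) ↔
        ∀ x, x ∉ chainBlock z (k + 1) → m x = 0) := by
    intro m y hy
    refine forall₂_congr fun x hx => ?_
    have : x ≠ y := fun h => hx (h ▸ hy)
    simp [this]
  have hdelta : ∀ (m : ι → ℤ) (y : ι), y ∈ chainBlock z (k + 1) →
      chainDelta z ζ (k + 1) (m - Pi.single y 1) = ζ y *
        if (∀ x, x ∉ chainBlock z (k + 1) → m x = 0) ∧ ∑ x, m x = -k then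
          ∏ x, ((ζ x ^ (-m x) : ℂˣ) : ℂ) else 0 := by
    intro m y hy
    rw [chainDelta, prod_zpow_neg_sub_single, sum_sub_single]
    have : (∑ x, m x - 1 = -((k + 1 : ℕ) : ℤ)) ↔ ∑ x, m x = -k := by
      push_cast
      constructor <;> intro h <;> linarith
    simp only [hsupp m y hy, this, mul_ite, mul_zero]
  ext m
  rw [act_linear, hdelta m _ hzk1, hdelta m _ hzk]
  simp only [Pi.sub_apply, Pi.single_eq_same, Pi.single_eq_of_ne hne, sub_zero, Pi.smul_apply,
    smul_eq_mul, chainDelta]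
  -- Below exponent 0 of `z (k + 1)` the two terms cancel by `hζ`, above it the cut removes both. At
  -- exponent 0 only one of them survives, and it is the delta function of the shorter chain.
  rcases lt_trichotomy (m (z (k + 1))) 0 with h | h | h
  · rw [if_pos (show m (z (k + 1)) - 1 < 0 by omega), if_pos h, ← mul_assoc, hζ, sub_self, if_neg fun h' =>
      h.ne (h'.1 _ hz), mul_zero]
  · rw [if_pos (show m (z (k + 1)) - 1 < 0 by omega), if_neg (show ¬m (z (k + 1)) < 0 by omega), ← mul_assoc, hζ, sub_zero]
    congr 2
    refine propext (and_congr_left' ⟨fun h' x hx => ?_, fun h' x hx => h' x fun hx' =>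
      hx (mem_chainBlock_succ.2 (.inl hx'))⟩)
    by_cases hxz : x = z (k + 1)
    · rw [hxz, h]
    · exact h' x fun hx' => (mem_chainBlock_succ.1 hx').elim hx hxz
  · rw [if_neg (show ¬m (z (k + 1)) - 1 < 0 by omega), if_neg h.not_gt, if_neg fun h' => h.ne' (h'.1 _ hz)]
    simp

end Chain

/-! ### Linear forms along a chain, and the successive expansion of its poles -/

section Chain

variable {ι : Type} [DecidableEq ι]

/-- The product of the linear forms `c_i z_j - z_i`, `k ≤ i < j ≤ N`. -/
def chainLinear (z : ℕ → ι) (c : ℕ → ℂ) (N k : ℕ) : Laurent ι :=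
  ∏ i ∈ Finset.Ico k N, ∏ j ∈ Finset.Ico (i + 1) (N + 1), (c i • Z (z j) - Z (z i))

/-- The product of the differences `z_j - z_i`, `k < i < j ≤ N`. -/
def chainNumer (z : ℕ → ι) (N k : ℕ) : Laurent ι :=
  ∏ i ∈ Finset.Ico k N, ∏ j ∈ Finset.Ico (i + 2) (N + 1), (Z (z j) - Z (z (i + 1)))

theorem chainLinear_eq (z : ℕ → ι) (c : ℕ → ℂ) {N k : ℕ} (hk : k < N) :
    chainLinear z c N k = (∏ j ∈ Finset.Ico (k + 2) (N + 1), (c k • Z (z j) - Z (z k))) *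
      chainLinear z c N (k + 1) * (c k • Z (z (k + 1)) - Z (z k)) := by
  rw [chainLinear, Finset.prod_eq_prod_Ico_succ_bot hk,
    Finset.prod_eq_prod_Ico_succ_bot (by omega : k + 1 < N + 1), chainLinear]
  ring

theorem chainNumer_eq (z : ℕ → ι) {N k : ℕ} (hk : k < N) :
    chainNumer z N k = (∏ j ∈ Finset.Ico (k + 2) (N + 1), (Z (z j) - Z (z (k + 1)))) *
      chainNumer z N (k + 1) := by
  rw [chainNumer, Finset.prod_eq_prod_Ico_succ_bot hk, chainNumer]

/-- Modulo `c z_x - z_y`, each factor `c z_j - z_y` becomes `c (z_j - z_x)`. In this way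
denominators turn into numerator factors once a pole has been passed. -/
theorem linear_dvd_prod_sub_prod (s : Finset ℕ) (z : ℕ → ι) (c : ℂ) (x y : ι) :
    c • Z x - Z y ∣ (∏ j ∈ s, (c • Z (z j) - Z y) : Laurent ι) -
      c ^ s.card • ∏ j ∈ s, (Z (z j) - Z x) := by
  rw [← Ideal.mem_span_singleton, ← Ideal.Quotient.eq, ← Finset.prod_const, ← Finset.prod_smul,
    map_prod, map_prod]
  refine Finset.prod_congr rfl fun j _ => ?_
  rw [Ideal.Quotient.eq, Ideal.mem_span_singleton]
  refine ⟨1, ?_⟩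
  rw [smul_sub]
  ring

variable [Fintype ι]

/-- On the support the exponent of `z (k + 1)` is zero, hence never negative. The delta function of
one stage thus becomes negligible at the next. -/
theorem chainDelta_vanishBelow {z : ℕ → ι} (ζ : ι → ℂˣ) {k : ℕ} (hz : z (k + 1) ∉ chainBlock z k) :
    VanishBelow (chainTail z (k + 1)) (chainDelta z ζ k) :=
  ⟨0, fun _ hm => if_neg fun h => (hm (z (k + 1)) ⟨k + 1, by simp, rfl⟩).ne (h.1 _ hz)⟩

theorem injOn_notMem_chainBlock {z : ℕ → ι} {N k j : ℕ} (hz : Set.InjOn z (Set.Iic N))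
    (hkj : k < j) (hj : j ≤ N) : z j ∉ chainBlock z k := by
  rintro ⟨i, hi, h⟩
  have := hz (Set.mem_Iic.2 ((Set.mem_Iic.1 hi).trans (hkj.le.trans hj))) (Set.mem_Iic.2 hj) h
  exact absurd (Set.mem_Iic.1 hi) (by omega)

theorem chainDelta_zero (z : ℕ → ι) (ζ : ι → ℂˣ) : chainDelta z ζ 0 = Pi.single 0 1 := by
  ext m
  rw [chainDelta, Pi.single_apply]
  have hiff : ((∀ x, x ∉ chainBlock z 0 → m x = 0) ∧ ∑ x, m x = -((0 : ℕ) : ℤ)) ↔ m = 0 := by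
    constructor
    · rintro ⟨h1, h2⟩
      have h3 : ∀ x, x ≠ z 0 → m x = 0 := fun x hx => h1 x (by
        rintro ⟨i, hi, rfl⟩
        exact hx (by rw [Nat.le_zero.1 (Set.mem_Iic.1 hi)]))
      rw [Finset.sum_eq_single (z 0) (fun x _ hx => h3 x hx) (by simp)] at h2
      ext x
      by_cases hx : x = z 0
      · rw [hx, h2]; simp
      · exact h3 x hx
    · rintro rfl
      simp
  simp only [hiff]
  split_ifs with h
  · simp [h]
  · rfl

/-- Since `l` acts on `f` by a negligible series, `T` may be replaced by `γ T'`; then `T'` is a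
common factor of both terms. -/
theorem vanishBelow_act_cancel {S : Set ι} {f δ : FormalSeries ι} {E T T' D M Q l : Laurent ι}
    {γ C : ℂ} (hγ : γ ≠ 0) (hQ : T = l * Q + γ • T')
    (h : VanishBelow S (act (E * (T * D)) f - C • act (T' * M) δ)) (hl : VanishBelow S (act l f)) :
    VanishBelow S (act T' (act (E * D) f - (γ⁻¹ * C) • act M δ)) := by
  have h1 := (h.sub (hl.act (E * Q * D))).smul γ⁻¹
  have h2 : E * (T * D) = E * Q * D * l + γ • (T' * (E * D)) := by
    rw [hQ, add_mul, smul_mul_assoc, mul_add, mul_smul_comm, mul_left_comm E T' D]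
    congr 1
    ring
  have h3 : γ⁻¹ • (act (E * (T * D)) f - C • act (T' * M) δ - act (E * Q * D) (act l f)) =
      act T' (act (E * D) f - (γ⁻¹ * C) • act M δ) := by
    rw [h2, map_add, LinearMap.add_apply, map_smul, LinearMap.smul_apply, act_mul _ l, act_mul T',
      act_mul T', map_sub, map_smul, mul_smul, sub_right_comm, add_sub_cancel_left, smul_sub,
      smul_smul γ⁻¹ γ, inv_mul_cancel₀ hγ, one_smul]
  rwa [h3] at h1

/-- The pole structure of a series with simple poles along a chain of linear forms: modulo series
vanishing at low exponents, it is a delta function. -/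
theorem chain_expansion {z : ℕ → ι} {N : ℕ} (hz : Set.InjOn z (Set.Iic N)) {c : ℕ → ℂ}
    (hc : ∀ k, c k ≠ 0) {ζ : ι → ℂˣ} (hζ : ∀ k < N, c k * ζ (z (k + 1)) = ζ (z k))
    {r : ι → ι → Prop} (hr : ∀ i j, i < j → j ≤ N → r (z j) (z i)) {f : FormalSeries ι}
    (hf : ∀ a b, r a b → DecaysAlong a b f) {E P : Laurent ι}
    (hE : ∀ k ≤ N, E ∈ cancelable r (chainTail z k))
    (h0 : act (E * chainLinear z c N 0) f = (chainNumer z N 0 * P).coeff) {k : ℕ} (hk : k ≤ N) :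
    (∀ j < k, VanishBelow (chainTail z k) (act (c j • Z (z (j + 1)) - Z (z j)) f)) ∧
    ∃ C : ℂ, C ≠ 0 ∧ VanishBelow (chainTail z k) (act (E * chainLinear z c N k) f -
      C • act (chainNumer z N k * P) (chainDelta z ζ k)) := by
  induction k with
  | zero =>
    refine ⟨fun j hj => absurd hj (Nat.not_lt_zero j), 1, one_ne_zero, 0, fun m _ => ?_⟩
    rw [chainDelta_zero, act_one_series, h0]
    simp
  | succ k ih =>
    have hkN : k < N := hk
    obtain ⟨ih1, C, hC, ih2⟩ := ih hkN.le
    have hzk : z (k + 1) ∉ chainBlock z k := injOn_notMem_chainBlock hz k.lt_succ_self hk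
    have htail : ∀ {j l}, l < j → j ≤ N → z j ∉ chainTail z l := fun hlj hj h =>
      injOn_notMem_chainBlock hz hlj hj (chainTail_subset_chainBlock z _ h)
    have hmono := chainTail_mono z k.le_succ
    set lin : Laurent ι := c k • Z (z (k + 1)) - Z (z k) with hlin
    set T : Laurent ι := ∏ j ∈ Finset.Ico (k + 2) (N + 1), (c k • Z (z j) - Z (z k)) with hT
    set T' : Laurent ι := ∏ j ∈ Finset.Ico (k + 2) (N + 1), (Z (z j) - Z (z (k + 1))) with hT'
    set D := chainLinear z c N (k + 1) with hD
    set M := chainNumer z N (k + 1) * P with hM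
    have hTc : T ∈ cancelable r (chainTail z (k + 1)) := Submonoid.prod_mem _ fun j hj => by
      rw [Finset.mem_Ico] at hj
      exact linear_mem_cancelable (hc k) (htail (by omega) (by omega)) (hr _ _ (by omega) (by omega))
    have hDc : D ∈ cancelable r (chainTail z (k + 1)) := Submonoid.prod_mem _ fun i hi =>
      Submonoid.prod_mem _ fun j hj => by
        rw [Finset.mem_Ico] at hi hj
        exact linear_mem_cancelable (hc i) (htail (by omega) (by omega))
          (hr _ _ (by omega) (by omega))
    rw [chainLinear_eq z c hkN, chainNumer_eq z hkN, mul_assoc T' _ P, ← mul_assoc E, act_mul] at ih2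
    -- The old delta term is negligible modulo the longer tail. Cancelling `E`, `T` and `D` leaves
    -- only the new linear form acting on `f`.
    have hnew : VanishBelow (chainTail z (k + 1)) (act lin f) := by
      refine (mul_mem (hE _ hk) (mul_mem hTc hDc)) _ (fun a b hab => (hf a b hab).act _) ?_
      have := (ih2.mono hmono).add
        (((chainDelta_vanishBelow ζ hzk).act (T' * M)).smul C)
      rwa [sub_add_cancel] at this
    refine ⟨fun j hj => ?_, ?_⟩
    · rcases Nat.lt_succ_iff_lt_or_eq.1 hj with h | rfl
      · exact (ih1 j h).mono hmono
      · exact hnew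
    -- The quotient of the old delta function by the linear form: the half of the new delta function
    -- that decays in the same direction as `f`, so that the form can be cancelled.
    set G : FormalSeries ι := fun m => if m (z (k + 1)) < 0 then chainDelta z ζ (k + 1) m else 0
      with hG
    have hGδ : act lin G = (ζ (z k) : ℂ) • chainDelta z ζ k := by
      rw [← act_linear_half_chainDelta hzk (hζ k hkN)]
    set C' : ℂ := C * (ζ (z k) : ℂ)⁻¹ with hC'
    have hC'0 : C' ≠ 0 := mul_ne_zero hC (inv_ne_zero (Units.ne_zero _))
    have hzz : z (k + 1) ≠ z k := fun h => hzk (h ▸ ⟨k, Set.mem_Iic.2 le_rfl, rfl⟩)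
    have hhalf : VanishBelow (chainTail z k) (act (E * (T * D)) f - C' • act (T' * M) G) := by
      refine VanishBelow.of_act_linear (hc k) (htail k.lt_succ_self hk)
        (((hf _ _ (hr k (k + 1) k.lt_succ_self hk)).act _).sub (DecaysAlong.smul (DecaysAlong.act ?_ _) _)) ?_
      · intro m
        refine ⟨(m (z (k + 1))).natAbs, fun t ht => if_neg ?_⟩
        simp only [Pi.add_apply, Pi.smul_apply, Pi.sub_apply, Pi.single_eq_same,
          Pi.single_eq_of_ne hzz, sub_zero]
        rw [nsmul_eq_mul, mul_one]
        omega
      · rw [← hlin, map_sub, map_smul, ← act_mul, ← act_mul, mul_comm lin, mul_comm lin, act_mul,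
          act_mul _ lin, hGδ, map_smul, smul_smul, hC', mul_assoc,
          inv_mul_cancel₀ (Units.ne_zero _), mul_one]
        exact ih2
    -- At low exponents of `z (k + 1)` the cut in `G` is invisible, and the half may be completed to
    -- the full delta function.
    have hfull : VanishBelow (chainTail z (k + 1))
        (act (E * (T * D)) f - C' • act (T' * M) (chainDelta z ζ (k + 1))) := by
      have hGd : VanishBelow (chainTail z (k + 1)) (G - chainDelta z ζ (k + 1)) :=
        ⟨0, fun m hm => by
          rw [Pi.sub_apply, hG]
          simp only [if_pos (hm (z (k + 1)) ⟨k + 1, by simp, rfl⟩), sub_self]⟩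
      have := (hhalf.mono hmono).add ((hGd.act (T' * M)).smul C')
      rwa [map_sub, smul_sub, sub_add_sub_cancel] at this
    -- As the new linear form acts trivially at low exponents, the denominators `T` are there a
    -- multiple of the differences `T'` present in the numerator.
    obtain ⟨Q, hQ⟩ := linear_dvd_prod_sub_prod (Finset.Ico (k + 2) (N + 1)) z (c k) (z (k + 1)) (z k)
    rw [← hT, ← hT', ← hlin, sub_eq_iff_eq_add] at hQ
    set γ : ℂ := c k ^ (Finset.Ico (k + 2) (N + 1)).card with hγ
    have hγ0 : γ ≠ 0 := pow_ne_zero _ (hc k)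
    refine ⟨γ⁻¹ * C', mul_ne_zero (inv_ne_zero hγ0) hC'0, ?_⟩
    -- Cancelling `T'` requires the delta function to decay as well, whence the restriction to
    -- directions `z_a / z_b` with `a` outside its block.
    have hT'c : T' ∈ cancelable (fun a b => r a b ∧ a ≠ b ∧ a ∉ chainBlock z (k + 1))
        (chainTail z (k + 1)) := Submonoid.prod_mem _ fun j hj => by
      rw [Finset.mem_Ico] at hj
      refine Z_sub_mem_cancelable (htail (by omega) (by omega))
        ⟨hr _ _ (by omega) (by omega), fun h => ?_,
          injOn_notMem_chainBlock hz (by omega) (by omega)⟩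
      exact injOn_notMem_chainBlock hz (show k + 1 < j by omega) (by omega)
        (h ▸ ⟨k + 1, Set.mem_Iic.2 le_rfl, rfl⟩)
    refine hT'c _ (fun a b hab => ((hf a b hab.1).act _).sub
      (((chainDelta_decaysAlong z ζ (k + 1) hab.2.1 hab.2.2).act _).smul _)) ?_
    exact vanishBelow_act_cancel hγ0 hQ hfull hnew

end Chain

/-! ### Vanishing of the numerator on a chain -/

section Chain

variable {ι : Type} [DecidableEq ι]

/-- Each linear form allows exponents to be moved from `z j` to `z (j + 1)` at the cost of a nonzero
factor. Starting from low exponents, all those of `z 1, …, z N` can be raised to a common low value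
`κ`, the exponent of `z 0` absorbing the difference; there the coefficient vanishes by hypothesis.
-/
theorem vanishBelow_of_chain {z : ℕ → ι} {N : ℕ} (hz : Set.InjOn z (Set.Iic N)) {c : ℕ → ℂ}
    (hc : ∀ k, c k ≠ 0) {f : FormalSeries ι}
    (h : ∀ j < N, VanishBelow (chainTail z N) (act (c j • Z (z (j + 1)) - Z (z j)) f))
    (hf : ∃ B : ℤ, ∀ κ < B, ∀ m : ι → ℤ, (∀ j, 0 < j → j ≤ N → m (z j) = κ) → f m = 0) :
    VanishBelow (chainTail z N) f := by
  obtain ⟨B₀, hB₀⟩ := hf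
  choose! B hB using h
  obtain ⟨κ, hκ⟩ : ∃ κ : ℤ, ∀ b ∈ insert B₀ ((Finset.range N).image B), κ < b := by
    obtain ⟨κ, hκ⟩ := (insert B₀ ((Finset.range N).image B)).bddBelow
    exact ⟨κ - 1, fun b hb => lt_of_lt_of_le (by omega) (hκ hb)⟩
  have hne : ∀ i j, i ≤ N → j ≤ N → i ≠ j → z i ≠ z j := fun i j hi hj hij h => hij (hz hi hj h)
  -- The exponents of `z j` with `j > n` already equal `κ`, the others of the tail do not exceed it.
  -- The induction step fills `z (n + 1)` up to `κ` and lowers `z n`.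
  have key : ∀ n ≤ N, ∀ m : ι → ℤ, (∀ j, n < j → j ≤ N → m (z j) = κ) →
      (∀ j, 0 < j → j ≤ n → m (z j) ≤ κ) → f m = 0 := by
    intro n
    induction n with
    | zero => exact fun _ m h1 _ => hB₀ κ (hκ _ (Finset.mem_insert_self _ _)) m h1
    | succ n ih =>
      intro hn m h1 h2
      set v : ι → ℤ := Pi.single (z (n + 1)) 1 - Pi.single (z n) 1 with hv
      have hv1 : v (z (n + 1)) = 1 := by simp [hv, hne (n + 1) n hn (by omega) (by omega)]
      have hv0 : ∀ x, x ≠ z (n + 1) → v x ≤ 0 := by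
        intro x hx
        simp only [hv, Pi.sub_apply, Pi.single_eq_of_ne hx, zero_sub, neg_nonpos]
        by_cases h : x = z n <;> simp [h]
      have hvj : ∀ j, n + 1 < j → j ≤ N → v (z j) = 0 := by
        intro j hj hjN
        simp [hv, hne j (n + 1) hjN hn (by omega), hne j n hjN (by omega) (by omega)]
      have hmv : ∀ (t : ℕ) x, (m + t • v) x = m x + t * v x := by
        intro t x
        simp only [Pi.add_apply, Pi.smul_apply]
        rw [nsmul_eq_mul]
      have h2n := h2 (n + 1) (by omega) le_rfl
      have hft := eq_of_act_linear_eq_zero (a := z (n + 1)) (b := z n) (c := c n) (f := f) (m := m)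
        (κ - m (z (n + 1))).toNat fun s hs => by
          refine hB n hn _ fun x hx => lt_of_le_of_lt ?_ (hκ (B n) (Finset.mem_insert_of_mem
            (Finset.mem_image_of_mem B (Finset.mem_range.2 hn))))
          obtain ⟨j, hj, rfl⟩ := hx
          rw [← hv, Pi.add_apply, hmv]
          by_cases hjn : j = n + 1
          · rw [hjn, hv1, Pi.single_eq_same]
            omega
          · have hjn' := hne j (n + 1) hj.2 hn hjn
            rw [Pi.single_eq_of_ne hjn']
            have := hv0 _ hjn'
            have : m (z j) ≤ κ := by
              rcases lt_or_ge (n + 1) j with h | h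
              · exact (h1 j h hj.2).le
              · exact h2 j hj.1 h
            nlinarith [Int.natCast_nonneg s]
      rw [← hv, ih (by omega), eq_comm, mul_eq_zero] at hft
      · exact hft.resolve_left (pow_ne_zero _ (hc n))
      · intro j hj hjN
        rw [hmv]
        rcases Nat.lt_or_eq_of_le (show n + 1 ≤ j from hj) with h | h
        · rw [hvj j h hjN, h1 j h hjN]; ring
        · rw [← h, hv1]
          omega
      · intro j hj hjn
        rw [hmv]
        have := hv0 (z j) (hne j (n + 1) (by omega) hn (by omega))
        have := h2 j hj (by omega)
        nlinarith [Int.natCast_nonneg (κ - m (z (n + 1))).toNat]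
  exact ⟨κ, fun m hm => key N le_rfl m (fun j h1 h2 => absurd h1 (by omega))
    fun j h1 h2 => (hm (z j) ⟨j, ⟨h1, h2⟩, rfl⟩).le⟩

variable [Fintype ι]

/-- Up to a unit, a coefficient of the product with the delta function is the part of the value at
`ζ` coming from the monomials with given exponents outside the chain and given total degree. Each
such part also occurs at arbitrarily low exponents of the tail, so it vanishes, and the value is the
sum of these parts. -/
theorem value_eq_zero_of_act_chainDelta {z : ℕ → ι} {N : ℕ} (hz : Set.InjOn z (Set.Iic N))
    {ζ : ι → ℂˣ} {P : Laurent ι} (h : VanishBelow (chainTail z N) (act P (chainDelta z ζ N))) :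
    P.value ζ = 0 := by
  classical
  obtain ⟨B, hB⟩ := h
  let κ : (ι → ℤ) → (ι → ℤ) × ℤ := fun k => (fun x => if x ∈ chainBlock z N then 0 else k x, ∑ x, k x)
  rw [Laurent.value, Finsupp.sum, ← Finset.sum_fiberwise_of_maps_to
    (fun k hk => Finset.mem_image_of_mem κ hk)]
  refine Finset.sum_eq_zero fun b hb => ?_
  obtain ⟨k₀, -, rfl⟩ := Finset.mem_image.1 hb
  obtain ⟨L, hL0, hL⟩ : ∃ L : ℤ, 0 ≤ L ∧ ∀ x, k₀ x - L < B := by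
    refine ⟨∑ x, |k₀ x| + |B| + 1, by positivity, fun x => ?_⟩
    have h1 := Finset.single_le_sum (f := fun x => |k₀ x|) (fun _ _ => abs_nonneg _)
      (Finset.mem_univ x)
    have h2 := le_abs_self (k₀ x)
    have h3 := neg_abs_le B
    omega
  let u : ι → ℤ := ∑ j ∈ Finset.Ioc 0 N, (Pi.single (z j) 1 - Pi.single (z 0) 1)
  -- The term with `N` accounts for the degree `-N` of the delta function. The term with `L` pushes
  -- the tail below `B` without changing the total degree, as the coordinates of `u` sum to zero.
  let m : ι → ℤ := k₀ - (N : ℤ) • Pi.single (z 0) 1 - L • u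
  have hm_off : ∀ x, x ∉ chainBlock z N → m x = k₀ x := by
    intro x hx
    have hxj : ∀ j ≤ N, x ≠ z j := fun j hj h => hx ⟨j, hj, h.symm⟩
    have : u x = 0 := by
      simp only [u, Finset.sum_apply, Pi.sub_apply]
      refine Finset.sum_eq_zero fun j hj => ?_
      rw [Pi.single_eq_of_ne (hxj j (Finset.mem_Ioc.1 hj).2),
        Pi.single_eq_of_ne (hxj 0 (Nat.zero_le _)), sub_zero]
    simp [m, this, hxj 0 (Nat.zero_le _)]
  have hm_sum : ∑ x, m x = ∑ x, k₀ x - N := by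
    have : ∑ x, u x = 0 := by
      simp only [u, Finset.sum_apply, Pi.sub_apply]
      rw [Finset.sum_comm]
      simp [Finset.sum_sub_distrib]
    simp [m, Finset.sum_sub_distrib, ← Finset.mul_sum, this]
  have hm_low : ∀ x ∈ chainTail z N, m x < B := by
    rintro x ⟨j, hj, rfl⟩
    have hj0 : z j ≠ z 0 := fun h => hj.1.ne' (hz hj.2 (Nat.zero_le _) h)
    have : u (z j) = 1 := by
      simp only [u, Finset.sum_apply, Pi.sub_apply]
      rw [Finset.sum_eq_single j]
      · simp [hj0]
      · intro i hi hij
        rw [Pi.single_eq_of_ne hj0, Pi.single_eq_of_ne fun h =>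
          hij (hz hj.2 (Finset.mem_Ioc.1 hi).2 h).symm, sub_zero]
      · exact fun h => absurd (Finset.mem_Ioc.2 hj) h
    have h2 := hL (z j)
    simp only [m, Pi.sub_apply, Pi.smul_apply, this, Pi.single_eq_of_ne hj0]
    simpa using h2
  have hB' := hB m hm_low
  rw [act_apply] at hB'
  have hδ : ∀ k, chainDelta z ζ N (m - k) = if κ k = κ k₀ then
      ((∏ x, ζ x ^ (-m x) : ℂˣ) : ℂ) * ∏ x, ((ζ x ^ k x : ℂˣ) : ℂ) else 0 := by
    intro k
    rw [chainDelta]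
    refine if_congr ?_ ?_ rfl
    · simp only [κ, Prod.mk.injEq]
      refine and_congr ⟨fun h => ?_, fun h x hx => ?_⟩ ?_
      · ext x
        split_ifs with hx
        · rfl
        · have := h x hx
          rw [Pi.sub_apply, hm_off x hx] at this
          omega
      · have := congrFun h x
        simp only [if_neg hx] at this
        rw [Pi.sub_apply, hm_off x hx, this, sub_self]
      · simp only [Pi.sub_apply, Finset.sum_sub_distrib, hm_sum]
        constructor <;> intro h <;> linarith
    · rw [← Units.coe_prod, ← Units.coe_prod, ← Units.val_mul, ← Finset.prod_mul_distrib]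
      congr 1
      refine Finset.prod_congr rfl fun x _ => ?_
      rw [← zpow_add]
      congr 1
      simp only [Pi.sub_apply]
      ring
  simp only [hδ, mul_ite, mul_zero] at hB'
  rw [← Finset.sum_filter] at hB'
  simp only [mul_left_comm _ ((∏ x, ζ x ^ (-m x) : ℂˣ) : ℂ)] at hB'
  rw [← Finset.mul_sum] at hB'
  exact (mul_eq_zero.1 hB').resolve_left (Units.ne_zero _)

/-- If a series with simple poles along a chain of linear forms has no coefficients with all
exponents of the chain equal and small, then its numerator vanishes on the chain. -/
theorem value_eq_zero_of_chain {z : ℕ → ι} {N : ℕ} (hz : Set.InjOn z (Set.Iic N)) {c : ℕ → ℂ}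
    (hc : ∀ k, c k ≠ 0) {ζ : ι → ℂˣ} (hζ : ∀ k < N, c k * ζ (z (k + 1)) = ζ (z k))
    {r : ι → ι → Prop} (hr : ∀ i j, i < j → j ≤ N → r (z j) (z i)) {f : FormalSeries ι}
    (hf : ∀ a b, r a b → DecaysAlong a b f) {E P : Laurent ι}
    (hE : ∀ k ≤ N, E ∈ cancelable r (chainTail z k))
    (h0 : act (E * chainLinear z c N 0) f = (chainNumer z N 0 * P).coeff)
    (hlow : ∃ B : ℤ, ∀ κ < B, ∀ m : ι → ℤ, (∀ j, 0 < j → j ≤ N → m (z j) = κ) → f m = 0) :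
    P.value ζ = 0 := by
  obtain ⟨h1, C, hC, h2⟩ := chain_expansion hz hc hζ hr hf hE h0 le_rfl
  have h3 := vanishBelow_of_chain hz hc h1 hlow
  have h4 := ((h3.act (E * chainLinear z c N N)).sub h2).smul C⁻¹
  rw [sub_sub_cancel, smul_smul, inv_mul_cancel₀ hC, one_smul] at h4
  refine value_eq_zero_of_act_chainDelta hz ?_
  simpa [chainNumer] using h4

end Chain

/-! ### Products over the pairs of letters of a word -/

section PairProd

variable {ι R : Type*} [CommRing R]

/-- The product of the `φ x y` over all pairs of letters, `x` standing to the left of `y`. -/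
def pairProd (φ : ι → ι → R) : List ι → R
  | [] => 1
  | x :: l => (l.map (φ x)).prod * pairProd φ l

theorem pairProd_append (φ : ι → ι → R) (l l' : List ι) :
    pairProd φ (l ++ l') = pairProd φ l * pairProd φ l' *
      (l.map fun x => (l'.map (φ x)).prod).prod := by
  induction l with
  | nil => simp [pairProd]
  | cons x l ih =>
    simp only [List.cons_append, pairProd, ih, List.map_append, List.prod_append, List.map_cons,
      List.prod_cons]
    ring

theorem pairProd_map {κ : Type*} (φ : ι → ι → R) (g : κ → ι) (l : List κ) :
    pairProd φ (l.map g) = pairProd (fun x y => φ (g x) (g y)) l := by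
  induction l with
  | nil => rfl
  | cons x l ih => simp only [List.map_cons, pairProd, ih, List.map_map]; rfl

theorem map_pairProd {S F : Type*} [CommRing S] [FunLike F R S] [RingHomClass F R S] (g : F)
    (φ : ι → ι → R) (l : List ι) : g (pairProd φ l) = pairProd (fun x y => g (φ x y)) l := by
  induction l with
  | nil => exact map_one g
  | cons x l ih => simp only [pairProd, map_mul, ih, map_list_prod, List.map_map]; rfl

/-- Only the relative order of the two exchanged neighbours changes, so all other factors are
shared. -/
theorem exists_pairProd_swap (φ : ι → ι → R) (p s : List ι) (x y : ι) :
    ∃ E, pairProd φ (p ++ x :: y :: s) = φ x y * E ∧ pairProd φ (p ++ y :: x :: s) = φ y x * E := by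
  refine ⟨pairProd φ p * ((s.map (φ x)).prod * (s.map (φ y)).prod * pairProd φ s) *
      (p.map fun z => φ z x * φ z y * (s.map (φ z)).prod).prod, ?_, ?_⟩
  · simp only [pairProd_append, pairProd, List.map_cons, List.prod_cons, mul_assoc]
    ring
  · simp only [pairProd_append, pairProd, List.map_cons, List.prod_cons, mul_assoc,
      mul_left_comm (φ _ y)]
    ring

theorem pairProd_perm {φ : ι → ι → R} (h : ∀ x y, φ y x = φ x y ∨ φ y x = -φ x y) {l l' : List ι}
    (hl : l.Perm l') (p : List ι) :
    pairProd φ (p ++ l') = pairProd φ (p ++ l) ∨ pairProd φ (p ++ l') = -pairProd φ (p ++ l) := by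
  induction hl generalizing p with
  | nil => exact .inl rfl
  | cons x _ ih => simpa using ih (p ++ [x])
  | swap x y s =>
    obtain ⟨E, h1, h2⟩ := exists_pairProd_swap φ p s x y
    rw [h1, h2]
    rcases h x y with h | h <;> rw [h] <;> simp
  | trans _ _ ih1 ih2 =>
    rcases ih1 p with h1 | h1 <;> rcases ih2 p with h2 | h2 <;> rw [h2, h1] <;> simp

theorem pairProd_eq_prod [DecidableEq ι] (φ : ι → ι → R) {r : ι → ι → Prop} [DecidableRel r]
    {l : List ι} (hl : l.Pairwise r) (hr : ∀ x y, r x y → ¬r y x) :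
    pairProd φ l = ∏ p ∈ l.toFinset ×ˢ l.toFinset with r p.1 p.2, φ p.1 p.2 := by
  induction l with
  | nil => rfl
  | cons x l ih =>
    rw [List.pairwise_cons] at hl
    have hrx : ∀ y, ¬r y y := fun y h => hr y y h h
    have hx : x ∉ l := fun h => hrx x (hl.1 x h)
    have hnd : l.Nodup := hl.2.imp fun {a b} h => by rintro rfl; exact hrx _ h
    rw [pairProd, ih hl.2, List.toFinset_cons, Finset.prod_filter, Finset.prod_product,
      Finset.prod_filter, Finset.prod_product, Finset.prod_insert (by simpa using hx),
      Finset.prod_insert (by simpa using hx), if_neg (hrx x), one_mul, ← List.prod_toFinset _ hnd]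
    congr 1
    · refine Finset.prod_congr rfl fun y hy => ?_
      rw [if_pos (hl.1 y (List.mem_toFinset.1 hy))]
    · refine Finset.prod_congr rfl fun y hy => ?_
      rw [Finset.prod_insert (by simpa using hx), if_neg (hr _ _ (hl.1 y (List.mem_toFinset.1 hy))),
        one_mul]

theorem pairProd_mem {φ : ι → ι → R} (S : Submonoid R) {l : List ι}
    (h : l.Pairwise fun x y => φ x y ∈ S) : pairProd φ l ∈ S := by
  induction l with
  | nil => exact S.one_mem
  | cons x l ih =>
    rw [List.pairwise_cons] at h
    refine S.mul_mem (S.list_prod_mem fun y hy => ?_) (ih h.2)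
    obtain ⟨z, hz, rfl⟩ := List.mem_map.1 hy
    exact h.1 z hz

/-- Chains are read from index `N` down to `0`, so that `z 0` acts first; the larger index is then
on the left in each factor, as in `chainLinear`. -/
theorem pairProd_reverse_range_map (φ : ι → ι → R) (z : ℕ → ι) (N : ℕ) :
    pairProd φ ((List.range (N + 1)).reverse.map z) =
      ∏ i ∈ Finset.Ico 0 N, ∏ j ∈ Finset.Ico (i + 1) (N + 1), φ (z j) (z i) := by
  induction N with
  | zero => simp [pairProd]
  | succ N ih =>
    rw [List.range_succ, List.reverse_append, List.reverse_singleton, List.singleton_append,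
      List.map_cons, pairProd, ih, List.map_map, List.map_reverse, List.prod_reverse,
      ← List.prod_toFinset _ List.nodup_range, List.toFinset_range, Finset.range_eq_Ico,
      Finset.prod_Ico_succ_top (Nat.zero_le N), Finset.prod_Ico_succ_top (Nat.zero_le N),
      mul_right_comm, ← Finset.prod_mul_distrib]
    congr 1
    · refine Finset.prod_congr rfl fun i hi => ?_
      rw [Finset.prod_Ico_succ_top (b := N + 1) (by rw [Finset.mem_Ico] at hi; omega), mul_comm]
      rfl
    · simp

end PairProd

/-! ### Matrix coefficients of words in the currents -/

/-- The properties of the modes of the currents `e_α(z)`, acting on a module, from which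
the properties of the correlation functions are derived. -/
structure IsSmoothAction {r : ℕ} (a : Fin r → Fin r → ℤ) (d : Fin r → ℕ) (q : ℂ) {V : Type u}
    [AddCommGroup V] [Module ℂ V] (e : Fin r → ℤ → Module.End ℂ V) : Prop where
  vertex : ∀ α β m k, exchange (qExp a d q α β) 1 (e α) (e β) m k = 0
  serre : ∀ α β, α ≠ β → ∀ k l w, e α k w = 0 → (e α k ^ (1 - a α β).toNat) (e β l w) = 0
  smooth : ∀ α w, ∃ M : ℤ, ∀ m, M ≤ m → e α m w = 0

section Words

variable {r : ℕ} {n : Fin r → ℕ} {V : Type u} [AddCommGroup V] [Module ℂ V]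

/-- The product of the modes `e_α[-m x]` over the letters `x` of a word. -/
def wordOp (e : Fin r → ℤ → Module.End ℂ V) (l : List (Var n)) (m : Var n → ℤ) : Module.End ℂ V :=
  (l.map fun x => e x.1 (-m x)).prod

/-- The series of matrix coefficients of the product of the currents along a word. -/
def wordCorr (e : Fin r → ℤ → Module.End ℂ V) (ξ : Module.Dual ℂ V) (v : V) (l : List (Var n)) :
    FormalSeries (Var n) := fun m => ξ (wordOp e l m v)

theorem wordOp_append (e : Fin r → ℤ → Module.End ℂ V) (l l' : List (Var n)) (m : Var n → ℤ) :
    wordOp e (l ++ l') m = wordOp e l m * wordOp e l' m := by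
  simp [wordOp]

theorem wordOp_cons (e : Fin r → ℤ → Module.End ℂ V) (x : Var n) (l : List (Var n))
    (m : Var n → ℤ) : wordOp e (x :: l) m = e x.1 (-m x) * wordOp e l m := by
  simp [wordOp]

theorem wordOp_congr (e : Fin r → ℤ → Module.End ℂ V) {l : List (Var n)} {m m' : Var n → ℤ}
    (h : ∀ x ∈ l, m x = m' x) : wordOp e l m = wordOp e l m' := by
  rw [wordOp, wordOp, List.map_congr_left fun x hx => by rw [h x hx]]

variable {a : Fin r → Fin r → ℤ} {d : Fin r → ℕ} {q : ℂ} {e : Fin r → ℤ → Module.End ℂ V}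

/-- The letters to the right of `b`, with their exponents fixed, produce one fixed vector, and high
modes of the current of `b` kill it whatever stands further left. -/
theorem exists_wordCorr_eq_zero (he : IsSmoothAction a d q e) (ξ : Module.Dual ℂ V) (v : V)
    (p s : List (Var n)) (b : Var n) (m : Var n → ℤ) :
    ∃ B : ℤ, ∀ k : Var n → ℤ, (∀ x ∈ s, k x = m x) → k b < B →
      wordCorr e ξ v (p ++ b :: s) k = 0 := by
  obtain ⟨M, hM⟩ := he.smooth b.1 (wordOp e s m v)
  refine ⟨-M, fun k hk hb => ?_⟩
  rw [wordCorr, wordOp_append, wordOp_cons, wordOp_congr e hk, Module.End.mul_apply,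
    Module.End.mul_apply, hM _ (by omega), map_zero, map_zero]

/-- `x` stands to the left of `y` in the word `l`. -/
def LeftOf (l : List (Var n)) (x y : Var n) : Prop := ∃ p s, l = p ++ y :: s ∧ x ∈ p

/-- In the direction `z_x / z_y` the exponent of `y` tends to `-∞`, while all letters to the right
of `y` keep theirs. -/
theorem wordCorr_decaysAlong (he : IsSmoothAction a d q e) (ξ : Module.Dual ℂ V) (v : V)
    {l : List (Var n)} (hl : l.Nodup) {x y : Var n} (hxy : LeftOf l x y) :
    DecaysAlong x y (wordCorr e ξ v l) := by
  obtain ⟨p, s, rfl, hx⟩ := hxy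
  intro m
  obtain ⟨B, hB⟩ := exists_wordCorr_eq_zero he ξ v p s y m
  have hd := List.disjoint_of_nodup_append hl
  have hys : y ∉ s := (List.nodup_cons.1 (List.nodup_append.1 hl).2.1).1
  have hne : y ≠ x := fun h => hd hx (h ▸ List.mem_cons_self)
  refine ⟨(m y - B).toNat + 1, fun t ht => hB _ (fun z hz => ?_) ?_⟩
  · have h1 : z ≠ x := fun h => hd hx (h ▸ List.mem_cons_of_mem _ hz)
    have h2 : z ≠ y := fun h => hys (h ▸ hz)
    simp [h1, h2]
  · simp only [Pi.add_apply, Pi.smul_apply, Pi.sub_apply, Pi.single_eq_same,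
      Pi.single_eq_of_ne hne, zero_sub]
    rw [nsmul_eq_mul]
    omega

variable (a d q) in
/-- The linear form `q_α^{a_{αβ}} z_x - z_y`. -/
def vertexForm (x y : Var n) : Laurent (Var n) := qExp a d q x.1 y.1 • Z x - Z y

/-- This is the vertex relation inserted between the operators of `p` and `s`, which do not see the
exponents of `x` and `y`. -/
theorem act_vertexForm_wordCorr (he : IsSmoothAction a d q e) (ξ : Module.Dual ℂ V) (v : V)
    {p s : List (Var n)} {x y : Var n} (hl : (p ++ x :: y :: s).Nodup) :
    act (vertexForm a d q x y) (wordCorr e ξ v (p ++ x :: y :: s)) =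
      -act (qExp a d q x.1 y.1 • Z y - Z x) (wordCorr e ξ v (p ++ y :: x :: s)) := by
  have hd := List.disjoint_of_nodup_append hl
  have h2 := (List.nodup_append.1 hl).2.1
  rw [List.nodup_cons, List.nodup_cons] at h2
  have hxy : x ≠ y := fun h => h2.1 (h ▸ List.mem_cons_self)
  ext m
  have hp : ∀ z : Var n, z = x ∨ z = y → wordOp e p (m - Pi.single z 1) = wordOp e p m := by
    intro z hz
    refine wordOp_congr e fun t ht => ?_
    have : t ≠ z := by
      rintro rfl
      exact hd ht (by rcases hz with rfl | rfl <;> simp)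
    simp [this]
  have hs : ∀ z : Var n, z = x ∨ z = y → wordOp e s (m - Pi.single z 1) = wordOp e s m := by
    intro z hz
    refine wordOp_congr e fun t ht => ?_
    have : t ≠ z := by
      rintro rfl
      rcases hz with rfl | rfl
      · exact h2.1 (List.mem_cons_of_mem _ ht)
      · exact h2.2.1 ht
    simp [this]
  have hv := he.vertex x.1 y.1 (-m x) (-m y)
  rw [exchange, one_mul, one_mul, sub_eq_zero] at hv
  have hv' := congrArg (fun T => ξ (wordOp e p m (T (wordOp e s m v)))) hv
  simp only [LinearMap.sub_apply, LinearMap.smul_apply, map_sub, map_smul, Module.End.mul_apply,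
    smul_eq_mul] at hv'
  rw [Pi.neg_apply, vertexForm, act_linear, act_linear]
  simp only [wordCorr, wordOp_append, wordOp_cons, hp x (.inl rfl), hp y (.inr rfl),
    hs x (.inl rfl), hs y (.inr rfl), Pi.sub_apply, Pi.single_eq_same, Pi.single_eq_of_ne hxy,
    Pi.single_eq_of_ne hxy.symm, sub_zero, neg_sub, Module.End.mul_apply]
  rw [show (1 : ℤ) - m x = -m x + 1 by ring, show (1 : ℤ) - m y = -m y + 1 by ring]
  linear_combination hv'

variable (a d q) in
/-- The product of the denominators along a word. -/
def wordDenom (l : List (Var n)) : Laurent (Var n) := pairProd (vertexForm a d q) l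

/-- The product of all the differences of variables along a word. -/
def wordVandermonde (l : List (Var n)) : Laurent (Var n) := pairProd (fun x y => Z x - Z y) l

/-- The series of matrix coefficients along a word, multiplied by the denominators. -/
def wordNumer (a : Fin r → Fin r → ℤ) (d : Fin r → ℕ) (q : ℂ) (e : Fin r → ℤ → Module.End ℂ V)
    (ξ : Module.Dual ℂ V) (v : V) (l : List (Var n)) : FormalSeries (Var n) :=
  act (wordDenom a d q l) (wordCorr e ξ v l)

theorem wordNumer_swap (hsym : ∀ α β, qExp a d q α β = qExp a d q β α)
    (he : IsSmoothAction a d q e) (ξ : Module.Dual ℂ V) (v : V)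
    {p s : List (Var n)} {x y : Var n} (hl : (p ++ x :: y :: s).Nodup) :
    wordNumer a d q e ξ v (p ++ y :: x :: s) = -wordNumer a d q e ξ v (p ++ x :: y :: s) := by
  obtain ⟨E, h1, h2⟩ := exists_pairProd_swap (vertexForm a d q) p s x y
  rw [wordNumer, wordNumer, wordDenom, wordDenom, h1, h2, mul_comm, mul_comm _ E, act_mul, act_mul,
    act_vertexForm_wordCorr he ξ v hl, map_neg, neg_neg, vertexForm, hsym]

/-- Each exchange of neighbours contributes a sign. The Vandermonde product is carried along as a
record of the same sign, so that signs of permutations need not be computed. -/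
theorem wordNumer_perm (hsym : ∀ α β, qExp a d q α β = qExp a d q β α)
    (he : IsSmoothAction a d q e) (ξ : Module.Dual ℂ V) (v : V) {l l' : List (Var n)}
    (hl : l.Perm l') (p : List (Var n)) (hp : (p ++ l).Nodup) :
    ∃ ε : ℂ, (ε = 1 ∨ ε = -1) ∧
      wordNumer a d q e ξ v (p ++ l') = ε • wordNumer a d q e ξ v (p ++ l) ∧
      wordVandermonde (p ++ l') = ε • wordVandermonde (p ++ l) := by
  induction hl generalizing p with
  | nil => exact ⟨1, .inl rfl, by simp, by simp⟩
  | cons x _ ih => simpa using ih (p ++ [x]) (by simpa using hp)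
  | swap x y s =>
    obtain ⟨E, h1, h2⟩ := exists_pairProd_swap (fun x y : Var n => (Z x - Z y : Laurent (Var n))) p s x y
    refine ⟨-1, .inr rfl, ?_, ?_⟩
    · rw [wordNumer_swap hsym he ξ v hp, neg_one_smul]
    · rw [wordVandermonde, wordVandermonde, h1, h2, neg_one_smul]
      ring
  | trans h1 _ ih1 ih2 =>
    obtain ⟨ε, hε, h3, h4⟩ := ih1 p hp
    obtain ⟨ε', hε', h3', h4'⟩ := ih2 p ((h1.append_left p).nodup_iff.1 hp)
    refine ⟨ε' * ε, ?_, by rw [h3', h3, smul_smul], by rw [h4', h4, smul_smul]⟩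
    rcases hε with rfl | rfl <;> rcases hε' with rfl | rfl <;> simp

end Words

/-! ### The word of all variables in their standard order -/

section StandardWord

variable {r : ℕ} {n : Fin r → ℕ}

theorem Before.asymm {x y : Var n} (h : Before x y) : ¬Before y x := by
  rintro (h' | h') <;> rcases h with h | h
  · exact lt_asymm h h'
  · exact h'.ne h.1.symm
  · exact h.ne h'.1.symm
  · omega

theorem Before.ne {x y : Var n} (h : Before x y) : x ≠ y := by
  rintro rfl
  exact h.asymm h

variable (n) in
/-- The word consisting of all the variables in their standard order. -/
def stdWord : List (Var n) :=
  (List.finRange r).flatMap fun α => (List.finRange (n α)).map fun i => ⟨α, i⟩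

theorem mem_stdWord (x : Var n) : x ∈ stdWord n := by
  simp only [stdWord, List.mem_flatMap, List.mem_finRange, List.mem_map, true_and]
  exact ⟨x.1, x.2, rfl⟩

theorem stdWord_pairwise : (stdWord n).Pairwise Before := by
  rw [stdWord, List.pairwise_flatMap]
  refine ⟨fun α _ => ?_, ?_⟩
  · rw [List.pairwise_map]
    exact (List.pairwise_lt_finRange _).imp fun h => .inr ⟨rfl, h⟩
  · refine (List.pairwise_lt_finRange _).imp fun h => ?_
    simp only [List.mem_map, List.mem_finRange, true_and]
    rintro _ ⟨i, rfl⟩ _ ⟨j, rfl⟩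
    exact .inl h

theorem stdWord_nodup : (stdWord n).Nodup :=
  stdWord_pairwise.imp fun h => h.ne

theorem stdWord_perm {l : List (Var n)} (hl : l.Nodup) (h : ∀ x, x ∈ l) : (stdWord n).Perm l :=
  (List.perm_ext_iff_of_nodup stdWord_nodup hl).2 fun x => by simp [mem_stdWord, h]

theorem exists_stdWord_eq {α : Fin r} {i j : Fin (n α)} (hij : (j : ℕ) = i + 1) :
    ∃ p s, stdWord n = p ++ ⟨α, i⟩ :: ⟨α, j⟩ :: s := by
  obtain ⟨p, t, ht⟩ := List.append_of_mem (mem_stdWord (⟨α, i⟩ : Var n))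
  have hpw := stdWord_pairwise (n := n)
  rw [ht, List.pairwise_append, List.pairwise_cons] at hpw
  have hbef : Before (⟨α, i⟩ : Var n) ⟨α, j⟩ := .inr ⟨rfl, by simp [hij]⟩
  have hj : (⟨α, j⟩ : Var n) ∈ t := by
    have := mem_stdWord (⟨α, j⟩ : Var n)
    rw [ht, List.mem_append, List.mem_cons] at this
    rcases this with h | h | h
    · exact absurd (hpw.2.2 _ h _ List.mem_cons_self) hbef.asymm
    · exact absurd h.symm hbef.ne
    · exact h
  cases t with
  | nil => simp at hj
  | cons y s =>
    rcases List.mem_cons.1 hj with h | h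
    · exact ⟨p, s, by rw [ht, h]⟩
    · exfalso
      have h1 := hpw.2.1.1 y List.mem_cons_self
      have h2 := (List.pairwise_cons.1 hpw.2.1.2).1 _ h
      obtain ⟨β, k⟩ := y
      rcases h1 with h1 | ⟨h1, h1'⟩
      · rcases h2 with h2 | ⟨h2, -⟩
        · exact lt_asymm h1 h2
        · exact h1.ne h2.symm
      · dsimp at h1
        subst h1
        rcases h2 with h2 | ⟨-, h2⟩
        · exact lt_irrefl _ h2
        · dsimp at h1' h2
          omega

open Classical in
theorem pairProd_stdWord {R : Type*} [CommRing R] (φ : Var n → Var n → R) :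
    pairProd φ (stdWord n) = ∏ p : Var n × Var n with Before p.1 p.2, φ p.1 p.2 := by
  have : (stdWord n).toFinset = Finset.univ := by ext x; simp [mem_stdWord]
  rw [pairProd_eq_prod φ stdWord_pairwise fun _ _ h => h.asymm, this, Finset.univ_product_univ]

theorem wordDenom_stdWord (a : Fin r → Fin r → ℤ) (d : Fin r → ℕ) (q : ℂ) :
    wordDenom a d q (stdWord n) = denom a d q n := by
  rw [wordDenom, pairProd_stdWord, denom]
  rfl

theorem numer_eq_pairProd :
    numer n = pairProd (fun x y => if x.1 = y.1 then Z x - Z y else 1) (stdWord n) := by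
  classical
  rw [numer, pairProd_stdWord, ← Finset.prod_filter, Finset.filter_filter]

open Classical in
theorem wordVandermonde_stdWord : wordVandermonde (stdWord n) =
    numer n * ∏ p : Var n × Var n with p.1.1 < p.2.1, (Z p.1 - Z p.2) := by
  rw [wordVandermonde, pairProd_stdWord,
    ← Finset.prod_filter_mul_prod_filter_not _ (fun p : Var n × Var n => p.1.1 = p.2.1),
    Finset.filter_filter, Finset.filter_filter, numer]
  congr 2
  ext p
  rw [Finset.mem_filter, Finset.mem_filter]
  simp only [Finset.mem_univ, true_and, Before]
  constructor
  · rintro ⟨h | h, h'⟩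
    · exact h
    · exact absurd h.1 h'
  · exact fun h => ⟨.inl h, h.ne⟩

/-- The differences of variables of distinct colours are permuted among themselves without a sign,
so the whole sign of the Vandermonde product comes from its equal-colour part. -/
theorem permute_numer {σ : Equiv.Perm (Var n)} (hσ : ∀ x, (σ x).1 = x.1) {ε : ℂ}
    (h : permute σ (wordVandermonde (stdWord n)) = ε • wordVandermonde (stdWord n)) :
    permute σ (numer n) = ε • numer n := by
  classical
  have hU : permute σ (∏ p : Var n × Var n with p.1.1 < p.2.1, (Z p.1 - Z p.2)) =
      ∏ p : Var n × Var n with p.1.1 < p.2.1, (Z p.1 - Z p.2) := by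
    rw [map_prod]
    refine Finset.prod_equiv (σ.prodCongr σ) (fun p => ?_) fun p _ => ?_
    · simp [hσ]
    · simp [permute_Z]
  have h0 : (∏ p : Var n × Var n with p.1.1 < p.2.1, (Z p.1 - Z p.2) : Laurent (Var n)) ≠ 0 := by
    refine Finset.prod_ne_zero_iff.2 fun p hp => ?_
    refine (Z_sub_prime fun h => ?_).ne_zero
    rw [Finset.mem_filter] at hp
    exact hp.2.ne (by rw [h])
  rw [wordVandermonde_stdWord, map_mul, hU, ← smul_mul_assoc] at h
  exact mul_right_cancel₀ h0 h

theorem numer_ne_zero : numer n ≠ 0 := by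
  classical
  refine Finset.prod_ne_zero_iff.2 fun p hp => (Z_sub_prime ?_).ne_zero
  exact (Finset.mem_filter.1 hp).2.1.ne

theorem denom_ne_zero (a : Fin r → Fin r → ℤ) (d : Fin r → ℕ) (q : ℂ) : denom a d q n ≠ 0 := by
  classical
  refine Finset.prod_ne_zero_iff.2 fun p hp => linear_ne_zero ?_ _
  exact (Finset.mem_filter.1 hp).2.ne

theorem denomNonzero_ne_zero (a : Fin r → Fin r → ℤ) (d : Fin r → ℕ) (q : ℂ) :
    denomNonzero a d q n ≠ 0 := by
  classical
  refine Finset.prod_ne_zero_iff.2 fun p hp => linear_ne_zero ?_ _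
  exact (Finset.mem_filter.1 hp).2.1.ne

end StandardWord

/-! ### The numerator of a correlation function -/

section Numerator

theorem act_permute {ι : Type} (σ : Equiv.Perm ι) (P : Laurent ι) (f : FormalSeries ι)
    (m : ι → ℤ) : act (permute σ P) (fun k => f (k ∘ σ)) m = act P f (m ∘ σ) := by
  induction P using AddMonoidAlgebra.induction_linear with
  | zero => simp
  | add P Q hP hQ =>
    simp only [map_add, LinearMap.add_apply, Pi.add_apply, hP, hQ]
  | single k c =>
    rw [permute, AddMonoidAlgebra.domCongr_single, act_single, act_single]
    congr 2
    ext x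
    simp [AddEquiv.arrowCongr]

variable {r : ℕ} {n : Fin r → ℕ} {V : Type u} [AddCommGroup V] [Module ℂ V]
  {a : Fin r → Fin r → ℤ} {d : Fin r → ℕ} {q : ℂ} {e : Fin r → ℤ → Module.End ℂ V}

theorem isIteratedLaurent_wordCorr (he : IsSmoothAction a d q e) (ξ : Module.Dual ℂ V) (v : V) :
    IsIteratedLaurent (wordCorr e ξ v (stdWord n)) := by
  intro x m
  obtain ⟨p, s, hps⟩ := List.append_of_mem (mem_stdWord x)
  have hpw := stdWord_pairwise (n := n)
  rw [hps, List.pairwise_append, List.pairwise_cons] at hpw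
  obtain ⟨B, hB⟩ := exists_wordCorr_eq_zero he ξ v p s x m
  refine ⟨B, fun k hk hx => ?_⟩
  rw [hps]
  exact hB k (fun y hy => hk y (hpw.2.1.1 y hy)) hx

theorem exists_wordNumer_eq (hsym : ∀ α β, qExp a d q α β = qExp a d q β α)
    (he : IsSmoothAction a d q e) (ξ : Module.Dual ℂ V) (v : V) {l : List (Var n)} (hl : l.Nodup)
    (h : ∀ x, x ∈ l) : ∃ ε : ℂ, (ε = 1 ∨ ε = -1) ∧
      wordNumer a d q e ξ v l = ε • wordNumer a d q e ξ v (stdWord n) ∧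
      wordVandermonde l = ε • wordVandermonde (stdWord n) := by
  simpa using wordNumer_perm hsym he ξ v (stdWord_perm hl h) [] stdWord_nodup

/-- Up to sign the word may be rearranged so that `x` comes last. Its current then acts directly on
`v`, and the bound on the exponent of `z_x` is uniform in all the others. -/
theorem wordNumer_vanishBelow (hsym : ∀ α β, qExp a d q α β = qExp a d q β α)
    (he : IsSmoothAction a d q e) (ξ : Module.Dual ℂ V) (v : V) (x : Var n) :
    VanishBelow {x} (wordNumer a d q e ξ v (stdWord n)) := by
  classical
  have hperm : (stdWord n).Perm ((stdWord n).erase x ++ [x]) :=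
    (List.perm_cons_erase (mem_stdWord x)).trans (List.perm_append_singleton _ _).symm
  obtain ⟨ε, hε, h1, -⟩ := exists_wordNumer_eq hsym he ξ v (hperm.nodup_iff.1 stdWord_nodup)
    fun y => hperm.mem_iff.1 (mem_stdWord y)
  have h2 : VanishBelow {x} (wordCorr e ξ v ((stdWord n).erase x ++ [x])) := by
    obtain ⟨B, hB⟩ := exists_wordCorr_eq_zero he ξ v ((stdWord n).erase x) [] x 0
    exact ⟨B, fun m hm => hB m (by simp) (hm x rfl)⟩
  have h3 := (h2.act (wordDenom a d q ((stdWord n).erase x ++ [x]))).smul ε⁻¹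
  rw [← wordNumer, h1, smul_smul, inv_mul_cancel₀ (by rcases hε with rfl | rfl <;> norm_num),
    one_smul] at h3
  exact h3

theorem exists_coeff_eq_wordNumer (hsym : ∀ α β, qExp a d q α β = qExp a d q β α)
    (he : IsSmoothAction a d q e) {ξ : Module.Dual ℂ V} {v : V} {K : ℤ}
    (hK : ∀ m, wordCorr e ξ v (stdWord n) m ≠ 0 → ∑ x, m x = K) :
    ∃ P : Laurent (Var n), P.coeff = wordNumer a d q e ξ v (stdWord n) := by
  choose B hB using wordNumer_vanishBelow (n := n) hsym he ξ v
  obtain ⟨L, -, hL⟩ := exists_support_bound (wordDenom a d q (stdWord n))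
  have hfin : (Function.support (wordNumer a d q e ξ v (stdWord n))).Finite := by
    -- Every exponent is bounded below by `B`, and the total degree is bounded above; the upper
    -- bound at `x` is that of the total minus the lower bounds at the other variables.
    refine (Set.finite_Icc B fun x => K + ∑ y : Var n, L - ∑ y, B y + B x).subset fun m hm => ?_
    have hlow : ∀ x, B x ≤ m x := fun x => by
      by_contra h
      exact hm (hB x m (by rintro _ rfl; exact not_le.1 h))
    have hup : ∑ x, m x ≤ K + ∑ y : Var n, L := by
      by_contra hlt
      refine hm (act_eq_zero fun k hk => ?_)
      by_contra hne
      have h1 := hK _ hne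
      simp only [Pi.sub_apply, Finset.sum_sub_distrib] at h1
      have h2 : ∑ x, k x ≤ ∑ y : Var n, L :=
        Finset.sum_le_sum fun x _ => (le_abs_self _).trans (hL k hk x)
      linarith
    refine ⟨hlow, fun x => ?_⟩
    have h1 := Finset.sum_le_sum (s := Finset.univ.erase x) fun y _ => hlow y
    have h2 := Finset.add_sum_erase Finset.univ m (Finset.mem_univ x)
    have h3 := Finset.add_sum_erase Finset.univ B (Finset.mem_univ x)
    simp only
    linarith
  exact ⟨.ofCoeff (Finsupp.ofSupportFinite _ hfin), rfl⟩

theorem wordNumer_map (ξ : Module.Dual ℂ V) (v : V) {σ : Equiv.Perm (Var n)}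
    (hσ : ∀ x, (σ x).1 = x.1) (l : List (Var n)) (m : Var n → ℤ) :
    wordNumer a d q e ξ v (l.map σ) m = wordNumer a d q e ξ v l (m ∘ σ) := by
  have h1 : wordCorr e ξ v (l.map σ) = fun k => wordCorr e ξ v l (k ∘ σ) := by
    ext k
    simp only [wordCorr, wordOp, List.map_map]
    congr 4
    ext x : 1
    simp [hσ]
  have h2 : wordDenom a d q (l.map σ) = permute σ (wordDenom a d q l) := by
    rw [wordDenom, wordDenom, pairProd_map, map_pairProd]
    congr
    ext x y : 2
    rw [vertexForm, vertexForm, map_sub, map_smul, permute_Z, permute_Z, hσ, hσ]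
  rw [wordNumer, wordNumer, h1, h2, act_permute]

theorem wordVandermonde_map (σ : Equiv.Perm (Var n)) (l : List (Var n)) :
    wordVandermonde (l.map σ) = permute σ (wordVandermonde l) := by
  rw [wordVandermonde, wordVandermonde, pairProd_map, map_pairProd]
  simp only [map_sub, permute_Z]

variable {P : Laurent (Var n)} {ξ : Module.Dual ℂ V} {v : V}

theorem exists_permute_eq (hsym : ∀ α β, qExp a d q α β = qExp a d q β α)
    (he : IsSmoothAction a d q e) (hP : P.coeff = wordNumer a d q e ξ v (stdWord n))
    {σ : Equiv.Perm (Var n)} (hσ : ∀ x, (σ x).1 = x.1) :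
    ∃ ε : ℂ, ε ≠ 0 ∧ permute σ P = ε • P ∧ permute σ (numer n) = ε • numer n := by
  obtain ⟨ε, hε, h1, h2⟩ := exists_wordNumer_eq hsym he ξ v
    (l := (stdWord n).map σ) (stdWord_nodup.map σ.injective)
    fun x => List.mem_map.2 ⟨σ.symm x, mem_stdWord _, by simp⟩
  refine ⟨ε, by rcases hε with rfl | rfl <;> norm_num, ?_, ?_⟩
  · ext m
    rw [permute_coeff, hP, ← wordNumer_map ξ v hσ, h1, AddMonoidAlgebra.coeff_smul,
      Finsupp.smul_apply, hP]
    rfl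
  · rw [wordVandermonde_map] at h2
    exact permute_numer hσ h2

/-- In a word beginning with `x`, `y`, the transposition is an exchange of neighbours, which costs
exactly one sign. The unknown sign relating this word to the standard one occurs on both sides and
cancels. -/
theorem permute_swap (hsym : ∀ α β, qExp a d q α β = qExp a d q β α)
    (he : IsSmoothAction a d q e) (hP : P.coeff = wordNumer a d q e ξ v (stdWord n))
    {x y : Var n} (hxy : x ≠ y) (hc : x.1 = y.1) : permute (Equiv.swap x y) P = -P := by
  have hσ : ∀ t, (Equiv.swap x y t).1 = t.1 := by
    intro t
    rw [Equiv.swap_apply_def]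
    split_ifs with h1 h2
    · rw [h1, hc]
    · rw [h2, hc]
    · rfl
  let s := (Finset.univ \ {x, y} : Finset (Var n)).toList
  have hs : ∀ t, t ∈ s ↔ t ≠ x ∧ t ≠ y := by simp [s]
  have hnd : ([] ++ x :: y :: s).Nodup := by
    simp only [List.nil_append, List.nodup_cons, List.mem_cons, hs, Finset.nodup_toList, s]
    simp [hxy]
  obtain ⟨ε, hε, h1, -⟩ := exists_wordNumer_eq hsym he ξ v hnd fun t => by
    by_cases h1 : t = x <;> by_cases h2 : t = y <;> simp [hs, h1, h2]
  have hmap : ([] ++ x :: y :: s).map (Equiv.swap x y) = [] ++ y :: x :: s := by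
    have : s.map (Equiv.swap x y) = s :=
      (List.map_congr_left fun t ht => Equiv.swap_apply_of_ne_of_ne ((hs t).1 ht).1
        ((hs t).1 ht).2).trans (List.map_id s)
    simp only [List.nil_append, List.map_cons, Equiv.swap_apply_left, Equiv.swap_apply_right, this]
  have hε0 : ε ≠ 0 := by rcases hε with rfl | rfl <;> norm_num
  ext m
  have h2 := wordNumer_map (a := a) (d := d) (q := q) (e := e) ξ v hσ ([] ++ x :: y :: s) m
  rw [hmap, wordNumer_swap hsym he ξ v hnd, h1, ← hP] at h2
  simp only [Pi.neg_apply, Pi.smul_apply, smul_eq_mul] at h2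
  rw [permute_coeff]
  refine mul_left_cancel₀ hε0 ?_
  rw [← h2]
  simp

/-- By antisymmetry `P` vanishes on every diagonal of two variables of the same colour, and these
diagonals are pairwise different primes. -/
theorem numer_dvd (hsym : ∀ α β, qExp a d q α β = qExp a d q β α)
    (he : IsSmoothAction a d q e) (hP : P.coeff = wordNumer a d q e ξ v (stdWord n)) :
    numer n ∣ P := by
  classical
  rw [numer]
  have hmem : ∀ p ∈ ({p | Before p.1 p.2 ∧ p.1.1 = p.2.1} : Finset (Var n × Var n)),
      Before p.1 p.2 ∧ p.1.1 = p.2.1 := fun p hp => (Finset.mem_filter.1 hp).2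
  refine prod_Z_sub_dvd _ _ (fun p hp => (hmem p hp).1.ne)
    (fun p hp hp' => (hmem p hp).1.asymm (hmem _ hp').1) fun p hp => ?_
  rw [Z_sub_dvd_iff]
  intro z hz
  have h := congrArg (fun Q => Q.value z) (permute_swap hsym he hP (hmem p hp).1.ne (hmem p hp).2)
  have hzz : z ∘ Equiv.swap p.1 p.2 = z := by
    ext t
    simp only [Function.comp_apply, Equiv.swap_apply_def]
    split_ifs with h1 h2
    · rw [h1, hz]
    · rw [h2, hz]
    · rfl
  simp only [value_permute, value_neg, hzz] at h
  linear_combination h / 2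

theorem isColorSymmetric_of_eq_numer_mul (hsym : ∀ α β, qExp a d q α β = qExp a d q β α)
    (he : IsSmoothAction a d q e) (hP : P.coeff = wordNumer a d q e ξ v (stdWord n))
    {A : Laurent (Var n)} (hA : P = numer n * A) : IsColorSymmetric A := by
  intro σ hσ
  obtain ⟨ε, hε, h1, h2⟩ := exists_permute_eq hsym he hP hσ
  rw [hA, map_mul, h2, smul_mul_assoc] at h1
  exact mul_left_cancel₀ numer_ne_zero (smul_right_injective _ hε h1)

/-- The two variables are neighbours in the standard word, so their interchange alters one factor of
the denominator only, and it changes the sign of `P`. -/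
theorem isTwistedSymmetric_of_coeff_eq (hsym : ∀ α β, qExp a d q α β = qExp a d q β α)
    (ha : ∀ α, a α α = 2) (he : IsSmoothAction a d q e)
    (hP : P.coeff = wordNumer a d q e ξ v (stdWord n)) :
    IsTwistedSymmetric d q (algebraMap (Laurent (Var n)) (RatFun (Var n)) P /
      algebraMap (Laurent (Var n)) (RatFun (Var n)) (denom a d q n)) := by
  intro α i j hij
  obtain ⟨p, s, hps⟩ := exists_stdWord_eq hij
  set x : Var n := ⟨α, i⟩ with hx
  set y : Var n := ⟨α, j⟩ with hy
  have hxy : x ≠ y := Before.ne (.inr ⟨rfl, by simp [x, y, hij]⟩)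
  have hnd := stdWord_nodup (n := n)
  rw [hps] at hnd
  have hd := List.disjoint_of_nodup_append hnd
  have h2 := (List.nodup_append.1 hnd).2.1
  rw [List.nodup_cons, List.nodup_cons] at h2
  obtain ⟨E, hE1, hE2⟩ := exists_pairProd_swap (vertexForm a d q) p s x y
  have hmap : (stdWord n).map (Equiv.swap x y) = p ++ y :: x :: s := by
    have hfix : ∀ t : List (Var n), x ∉ t → y ∉ t → t.map (Equiv.swap x y) = t := fun t h1 h2 =>
      (List.map_congr_left fun z hz => Equiv.swap_apply_of_ne_of_ne (by rintro rfl; exact h1 hz)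
        (by rintro rfl; exact h2 hz)).trans (List.map_id t)
    rw [hps, List.map_append, List.map_cons, List.map_cons, Equiv.swap_apply_left,
      Equiv.swap_apply_right, hfix p (fun h => hd h (by simp)) (fun h => hd h (by simp)),
      hfix s (fun h => h2.1 (List.mem_cons_of_mem _ h)) h2.2.1]
  have hD : denom a d q n = vertexForm a d q x y * E := by
    rw [← wordDenom_stdWord, wordDenom, hps, hE1]
  have hD' : permute (Equiv.swap x y) (denom a d q n) = vertexForm a d q y x * E := by
    rw [← wordDenom_stdWord, wordDenom, ← hE2, ← hmap, map_pairProd, pairProd_map]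
    congr
    ext z w : 2
    have hσ : ∀ t, (Equiv.swap x y t).1 = t.1 := by
      intro t
      rw [Equiv.swap_apply_def]
      split_ifs with h1 h2
      · rw [h1]
      · rw [h2]
      · rfl
    rw [vertexForm, vertexForm, map_sub, map_smul, permute_Z, permute_Z, hσ, hσ]
  have hform : vertexForm a d q x y = (q ^ d α) ^ 2 • Z x - Z y := by
    rw [vertexForm, qExp, ha]
    norm_cast
  have hform' : vertexForm a d q y x = -(Z x - (q ^ d α) ^ 2 • Z y) := by
    rw [vertexForm, qExp, ha, neg_sub]
    norm_cast
  have hxy0 : vertexForm a d q x y ≠ 0 := linear_ne_zero hxy _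
  have hyx0 : vertexForm a d q y x ≠ 0 := linear_ne_zero hxy.symm _
  have hE0 : E ≠ 0 := by
    rintro rfl
    exact denom_ne_zero a d q (hD.trans (mul_zero _))
  have hinj := IsFractionRing.injective (Laurent (Var n)) (RatFun (Var n))
  have hne : ∀ Q : Laurent (Var n), Q ≠ 0 → algebraMap (Laurent (Var n)) (RatFun (Var n)) Q ≠ 0 :=
    fun Q hQ h => hQ (hinj (h.trans (map_zero _).symm))
  have hperm : ∀ Q : Laurent (Var n), permuteRat (Equiv.swap x y)
      (algebraMap (Laurent (Var n)) (RatFun (Var n)) Q) =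
      algebraMap (Laurent (Var n)) (RatFun (Var n)) (permute (Equiv.swap x y) Q) := fun Q =>
    IsFractionRing.ringEquivOfRingEquiv_algebraMap _ _
  rw [map_div₀, hperm, hperm, permute_swap hsym he hP hxy rfl, hD', hform',
    ← hform, hD]
  rw [hform'] at hyx0
  have h1 := hne _ hxy0
  have h2 := hne _ (neg_ne_zero.1 hyx0)
  have h3 := hne _ hE0
  rw [map_mul, map_mul, map_neg, map_neg]
  field_simp

end Numerator

/-! ### The vanishing conditions -/

section Locus

variable {ι : Type} [Fintype ι] [DecidableEq ι]

/-- The Laurent polynomials which can be cancelled from those vanishing at all the points which are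
proportional to `z` on `S`. -/
def locusCancelable (S : Set ι) (z : ι → ℂˣ) : Submonoid (Laurent ι) where
  carrier := {Q | ∀ A : Laurent ι,
    (∀ ζ : ι → ℂˣ, (∀ x ∈ S, ∀ y ∈ S, ζ x * z y = z x * ζ y) → (Q * A).value ζ = 0) →
    ∀ ζ : ι → ℂˣ, (∀ x ∈ S, ∀ y ∈ S, ζ x * z y = z x * ζ y) → A.value ζ = 0}
  one_mem' := fun A h => by simpa using h
  mul_mem' := fun {P Q} hP hQ A h => hQ A (hP (Q * A) (by simpa only [mul_assoc] using h))

/-- The locus is the image of a torus: on `S` all coordinates are multiples of the one at `b`, the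
others are free. It is therefore irreducible, and a difference involving a free coordinate does not
vanish identically on it. -/
theorem Z_sub_mem_locusCancelable {S : Set ι} {z : ι → ℂˣ} {b x y : ι} (hb : b ∈ S) (hxy : x ≠ y)
    (h : x ∉ S ∨ y ∉ S) : (Z x - Z y : Laurent ι) ∈ locusCancelable S z := by
  classical
  intro A hA ζ hζ
  let π : ι → ι := fun t => if t ∈ S then b else t
  let c : ι → ℂˣ := fun t => if t ∈ S then z t * (z b)⁻¹ else 1
  have hlocus : ∀ w : ι → ℂˣ, ∀ s ∈ S, ∀ t ∈ S,
      (c s * w (π s)) * z t = z s * (c t * w (π t)) := by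
    intro w s hs t ht
    simp only [c, π, if_pos hs, if_pos ht]
    simp only [mul_left_comm, mul_comm]
  rcases value_eq_zero_or_of_mul π c (P := Z x - Z y) (Q := A) fun w => hA _ (hlocus w) with h1 | h1
  · exfalso
    have hπ : π y ≠ π x := by
      simp only [π]
      split_ifs with hy hx hx
      · exact absurd h (by tauto)
      · exact fun h => hx (h ▸ hb)
      · exact fun h => hy (h ▸ hb)
      · exact hxy.symm
    -- The parameter of `x` is adjusted so that the coordinate at `x` is twice the one at `y`.
    have h2 := h1 (Function.update 1 (π x) ((c x)⁻¹ * c y * Units.mk0 2 two_ne_zero))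
    rw [value_Z_sub, Function.update_self, Function.update_of_ne hπ, sub_eq_zero, Units.val_inj,
      mul_assoc, mul_inv_cancel_left] at h2
    have h3 := congrArg Units.val (mul_left_cancel h2)
    norm_num at h3
  · have h2 := h1 ζ
    have h3 : (fun t => c t * ζ (π t)) = ζ := by
      ext t
      by_cases ht : t ∈ S
      · simp only [c, π, if_pos ht]
        rw [mul_right_comm, ← hζ t ht b hb, mul_inv_cancel_right]
      · simp only [c, π, if_neg ht, one_mul]
    rwa [h3] at h2

end Locus

/-! ### Serre chains, the vanishing conditions, and the passage from `A` to `B` -/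

section Vanishing

variable {r : ℕ} {n : Fin r → ℕ} {V : Type u} [AddCommGroup V] [Module ℂ V]
  {a : Fin r → Fin r → ℤ} {d : Fin r → ℕ} {q : ℂ} {e : Fin r → ℤ → Module.End ℂ V}

theorem pairwise_leftOf (p l : List (Var n)) : l.Pairwise (LeftOf (p ++ l)) := by
  induction l generalizing p with
  | nil => exact List.Pairwise.nil
  | cons x l ih =>
    refine List.pairwise_cons.2 ⟨fun y hy => ?_, by simpa using ih (p ++ [x])⟩
    obtain ⟨u, w, rfl⟩ := List.append_of_mem hy
    exact ⟨p ++ x :: u, w, by simp, by simp⟩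

/-- The variables `z_j^{(β)}, z_{i_1}^{(α)}, z_{i_2}^{(α)}, …`. -/
def serreChain {α β : Fin r} {N : ℕ} (i : Fin N → Fin (n α)) (j : Fin (n β)) : ℕ → Var n
  | 0 => ⟨β, j⟩
  | k + 1 => if h : k < N then ⟨α, i ⟨k, h⟩⟩ else ⟨β, j⟩

theorem serreChain_succ {α β : Fin r} {N : ℕ} (i : Fin N → Fin (n α)) (j : Fin (n β)) {k : ℕ}
    (hk : k < N) : serreChain i j (k + 1) = ⟨α, i ⟨k, hk⟩⟩ := by
  rw [serreChain, dif_pos hk]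

theorem serreChain_injOn {α β : Fin r} (hαβ : α ≠ β) {N : ℕ} {i : Fin N → Fin (n α)}
    (hi : Function.Injective i) (j : Fin (n β)) : Set.InjOn (serreChain i j) (Set.Iic N) := by
  intro k hk l hl h
  rw [Set.mem_Iic] at hk hl
  cases k with
  | zero =>
    cases l with
    | zero => rfl
    | succ l =>
      rw [serreChain_succ i j hl] at h
      exact absurd (congrArg Sigma.fst h).symm hαβ
  | succ k =>
    cases l with
    | zero =>
      rw [serreChain_succ i j hk] at h
      exact absurd (congrArg Sigma.fst h) hαβ
    | succ l =>
      rw [serreChain_succ i j hk, serreChain_succ i j hl, Sigma.mk.injEq, heq_eq_eq] at h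
      have := hi h.2
      simpa using this

/-- The coefficients of the linear forms relating neighbours in a Serre chain. -/
def serreCoeff (a : Fin r → Fin r → ℤ) (d : Fin r → ℕ) (q : ℂ) (α β : Fin r) : ℕ → ℂ
  | 0 => qExp a d q α β
  | _ + 1 => qExp a d q α α

theorem qExp_ne_zero (hq : q ≠ 0) (α β : Fin r) : qExp a d q α β ≠ 0 :=
  zpow_ne_zero _ (pow_ne_zero _ hq)

theorem wordOp_serreChain {α β : Fin r} {N : ℕ} (i : Fin N → Fin (n α)) (j : Fin (n β)) {κ : ℤ}
    {m : Var n → ℤ} (hm : ∀ k, 0 < k → k ≤ N → m (serreChain i j k) = κ) :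
    wordOp e ((List.range (N + 1)).reverse.map (serreChain i j)) m =
      e α (-κ) ^ N * e β (-m ⟨β, j⟩) := by
  rw [List.range_succ_eq_map, List.reverse_cons, List.map_append, wordOp_append]
  congr 1
  · rw [wordOp, List.map_map, List.map_reverse, List.map_map,
      List.map_congr_left (g := fun _ => e α (-κ)) fun k hk => ?_]
    · simp
    · have hk := List.mem_range.1 hk
      simp only [Function.comp]
      rw [hm (k + 1) k.succ_pos hk, serreChain_succ i j hk]

/-- Since `α ≠ β`, the pairs involving `z 0` contribute nothing to the equal-colour differences;
this explains the shift of indices in `chainNumer`. -/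
theorem chainNumer_serreChain {α β : Fin r} (hαβ : α ≠ β) {N : ℕ} (hN : 0 < N)
    (i : Fin N → Fin (n α)) (j : Fin (n β)) :
    pairProd (fun x y : Var n => if x.1 = y.1 then (Z x - Z y : Laurent (Var n)) else 1)
      ((List.range (N + 1)).reverse.map (serreChain i j)) = chainNumer (serreChain i j) N 0 := by
  obtain ⟨N, rfl⟩ := Nat.exists_eq_succ_of_ne_zero hN.ne'
  have hc : ∀ k < N + 1, (serreChain i j (k + 1)).1 = α := fun k hk => by
    rw [serreChain_succ i j hk]
  rw [pairProd_reverse_range_map, chainNumer, ← Finset.range_eq_Ico, Finset.prod_range_succ',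
    Finset.prod_range_succ]
  congr 1
  · refine Finset.prod_congr rfl fun k hk => Finset.prod_congr rfl fun l hl => ?_
    rw [Finset.mem_range] at hk
    rw [Finset.mem_Ico] at hl
    obtain ⟨l, rfl⟩ := Nat.exists_eq_succ_of_ne_zero (show l ≠ 0 by omega)
    rw [if_pos (by rw [hc l (by omega), hc k (by omega)])]
  · rw [Finset.Ico_self, Finset.prod_empty]
    refine Finset.prod_eq_one fun l hl => if_neg ?_
    rw [Finset.mem_Ico] at hl
    obtain ⟨l, rfl⟩ := Nat.exists_eq_succ_of_ne_zero (show l ≠ 0 by omega)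
    rw [hc l (by omega)]
    exact hαβ

theorem chainLinear_serreChain {α β : Fin r} {N : ℕ} (i : Fin N → Fin (n α)) (j : Fin (n β)) :
    wordDenom a d q ((List.range (N + 1)).reverse.map (serreChain i j)) =
      chainLinear (serreChain i j) (serreCoeff a d q α β) N 0 := by
  have hc : ∀ k < N, (serreChain i j (k + 1)).1 = α := fun k hk => by
    rw [serreChain_succ i j hk]
  rw [wordDenom, pairProd_reverse_range_map, chainLinear]
  refine Finset.prod_congr rfl fun k hk => Finset.prod_congr rfl fun l hl => ?_
  rw [Finset.mem_Ico] at hk hl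
  obtain ⟨l, rfl⟩ := Nat.exists_eq_succ_of_ne_zero (show l ≠ 0 by omega)
  rw [vertexForm, hc l (by omega)]
  cases k with
  | zero => rfl
  | succ k => rw [hc k (by omega), serreCoeff]

/-- The points of the locus of the vanishing condition for given indices. -/
theorem serre_locus_iff (hq : q ≠ 0) (ha : ∀ α, a α α = 2) {α β : Fin r} {N : ℕ}
    {i : Fin N → Fin (n α)} {j : Fin (n β)} {z : Var n → ℂˣ}
    (hz : ∀ t : Fin N, (q ^ d α) ^ (2 * (t : ℕ)) * (z ⟨α, i t⟩ : ℂ) =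
        (q ^ d α) ^ (-a α β) * (z ⟨β, j⟩ : ℂ)) (k : ℕ) (hk : k < N) :
    serreCoeff a d q α β k * z (serreChain i j (k + 1)) = z (serreChain i j k) := by
  have hp : q ^ d α ≠ 0 := pow_ne_zero _ hq
  have h := hz ⟨k, hk⟩
  rw [serreChain_succ i j hk]
  cases k with
  | zero =>
    simp only [mul_zero, pow_zero, one_mul] at h
    rw [h, serreCoeff, qExp, ← mul_assoc, ← zpow_add₀ hp, add_neg_cancel, zpow_zero, one_mul]
    rfl
  | succ k =>
    have h' := hz ⟨k, k.lt_succ_self.trans hk⟩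
    rw [← h, mul_add, pow_add, mul_assoc] at h'
    rw [serreChain_succ i j (k.lt_succ_self.trans hk), serreCoeff, qExp, ha,
      mul_left_cancel₀ (pow_ne_zero _ hp) h']
    norm_cast

/-- The set of the variables in the vanishing condition for given indices. -/
def serreBlock {α β : Fin r} {N : ℕ} (i : Fin N → Fin (n α)) (j : Fin (n β)) : Set (Var n) :=
  chainBlock (serreChain i j) N

theorem mem_serreBlock_self {α β : Fin r} {N : ℕ} (i : Fin N → Fin (n α)) (j : Fin (n β)) :
    (⟨β, j⟩ : Var n) ∈ serreBlock i j := ⟨0, Nat.zero_le _, rfl⟩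

theorem mem_serreBlock {α β : Fin r} {N : ℕ} (i : Fin N → Fin (n α)) (j : Fin (n β)) (t : Fin N) :
    (⟨α, i t⟩ : Var n) ∈ serreBlock i j :=
  ⟨t + 1, t.2, by rw [serreChain_succ i j t.2]⟩

theorem fst_of_mem_serreBlock {α β : Fin r} {N : ℕ} {i : Fin N → Fin (n α)} {j : Fin (n β)}
    {x : Var n} (hx : x ∈ serreBlock i j) : x.1 = α ∨ x.1 = β := by
  obtain ⟨k, hk, rfl⟩ := hx
  cases k with
  | zero => exact .inr rfl
  | succ k => exact .inl (by rw [serreChain_succ i j (Set.mem_Iic.1 hk)])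

theorem serre_locus_of_proportional {α β : Fin r} {N : ℕ}
    {i : Fin N → Fin (n α)} {j : Fin (n β)} {z ζ : Var n → ℂˣ}
    (hz : ∀ t : Fin N, (q ^ d α) ^ (2 * (t : ℕ)) * (z ⟨α, i t⟩ : ℂ) =
        (q ^ d α) ^ (-a α β) * (z ⟨β, j⟩ : ℂ))
    (hζ : ∀ x ∈ serreBlock i j, ∀ y ∈ serreBlock i j, ζ x * z y = z x * ζ y)
    (t : Fin N) : (q ^ d α) ^ (2 * (t : ℕ)) * (ζ ⟨α, i t⟩ : ℂ) =
        (q ^ d α) ^ (-a α β) * (ζ ⟨β, j⟩ : ℂ) := by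
  have h := congrArg Units.val (hζ _ (mem_serreBlock i j t) _ (mem_serreBlock_self i j))
  simp only [Units.val_mul] at h
  refine mul_right_cancel₀ (Units.ne_zero (z ⟨β, j⟩)) ?_
  rw [mul_assoc, h, ← mul_assoc, hz]
  ring

/-- Writing the chain at the right end of the word puts the correlation function in the form treated
by `value_eq_zero_of_chain`. The equal-colour differences split into those inside the chain, which
compensate for its superfluous denominators, and a factor `Q` which can be cancelled on the locus.
-/
theorem value_eq_zero_of_eq_numer_mul (hq : q ≠ 0)
    (hsym : ∀ α β, qExp a d q α β = qExp a d q β α)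
    (ha : ∀ α, a α α = 2) (ha' : ∀ α β, α ≠ β → a α β ≤ 0)
    (he : IsSmoothAction a d q e) {ξ : Module.Dual ℂ V} {v : V} {P A : Laurent (Var n)}
    (hP : P.coeff = wordNumer a d q e ξ v (stdWord n)) (hA : P = numer n * A) {α β : Fin r}
    (hαβ : α ≠ β) {N : ℕ} (hNa : (1 - a α β).toNat = N) {i : Fin N → Fin (n α)} (j : Fin (n β))
    (hi : Function.Injective i) {z : Var n → ℂˣ}
    (hz : ∀ t : Fin N, (q ^ d α) ^ (2 * (t : ℕ)) * (z ⟨α, i t⟩ : ℂ) =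
      (q ^ d α) ^ (-a α β) * (z ⟨β, j⟩ : ℂ)) : A.value z = 0 := by
  have hN : 0 < N := by
    have := ha' α β hαβ
    omega
  set w := serreChain i j with hw
  set blk : List (Var n) := (List.range (N + 1)).reverse.map w with hblk
  have hinj := serreChain_injOn hαβ hi j
  have hmem_blk : ∀ x, x ∈ blk ↔ x ∈ serreBlock i j := by
    intro x
    simp [hblk, serreBlock, chainBlock, hw]
  classical
  -- The remaining variables stand to the left, so the modes of the chain act directly on `v`.
  set us : List (Var n) := (Finset.univ.filter fun x => x ∉ serreBlock i j).toList with hus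
  have hmem_us : ∀ x, x ∈ us ↔ x ∉ serreBlock i j := by
    intro x
    rw [hus, Finset.mem_toList, Finset.mem_filter]
    simp
  have hblk_nd : blk.Nodup := by
    refine List.Nodup.map_on ?_ (List.nodup_reverse.2 List.nodup_range)
    intro k hk l hl h
    simp only [List.mem_reverse, List.mem_range] at hk hl
    exact hinj (Set.mem_Iic.2 (by omega)) (Set.mem_Iic.2 (by omega)) h
  have hnd : (us ++ blk).Nodup := by
    refine List.Nodup.append (Finset.nodup_toList _) hblk_nd fun x hx hx' => ?_
    exact (hmem_us x).1 hx ((hmem_blk x).1 hx')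
  have hall : ∀ x, x ∈ us ++ blk := by
    intro x
    rw [List.mem_append, hmem_us, hmem_blk]
    exact (em _).symm
  obtain ⟨ε, hε, hnum, -⟩ := exists_wordNumer_eq hsym he ξ v hnd hall
  have hpw := pairwise_leftOf [] (us ++ blk)
  rw [List.nil_append, List.pairwise_append] at hpw
  have hr : ∀ k l, k < l → l ≤ N → LeftOf (us ++ blk) (w l) (w k) := by
    intro k l hkl hl
    have h1 := hpw.2.1
    rw [hblk, List.pairwise_map, List.pairwise_reverse, ← hblk, List.pairwise_iff_getElem] at h1
    have h2 := h1 k l (by rw [List.length_range]; omega) (by rw [List.length_range]; omega) hkl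
    have hk : (List.range (N + 1))[k]'(by rw [List.length_range]; omega) = k := by simp
    have hl' : (List.range (N + 1))[l]'(by rw [List.length_range]; omega) = l := by simp
    rwa [hk, hl'] at h2
  -- the factors of the denominator outside the chain
  set E : Laurent (Var n) := wordDenom a d q us *
    (us.map fun x => (blk.map (vertexForm a d q x)).prod).prod with hE
  have hden : wordDenom a d q (us ++ blk) = E * chainLinear w (serreCoeff a d q α β) N 0 := by
    rw [← chainLinear_serreChain, wordDenom, pairProd_append, hE, wordDenom, wordDenom]
    ring
  have hEc : ∀ k ≤ N, E ∈ cancelable (LeftOf (us ++ blk)) (chainTail w k) := by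
    intro k hk
    have hus' : ∀ x ∈ us, x ∉ chainTail w k := fun x hx hx' => (hmem_us x).1 hx
      (chainBlock_mono w hk (chainTail_subset_chainBlock w k hx'))
    refine mul_mem (pairProd_mem _ ?_) (Submonoid.list_prod_mem _ ?_)
    · exact hpw.1.imp_of_mem fun {x y} hx _ hxy =>
        linear_mem_cancelable (qExp_ne_zero hq _ _) (hus' x hx) hxy
    · intro p hp
      obtain ⟨x, hx, rfl⟩ := List.mem_map.1 hp
      refine Submonoid.list_prod_mem _ fun p hp => ?_
      obtain ⟨y, hy, rfl⟩ := List.mem_map.1 hp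
      exact linear_mem_cancelable (qExp_ne_zero hq _ _) (hus' x hx) (hpw.2.2 x hx y hy)
  -- the factors of the numerator outside the chain
  set φ : Var n → Var n → Laurent (Var n) := fun x y => if x.1 = y.1 then Z x - Z y else 1 with hφ
  set Q : Laurent (Var n) := pairProd φ us *
    (us.map fun x => (blk.map (φ x)).prod).prod with hQ
  have hφQ : pairProd φ (us ++ blk) = chainNumer w N 0 * Q := by
    rw [pairProd_append, hQ, ← chainNumer_serreChain hαβ hN]
    ring
  have hφc : ∀ x ∈ us, ∀ y, x ≠ y → φ x y ∈ locusCancelable (serreBlock i j) z := by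
    intro x hx y hxy
    simp only [hφ]
    split_ifs
    · exact Z_sub_mem_locusCancelable (mem_serreBlock_self i j) hxy (.inl ((hmem_us x).1 hx))
    · exact one_mem _
  have hQc : Q ∈ locusCancelable (serreBlock i j) z := by
    have hd := List.nodup_append.1 hnd
    refine mul_mem (pairProd_mem _ ?_) (Submonoid.list_prod_mem _ ?_)
    · exact hd.1.imp_of_mem fun {x y} hx _ hxy => hφc x hx y hxy
    · intro p hp
      obtain ⟨x, hx, rfl⟩ := List.mem_map.1 hp
      refine Submonoid.list_prod_mem _ fun p hp => ?_
      obtain ⟨y, hy, rfl⟩ := List.mem_map.1 hp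
      exact hφc x hx y (hd.2.2 x hx y hy)
  obtain ⟨η, hη, hnumer⟩ : ∃ η : ℂ, η ≠ 0 ∧ numer n = η • pairProd φ (us ++ blk) := by
    have h1 := pairProd_perm (φ := φ) (fun x y => by
      simp only [hφ, eq_comm (a := y.1)]
      split_ifs
      · right; ring
      · left; rfl) (stdWord_perm hnd hall).symm []
    rw [List.nil_append, List.nil_append, ← numer_eq_pairProd] at h1
    rcases h1 with h1 | h1
    · exact ⟨1, one_ne_zero, by rw [h1, one_smul]⟩
    · exact ⟨-1, by norm_num, by rw [h1, neg_one_smul]⟩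
  -- Cancelling `Q` needs the vanishing of `Q * A` at all points proportional to `z` on the block;
  -- these satisfy the same chain of equations.
  refine hQc A (fun ζ hζ => ?_) z fun _ _ _ _ => mul_comm _ _ |>.trans (mul_comm _ _)
  have hε0 : ε * η ≠ 0 := mul_ne_zero (by rcases hε with rfl | rfl <;> norm_num) hη
  have hmain : ((ε * η) • (Q * A)).value ζ = 0 := by
    refine value_eq_zero_of_chain (r := LeftOf (us ++ blk)) (f := wordCorr e ξ v (us ++ blk))
      hinj (c := serreCoeff a d q α β) (fun k => ?_)
      (serre_locus_iff hq ha (serre_locus_of_proportional hz hζ)) hr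
      (fun x y hxy => wordCorr_decaysAlong he ξ v hnd hxy) hEc ?_ ?_
    · cases k <;> exact qExp_ne_zero hq _ _
    · rw [← hden, ← wordNumer, hnum, ← hP, hA, hnumer, hφQ]
      have h1 : chainNumer w N 0 * ((ε * η) • (Q * A)) =
          ε • (η • (chainNumer w N 0 * Q) * A) := by
        rw [mul_smul_comm, smul_mul_assoc, mul_smul, mul_assoc (chainNumer w N 0) Q A]
      rw [h1, AddMonoidAlgebra.coeff_smul]
      rfl
    -- For `κ < -M + 1` the mode `-κ` is at least `M`, so it kills `v`, and the consequence of the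
    -- Serre relations applies.
    · obtain ⟨M, hM⟩ := he.smooth α v
      refine ⟨-M + 1, fun κ hκ m hm => ?_⟩
      rw [wordCorr, wordOp_append, hblk, wordOp_serreChain i j hm, Module.End.mul_apply,
        Module.End.mul_apply, ← hNa, he.serre α β hαβ _ _ _ (hM _ (by omega)), map_zero, map_zero]
  rw [← evalUnits_eq_value, map_smul, smul_eq_mul, mul_eq_zero, evalUnits_eq_value] at hmain
  exact hmain.resolve_left hε0

theorem vanishesFor_of_eq_numer_mul (hq : q ≠ 0)
    (hsym : ∀ α β, qExp a d q α β = qExp a d q β α)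
    (ha : ∀ α, a α α = 2) (ha' : ∀ α β, α ≠ β → a α β ≤ 0)
    (he : IsSmoothAction a d q e) {ξ : Module.Dual ℂ V} {v : V} {P A : Laurent (Var n)}
    (hP : P.coeff = wordNumer a d q e ξ v (stdWord n)) (hA : P = numer n * A) {α β : Fin r}
    (hαβ : α ≠ β) : VanishesFor a d q A α β := fun _ j hi _ hz =>
  value_eq_zero_of_eq_numer_mul hq hsym ha ha' he hP hA hαβ rfl j hi hz

/-- For `a α β = 0` the vanishing condition concerns one `i` and one `j`, and says that `A` vanishes
on their diagonal. The product `T` of these differences thus divides `A`, and it is also the excess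
of `denom` over `denomNonzero`. -/
theorem exists_denomNonzero_form (ha0 : ∀ α β, a α β = 0 ↔ a β α = 0) (ha : ∀ α, a α α = 2)
    {A : Laurent (Var n)} (hA : ∀ α β, α ≠ β → VanishesFor a d q A α β) :
    ∃ T B : Laurent (Var n), denom a d q n = denomNonzero a d q n * T ∧ A = T * B ∧
      ∀ α β, α ≠ β → a α β ≠ 0 → VanishesFor a d q B α β := by
  classical
  let s : Finset (Var n × Var n) := {p | Before p.1 p.2 ∧ a p.1.1 p.2.1 = 0}
  have hs : ∀ p ∈ s, Before p.1 p.2 ∧ a p.1.1 p.2.1 = 0 := fun p hp => (Finset.mem_filter.1 hp).2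
  have hcol : ∀ p ∈ s, p.1.1 ≠ p.2.1 := by
    intro p hp h
    have := (hs p hp).2
    rw [h, ha] at this
    norm_num at this
  have hdvd : ∏ p ∈ s, (Z p.1 - Z p.2) ∣ A := by
    refine prod_Z_sub_dvd s A (fun p hp => (hs p hp).1.ne)
      (fun p hp hp' => (hs p hp).1.asymm (hs _ hp').1) fun p hp => ?_
    rw [Z_sub_dvd_iff]
    intro z hz
    refine hA p.1.1 p.2.1 (hcol p hp) (fun _ => p.1.2) p.2.2 ?_ z ?_
    · have h1 : (1 - a p.1.1 p.2.1).toNat = 1 := by rw [(hs p hp).2]; rfl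
      intro t t' _
      apply Fin.ext
      omega
    · intro t
      have ht : (t : ℕ) = 0 := by
        have h1 : (1 - a p.1.1 p.2.1).toNat = 1 := by rw [(hs p hp).2]; rfl
        omega
      rw [ht, (hs p hp).2]
      simpa using congrArg Units.val hz
  obtain ⟨B, hB⟩ := hdvd
  refine ⟨_, B, ?_, hB, ?_⟩
  · rw [denom, denomNonzero, ← Finset.prod_filter_mul_prod_filter_not _
      (fun p : Var n × Var n => a p.1.1 p.2.1 ≠ 0), Finset.filter_filter, Finset.filter_filter]
    congr 1
    refine Finset.prod_congr ?_ fun p hp => ?_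
    · simp only [s, not_not]
    · rw [qExp, (hs p hp).2, zpow_zero, one_smul]
  · intro α β hαβ hne i j hi z hz
    -- A factor of `T` with both variables in the block would join `α` and `β`, in some order, or
    -- two variables of one colour; each contradicts the vanishing of its Cartan entry.
    have hT : ∏ p ∈ s, (Z p.1 - Z p.2) ∈ locusCancelable (serreBlock i j) z := by
      refine Submonoid.prod_mem _ fun p hp => ?_
      refine Z_sub_mem_locusCancelable (mem_serreBlock_self i j) (hs p hp).1.ne ?_
      by_contra h
      push Not at h
      have h0 := (hs p hp).2
      rcases fst_of_mem_serreBlock h.1 with h1 | h1 <;>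
        rcases fst_of_mem_serreBlock h.2 with h2 | h2 <;> rw [h1, h2] at h0
      · rw [ha] at h0; norm_num at h0
      · exact hne h0
      · exact hne ((ha0 _ _).1 h0)
      · rw [ha] at h0; norm_num at h0
    refine hT B (fun ζ hζ => ?_) z fun _ _ _ _ => mul_comm _ _ |>.trans (mul_comm _ _)
    rw [← hB]
    exact hA α β hαβ i j hi ζ (serre_locus_of_proportional hz hζ)

end Vanishing

/-! ### Correlation functions of smooth actions -/

section Smooth

variable {r : ℕ} {n : Fin r → ℕ} {V : Type u} [AddCommGroup V] [Module ℂ V]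
  {a : Fin r → Fin r → ℤ} {d : Fin r → ℕ} {q : ℂ} {e : Fin r → ℤ → Module.End ℂ V}

theorem hasCorrelationProperties_wordCorr (hq : q ≠ 0)
    (hsym : ∀ α β, qExp a d q α β = qExp a d q β α) (ha : ∀ α, a α α = 2)
    (ha' : ∀ α β, α ≠ β → a α β ≤ 0) (ha0 : ∀ α β, a α β = 0 ↔ a β α = 0)
    (he : IsSmoothAction a d q e) {ξ : Module.Dual ℂ V} {v : V} {K : ℤ}
    (hK : ∀ m, wordCorr e ξ v (stdWord n) m ≠ 0 → ∑ x, m x = K) :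
    HasCorrelationProperties a d q (wordCorr e ξ v (stdWord n)) := by
  obtain ⟨P, hP⟩ := exists_coeff_eq_wordNumer hsym he hK
  obtain ⟨A, hA⟩ := numer_dvd hsym he hP
  obtain ⟨T, B, hT, hAB, hB⟩ := exists_denomNonzero_form (d := d) (q := q) ha0 ha
    fun α β hαβ => vanishesFor_of_eq_numer_mul hq hsym ha ha' he hP hA hαβ
  have hinj : Function.Injective (algebraMap (Laurent (Var n)) (RatFun (Var n))) :=
    IsFractionRing.injective _ _
  have hne {p : Laurent (Var n)} (hp : p ≠ 0) :
      algebraMap (Laurent (Var n)) (RatFun (Var n)) p ≠ 0 := (map_ne_zero_iff _ hinj).2 hp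
  have hT0 : T ≠ 0 := fun h => denom_ne_zero (n := n) a d q (by rw [hT, h, mul_zero])
  have hiter := isIteratedLaurent_wordCorr he ξ v (n := n)
  refine ⟨hiter, _, ⟨hiter, P, denom a d q n, denom_ne_zero a d q, rfl, ?_⟩, ⟨P, rfl⟩,
    isTwistedSymmetric_of_coeff_eq hsym ha he hP,
    ⟨A, ?_, isColorSymmetric_of_eq_numer_mul hsym he hP hA,
      fun α β hαβ => vanishesFor_of_eq_numer_mul hq hsym ha ha' he hP hA hαβ⟩, B, ?_, hB⟩
  · rw [← act_eq_mulSeries, ← wordDenom_stdWord, hP]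
    rfl
  · rw [hA, map_mul, mul_div_right_comm]
  · rw [hA, hT, hAB, map_mul, map_mul, map_mul]
    have := hne hT0
    have := hne (denomNonzero_ne_zero (n := n) a d q)
    field_simp

theorem sum_map_stdWord (m : Var n → ℤ) : ((stdWord n).map m).sum = ∑ x, m x := by
  classical
  rw [← List.sum_toFinset m stdWord_nodup]
  congr 1
  ext x
  simp [mem_stdWord]

/-- If the current modes shift a grading, then matrix coefficients between homogeneous vectors and
covectors are homogeneous. -/
theorem sum_eq_of_wordCorr_ne_zero_of_graded {V' : ℤ → Submodule ℂ V}
    (he : ∀ α m k, ∀ u ∈ V' k, e α m u ∈ V' (k + m)) {ξ : Module.Dual ℂ V} {v : V} {k k' : ℤ}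
    (hv : v ∈ V' k) (hξ : ∀ l, l ≠ k' → ∀ u ∈ V' l, ξ u = 0) (m : Var n → ℤ)
    (hm : wordCorr e ξ v (stdWord n) m ≠ 0) : ∑ x, m x = k - k' := by
  have h (l : List (Var n)) : wordOp e l m v ∈ V' (k - (l.map m).sum) := by
    induction l with
    | nil => simpa [wordOp] using hv
    | cons x l ih =>
      rw [wordOp_cons, Module.End.mul_apply, List.map_cons, List.sum_cons,
        show k - (m x + (l.map m).sum) = k - (l.map m).sum + -m x by ring]
      exact he _ _ _ _ ih
  by_contra hne
  refine hm (hξ _ (fun h0 => hne ?_) _ (h _))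
  rw [sum_map_stdWord] at h0
  omega

/-- Matrix coefficients between eigenvectors and coeigenvectors of a degree operator are
homogeneous. -/
theorem exists_sum_eq_of_wordCorr_ne_zero {D : Module.End ℂ V}
    (hD : ∀ α (m : ℤ), D * e α m - e α m * D = (m : ℂ) • e α m) {ξ : Module.Dual ℂ V} {v : V}
    {c c' : ℂ} (hv : D v = c • v) (hξ : ∀ u, ξ (D u) = c' * ξ u) :
    ∃ K : ℤ, ∀ m, wordCorr e ξ v (stdWord n) m ≠ 0 → ∑ x, m x = K := by
  have h (m : Var n → ℤ) (l : List (Var n)) :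
      D (wordOp e l m v) = (c - ((l.map m).sum : ℤ)) • wordOp e l m v := by
    induction l with
    | nil => simpa [wordOp] using hv
    | cons x l ih =>
      have h1 := LinearMap.congr_fun (hD x.1 (-m x)) (wordOp e l m v)
      simp only [LinearMap.sub_apply, Module.End.mul_apply, LinearMap.smul_apply, ih, map_smul,
        sub_eq_iff_eq_add, ← add_smul] at h1
      rw [wordOp_cons, Module.End.mul_apply, h1, List.map_cons, List.sum_cons]
      congr 1
      push_cast
      ring
  have h1 (m : Var n → ℤ) (hm : wordCorr e ξ v (stdWord n) m ≠ 0) :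
      ((∑ x, m x : ℤ) : ℂ) = c - c' := by
    have h2 := hξ (wordOp e (stdWord n) m v)
    rw [h, map_smul, smul_eq_mul, sum_map_stdWord] at h2
    have h3 := mul_right_cancel₀ hm h2
    rw [← h3]
    ring
  by_cases h0 : ∃ m, wordCorr e ξ v (stdWord n) m ≠ 0
  · obtain ⟨m₀, hm₀⟩ := h0
    exact ⟨∑ x, m₀ x, fun m hm => Int.cast_injective (α := ℂ) ((h1 m hm).trans (h1 m₀ hm₀).symm)⟩
  · exact ⟨0, fun m hm => (h0 ⟨m, hm⟩).elim⟩

end Smooth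

/-! ### From modules over an algebra to actions -/

section Transfer

variable {A : Type*} {B : Type*} [Ring A] [Algebra ℂ A] [Ring B] [Algebra ℂ B]

theorem map_exchange (φ : A →ₐ[ℂ] B) (c : ℂ) (g : A) (x y : ℤ → A) (m k : ℤ) :
    φ (exchange c g x y m k) = exchange c (φ g) (fun m => φ (x m)) (fun m => φ (y m)) m k := by
  simp only [exchange, map_sub, map_smul, map_mul]

theorem map_serre (φ : A →ₐ[ℂ] B) (p : ℂ) (N : ℕ) (x y : ℤ → A) (k : Fin N → ℤ) (l : ℤ) :
    φ (serre p N x y k l) = serre p N (fun m => φ (x m)) (fun m => φ (y m)) k l := by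
  simp only [serre, map_sum, map_smul, map_mul, map_list_prod, List.map_map, Function.comp_def]

theorem qBinom_eq_zero_of_lt (p : ℂ) {N k : ℕ} (h : N < k) : qBinom p N k = 0 := by
  induction N generalizing k with
  | zero =>
    obtain ⟨k, rfl⟩ := Nat.exists_eq_succ_of_ne_zero h.ne'
    rfl
  | succ N ih =>
    obtain ⟨k, rfl⟩ := Nat.exists_eq_succ_of_ne_zero (Nat.zero_lt_of_lt h).ne'
    rw [qBinom, ih (by omega), ih (by omega), mul_zero, mul_zero, add_zero]

theorem qBinom_self (p : ℂ) (N : ℕ) : qBinom p N N = 1 := by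
  induction N with
  | zero => rfl
  | succ N ih => rw [qBinom, qBinom_eq_zero_of_lt p N.lt_succ_self, ih]; simp

theorem serre_const (p : ℂ) (N : ℕ) (x y : ℤ → A) (k l : ℤ) :
    serre p N x y (fun _ => k) l = (N.factorial : ℂ) •
      ∑ s ∈ Finset.range (N + 1), ((-1) ^ s * qBinom p N s) • (x k ^ s * y l * x k ^ (N - s)) := by
  rw [serre, Finset.smul_sum]
  refine Finset.sum_congr rfl fun s hs => ?_
  have hs : s ≤ N := by simpa [Nat.lt_succ_iff] using hs
  simp only [List.map_const', List.length_take, List.length_drop, List.length_finRange,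
    List.prod_replicate, min_eq_left hs, Finset.sum_const, Finset.card_univ, Fintype.card_perm,
    Fintype.card_fin]
  rw [← Nat.cast_smul_eq_nsmul ℂ, smul_comm]

/-- The consequence of the quantum Serre relations for the modes acting on a vector annihilated by
one of them. -/
theorem pow_apply_apply_eq_zero_of_serre {V : Type u} [AddCommGroup V] [Module ℂ V] {p : ℂ} {N : ℕ}
    {x y : ℤ → Module.End ℂ V} (h : ∀ k l, serre p N x y k l = 0) {k : ℤ} (l : ℤ) {w : V}
    (hw : x k w = 0) : (x k ^ N) (y l w) = 0 := by
  have h1 := h (fun _ => k) l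
  rw [serre_const, smul_eq_zero, or_iff_right (Nat.cast_ne_zero.2 N.factorial_ne_zero)] at h1
  have h2 := LinearMap.congr_fun h1 w
  -- In every term but the one with `s = N`, some `x k` acts on `w` first.
  rw [LinearMap.sum_apply, Finset.sum_range_succ, Finset.sum_eq_zero, zero_add] at h2
  · simpa [qBinom_self] using h2
  · intro s hs
    have hs := Finset.mem_range.1 hs
    obtain ⟨t, ht⟩ := Nat.exists_eq_succ_of_ne_zero (n := N - s) (by omega)
    rw [ht, Nat.succ_eq_add_one, pow_succ]
    simp [hw]

variable {r : ℕ} {n : Fin r → ℕ} {V : Type u} [AddCommGroup V] [Module ℂ V] [Module A V]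
  [IsScalarTower ℂ A V]

theorem correlation_eq_wordCorr (e : Fin r → ℤ → A) (ξ : Module.Dual ℂ V) (v : V) :
    correlation n e ξ v =
      wordCorr (fun α m => Algebra.lsmul ℂ ℂ V (e α m)) ξ v (stdWord n) := by
  ext m
  have h : wordOp (fun α m => Algebra.lsmul ℂ ℂ V (e α m)) (stdWord n) m =
      Algebra.lsmul ℂ ℂ V (((List.finRange r).map fun α =>
        ((List.finRange (n α)).map fun i => e α (-m ⟨α, i⟩)).prod).prod) := by
    rw [wordOp, stdWord, List.map_flatMap, List.flatMap, List.prod_flatten]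
    simp only [List.map_map, map_list_prod, Function.comp_def]
  rw [wordCorr, h]
  rfl

end Transfer

/-! ### Smoothness of currents -/

section Eventually

variable {V : Type u} [AddCommGroup V] [Module ℂ V]

/-- The modes `x[m]` with `m` large enough annihilate `w`. -/
def IsSmoothAt (x : ℤ → Module.End ℂ V) (w : V) : Prop := ∃ M : ℤ, ∀ m, M ≤ m → x m w = 0

variable {x y : ℤ → Module.End ℂ V} {c : ℂ} {g : Module.End ℂ V} {w : V}

theorem IsSmoothAt.add {w' : V} (h : IsSmoothAt x w) (h' : IsSmoothAt x w') :
    IsSmoothAt x (w + w') := by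
  obtain ⟨M, hM⟩ := h
  obtain ⟨M', hM'⟩ := h'
  refine ⟨max M M', fun m hm => ?_⟩
  rw [map_add, hM m (by omega), hM' m (by omega), add_zero]

theorem IsSmoothAt.of_commute {T : Module.End ℂ V} (hx : IsSmoothAt x w)
    (h : ∀ m, Commute (x m) T) : IsSmoothAt x (T w) := by
  obtain ⟨M, hM⟩ := hx
  refine ⟨M, fun m hm => ?_⟩
  rw [← Module.End.mul_apply, (h m).eq, Module.End.mul_apply, hM m hm, map_zero]

theorem exchange_apply (m k : ℤ) : exchange c g x y m k w =
    c • x (m + 1) (y k w) - g (x m (y (k + 1) w)) -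
      (y k (x (m + 1) w) - c • g (y (k + 1) (x m w))) := by
  simp [exchange]

/-- For `m` large the relation expresses `x[m] y[k] w` through `x[m-1] y[k+1] w`. Descending
induction on `k` starts where `y[k]` kills `w`, and each step raises the bound by one. -/
theorem IsSmoothAt.of_exchange (hc : c ≠ 0) (h : ∀ m k, exchange c g x y m k = 0)
    (hx : IsSmoothAt x w) (hy : IsSmoothAt y w) (k : ℤ) : IsSmoothAt x (y k w) := by
  obtain ⟨M, hM⟩ := hx
  obtain ⟨K, hK⟩ := hy
  have key (j : ℕ) : ∀ k m, K - j ≤ k → M + j ≤ m → x m (y k w) = 0 := by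
    induction j with
    | zero => exact fun k m hk _ => by rw [hK k (by simpa using hk), map_zero]
    | succ j ih =>
      intro k m hk hm
      push_cast at hk hm
      have h1 := LinearMap.congr_fun (h (m - 1) k) w
      rw [exchange_apply, sub_add_cancel, ih (k + 1) (m - 1) (by omega) (by omega),
        hM m (by omega), hM (m - 1) (by omega)] at h1
      simpa [hc] using h1
  exact ⟨M + (K - k).toNat, fun m hm => key (K - k).toNat k m (by omega) hm⟩

/-- The same recursion read in the other direction. The leading term now carries `g`, which has to
be injective. -/
theorem IsSmoothAt.of_exchange' (hc : c ≠ 0) (hg : Function.Injective g)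
    (h : ∀ m k, exchange c g x y m k = 0) (hx : IsSmoothAt x w) (hy : IsSmoothAt y w) (m : ℤ) :
    IsSmoothAt y (x m w) := by
  obtain ⟨M, hM⟩ := hx
  obtain ⟨K, hK⟩ := hy
  have key (j : ℕ) : ∀ k m, M - j ≤ m → K + j ≤ k → y k (x m w) = 0 := by
    induction j with
    | zero => exact fun k m hm _ => by rw [hM m (by simpa using hm), map_zero]
    | succ j ih =>
      intro k m hm hk
      push_cast at hk hm
      have h1 := LinearMap.congr_fun (h m (k - 1)) w
      rw [exchange_apply, sub_add_cancel, ih (k - 1) (m + 1) (by omega) (by omega),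
        hK k (by omega), hK (k - 1) (by omega)] at h1
      simpa [hc, map_eq_zero_iff g hg] using h1
  exact ⟨K + (M - m).toNat, fun k hk => key (M - m).toNat k m (by omega) hk⟩

theorem IsSmoothAt.of_commutator (hx : IsSmoothAt x w) (k : ℤ)
    (h : ∃ M : ℤ, ∀ m, M ≤ m → (x m * y k - y k * x m) w = 0) : IsSmoothAt x (y k w) := by
  obtain ⟨M, hM⟩ := hx
  obtain ⟨M', hM'⟩ := h
  refine ⟨max M M', fun m hm => ?_⟩
  have h1 := hM' m (by omega)
  rwa [LinearMap.sub_apply, Module.End.mul_apply, Module.End.mul_apply, hM m (by omega), map_zero,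
    sub_zero] at h1

/-- The recursion now involves the modes `m - 1` and `m - 2` of `x`, so the bound grows by two at
each step. -/
theorem IsSmoothAt.of_quadratic (hc : c ≠ 0) {T T' : Module.End ℂ V}
    (h : ∀ m k, c • (x (m + 2) * y k) - T * x (m + 1) * y (k + 1) + c • (x m * y (k + 2)) =
      c • (y k * x (m + 2)) - T' * y (k + 1) * x (m + 1) + c • (y (k + 2) * x m))
    (hx : IsSmoothAt x w) (hy : IsSmoothAt y w) (k : ℤ) : IsSmoothAt x (y k w) := by
  obtain ⟨M, hM⟩ := hx
  obtain ⟨K, hK⟩ := hy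
  have key (j : ℕ) : ∀ k m, K - j ≤ k → M + 2 * j ≤ m → x m (y k w) = 0 := by
    induction j with
    | zero => exact fun k m hk _ => by rw [hK k (by simpa using hk), map_zero]
    | succ j ih =>
      intro k m hk hm
      push_cast at hk hm
      have h1 := LinearMap.congr_fun (h (m - 2) k) w
      simp only [LinearMap.add_apply, LinearMap.sub_apply, LinearMap.smul_apply,
        Module.End.mul_apply] at h1
      rw [sub_add_cancel, ih (k + 1) _ (by omega) (by omega), ih (k + 2) _ (by omega) (by omega),
        hM m (by omega), hM (m - 2 + 1) (by omega), hM (m - 2) (by omega)] at h1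
      simpa [hc] using h1
  exact ⟨M + 2 * (K - k).toNat, fun m hm => key (K - k).toNat k m (by omega) hm⟩

theorem IsSmoothAt.of_degree {D : Module.End ℂ V} (hD : ∀ m : ℤ, D * x m - x m * D = (m : ℂ) • x m)
    (hx : IsSmoothAt x w) : IsSmoothAt x (D w) := by
  obtain ⟨M, hM⟩ := hx
  refine ⟨M, fun m hm => ?_⟩
  have h1 := LinearMap.congr_fun (hD m) w
  rw [LinearMap.sub_apply, Module.End.mul_apply, Module.End.mul_apply, LinearMap.smul_apply,
    hM m hm, map_zero, smul_zero, zero_sub, neg_eq_zero] at h1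
  exact h1

end Eventually

/-! ### Graded modules over `U_q 𝔫₊` -/

section NPlus

variable {r : ℕ} {a : Fin r → Fin r → ℤ} {d : Fin r → ℕ} {q : ℂ} {V : Type u} [AddCommGroup V]
  [Module ℂ V] [Module (NPlus a d q) V] [IsScalarTower ℂ (NPlus a d q) V]

theorem isSmoothAction_NPlus
    (h : ∀ α (w : V), IsSmoothAt (fun m => Algebra.lsmul ℂ ℂ V (NPlus.e a d q α m)) w) :
    IsSmoothAction a d q fun α m => Algebra.lsmul ℂ ℂ V (NPlus.e a d q α m) := by
  set ρ := (Algebra.lsmul ℂ ℂ V).comp (RingQuot.mkAlgHom ℂ (NPlusRel a d q)) with hρ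
  have hrel {s t : FreeAlgebra ℂ (Fin r × ℤ)} (hst : NPlusRel a d q s t) : ρ s = ρ t :=
    congrArg (Algebra.lsmul ℂ ℂ V) (RingQuot.mkAlgHom_rel ℂ hst)
  refine ⟨fun α β m k => ?_, fun α β hαβ k l w hw => ?_, h⟩
  · have h1 := hrel (.vertex α β m k)
    rwa [map_zero, map_exchange, map_one] at h1
  · refine pow_apply_apply_eq_zero_of_serre (p := q ^ d α)
      (x := fun m => Algebra.lsmul ℂ ℂ V (NPlus.e a d q α m))
      (y := fun m => Algebra.lsmul ℂ ℂ V (NPlus.e a d q β m)) (fun k l => ?_) l hw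
    have h1 := hrel (.serre α β hαβ k l)
    rwa [map_zero, map_serre] at h1

theorem isSmoothAt_of_graded {V' : ℤ → Submodule ℂ V} (hV : iSup V' = ⊤)
    (hb : ∃ N : ℤ, ∀ k, N < k → V' k = ⊥) {x : ℤ → Module.End ℂ V}
    (hx : ∀ m k, ∀ u ∈ V' k, x m u ∈ V' (k + m)) (w : V) : IsSmoothAt x w := by
  obtain ⟨N, hN⟩ := hb
  have hw : w ∈ iSup V' := hV ▸ Submodule.mem_top
  induction hw using Submodule.iSup_induction' with
  | mem k w hw =>
    refine ⟨N - k + 1, fun m hm => ?_⟩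
    have h1 := hx m k w hw
    rwa [hN (k + m) (by omega), Submodule.mem_bot] at h1
  | zero => exact ⟨0, fun m _ => map_zero _⟩
  | add w w' _ _ ih ih' => exact ih.add ih'

end NPlus

/-! ### Highest weight modules over the quantum affine algebra -/

namespace QAffine

variable {r : ℕ} (a : Fin r → Fin r → ℤ) (d : Fin r → ℕ) (q : ℂ) (V : Type u) [AddCommGroup V]
  [Module ℂ V] [Module (QAffine a d q) V] [IsScalarTower ℂ (QAffine a d q) V]

/-- The action of the free algebra on a `U_q 𝔤`-module. -/
def action : FreeAlgebra ℂ (AffGen r) →ₐ[ℂ] Module.End ℂ V :=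
  (Algebra.lsmul ℂ ℂ V).comp (RingQuot.mkAlgHom ℂ (AffRel a d q))

variable {a d q V}

theorem action_rel {s t : FreeAlgebra ℂ (AffGen r)} (h : AffRel a d q s t) :
    action a d q V s = action a d q V t :=
  congrArg (Algebra.lsmul ℂ ℂ V) (RingQuot.mkAlgHom_rel ℂ h)

theorem exchange_action {c : ℂ} {g : FreeAlgebra ℂ (AffGen r)} {x y : ℤ → FreeAlgebra ℂ (AffGen r)}
    {m k : ℤ} (h : AffRel a d q (exchange c g x y m k) 0) :
    exchange c (action a d q V g) (fun m => action a d q V (x m))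
      (fun m => action a d q V (y m)) m k = 0 := by
  rw [← map_exchange, action_rel h, map_zero]

open AffGen

/-- The vectors at which the currents `e_α(z)`, `f_α(z)`, `K_α^+(z)` are smooth. -/
def IsSmoothVector (a : Fin r → Fin r → ℤ) (d : Fin r → ℕ) (q : ℂ) {V : Type u} [AddCommGroup V]
    [Module ℂ V] [Module (QAffine a d q) V] [IsScalarTower ℂ (QAffine a d q) V] (w : V) : Prop :=
  (∀ α, IsSmoothAt (fun m => action a d q V (fe α m)) w) ∧
  (∀ α, IsSmoothAt (fun m => action a d q V (ff α m)) w) ∧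
  (∀ α, IsSmoothAt (fun m => action a d q V (fKp α m)) w)

/-- The modes of positive degree of this current are zero, which is why it need not appear in
`IsSmoothVector`. -/
theorem isSmoothAt_fKm (α : Fin r) (w : V) : IsSmoothAt (fun m => action a d q V (fKm α m)) w :=
  ⟨1, fun m hm => by simp only [fKm, if_neg (show ¬m ≤ 0 by omega), map_zero]; rfl⟩

theorem commute_fγ (s : FreeAlgebra ℂ (AffGen r)) :
    Commute (action a d q V s) (action a d q V fγ) := by
  induction s using FreeAlgebra.induction with
  | grade0 c => rw [AlgHom.commutes]; exact Algebra.commute_algebraMap_left _ _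
  | grade1 g =>
    have := action_rel (V := V) (AffRel.γ_central (a := a) (d := d) (q := q) g)
    rw [map_mul, map_mul] at this
    exact this.symm
  | mul s t hs ht => rw [map_mul]; exact hs.mul_left ht
  | add s t hs ht => rw [map_add]; exact hs.add_left ht

theorem fγ_mul_fγinv : action a d q V fγ * action a d q V fγinv = 1 := by
  rw [← map_mul, action_rel .γ_mul_γinv, map_one]

theorem fγinv_mul_fγ : action a d q V fγinv * action a d q V fγ = 1 := by
  rw [← map_mul, action_rel .γinv_mul_γ, map_one]

theorem commute_fγinv (s : FreeAlgebra ℂ (AffGen r)) :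
    Commute (action a d q V s) (action a d q V fγinv) :=
  (show Commute _ ((⟨_, _, fγ_mul_fγinv, fγinv_mul_fγ⟩ : (Module.End ℂ V)ˣ) : Module.End ℂ V) from
    commute_fγ s).units_inv_right

theorem fγ_injective : Function.Injective (action a d q V fγ) :=
  Function.LeftInverse.injective fun w => LinearMap.congr_fun fγinv_mul_fγ w

theorem fγinv_injective : Function.Injective (action a d q V fγinv) :=
  Function.LeftInverse.injective fun w => LinearMap.congr_fun fγ_mul_fγinv w

/-- The commutator involves only the modes `m + k` of the Cartan currents, which kill `w` for large
`m`. Both positions of the growing mode are needed: `e` is moved past `f`, and `f` past `e`. -/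
theorem e_f_commutator_eventually {w : V} (hw : IsSmoothVector a d q w) (α β : Fin r) (k : ℤ) :
    ∃ M : ℤ, ∀ m, M ≤ m → (action a d q V (fe α m) * action a d q V (ff β k) -
      action a d q V (ff β k) * action a d q V (fe α m)) w = 0 ∧
      (action a d q V (fe β k) * action a d q V (ff α m) -
      action a d q V (ff α m) * action a d q V (fe β k)) w = 0 := by
  by_cases hαβ : α = β
  · subst hαβ
    obtain ⟨M, hM⟩ := hw.2.2 α
    obtain ⟨M', hM'⟩ := isSmoothAt_fKm (a := a) (d := d) (q := q) α w
    refine ⟨max M M' - k, fun m hm => ?_⟩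
    have h1 := action_rel (V := V) (AffRel.e_f_same (a := a) (d := d) (q := q) α m k)
    have h2 := action_rel (V := V) (AffRel.e_f_same (a := a) (d := d) (q := q) α k m)
    simp only [map_sub, map_mul, map_smul] at h1 h2
    rw [h1, h2, add_comm k m]
    simp only [LinearMap.smul_apply, LinearMap.sub_apply, Module.End.mul_apply]
    rw [show action a d q V (fKp α (m + k)) w = 0 from hM _ (by omega),
      show action a d q V (fKm α (m + k)) w = 0 from hM' _ (by omega)]
    simp
  · refine ⟨0, fun m _ => ?_⟩
    have h1 := action_rel (V := V) (AffRel.e_f_ne (a := a) (d := d) (q := q) α β hαβ m k)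
    have h2 := action_rel (V := V) (AffRel.e_f_ne (a := a) (d := d) (q := q) β α (Ne.symm hαβ) k m)
    rw [map_mul, map_mul] at h1 h2
    rw [h1, h2, sub_self, sub_self]
    exact ⟨rfl, rfl⟩

theorem qExp_ne_zero' (hq : q ≠ 0) (α β : Fin r) : (qExp a d q α β)⁻¹ ≠ 0 :=
  inv_ne_zero (qExp_ne_zero hq α β)

/-- Every generator satisfies with each of the three families of currents a relation (exchange,
quadratic, commutator or degree) which transports smoothness. The Cartan currents must belong to the
notion because they arise from commuting `e` with `f`. -/
theorem IsSmoothVector.gen (hq : q ≠ 0) {w : V} (hw : IsSmoothVector a d q w) (g : AffGen r) :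
    IsSmoothVector a d q (action a d q V (FreeAlgebra.ι ℂ g) w) := by
  obtain ⟨hE, hF, hK⟩ := id hw
  have hc := qExp_ne_zero (a := a) (d := d) hq
  have hc' := qExp_ne_zero' (a := a) (d := d) hq
  cases g with
  | e β k =>
    refine ⟨fun α => ?_, fun α => ?_, fun α => ?_⟩
    · exact (hE α).of_exchange (hc α β) (fun m k => exchange_action (.e_e α β m k)) (hE β) k
    · obtain ⟨M, hM⟩ := e_f_commutator_eventually hw α β k
      refine (hF α).of_commutator (y := fun k => action a d q V (fe β k)) k
        ⟨M, fun m hm => ?_⟩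
      rw [← neg_sub, LinearMap.neg_apply, (hM m hm).2, neg_zero]
    · exact (hK α).of_exchange (hc α β) (fun m k => exchange_action (.Kp_e α β m k)) (hE β) k
  | f β k =>
    refine ⟨fun α => ?_, fun α => ?_, fun α => ?_⟩
    · obtain ⟨M, hM⟩ := e_f_commutator_eventually hw α β k
      exact (hE α).of_commutator (y := fun k => action a d q V (ff β k)) k
        ⟨M, fun m hm => (hM m hm).1⟩
    · exact (hF α).of_exchange (hc' α β) (fun m k => exchange_action (.f_f α β m k)) (hF β) k
    · exact (hK α).of_exchange (hc' α β) (fun m k => exchange_action (.Kp_f α β m k)) (hF β) k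
  | Kp β k =>
    have hk : FreeAlgebra.ι ℂ (Kp β k) = fKp β k := by simp [fKp]
    rw [hk]
    refine ⟨fun α => ?_, fun α => ?_, fun α => ?_⟩
    · exact (hK β).of_exchange' (hc β α) fγinv_injective
        (fun m k => exchange_action (.Kp_e β α m k)) (hE α) k
    · exact (hK β).of_exchange' (hc' β α) fγ_injective
        (fun m k => exchange_action (.Kp_f β α m k)) (hF α) k
    · refine (hK α).of_commute fun m => ?_
      have h1 := action_rel (V := V) (AffRel.Kp_comm (a := a) (d := d) (q := q) α β m k)
      rwa [map_mul, map_mul] at h1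
  | Km β k =>
    have hk : FreeAlgebra.ι ℂ (Km β k) = fKm β (-k) := by simp [fKm]
    rw [hk]
    refine ⟨fun α => ?_, fun α => ?_, fun α => ?_⟩
    · exact (isSmoothAt_fKm β w).of_exchange' (hc β α) fγ_injective
        (fun m k => exchange_action (.Km_e β α m k)) (hE α) _
    · exact (isSmoothAt_fKm β w).of_exchange' (hc' β α) fγinv_injective
        (fun m k => exchange_action (.Km_f β α m k)) (hF α) _
    · set b := qExp a d q α β
      refine (hK α).of_quadratic (y := fun m => action a d q V (fKm β m)) (hc α β)
        (T := action a d q V (b ^ 2 • fγ ^ 2 + fγinv ^ 2))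
        (T' := action a d q V (b ^ 2 • fγinv ^ 2 + fγ ^ 2)) (fun m k => ?_)
        (isSmoothAt_fKm β w) _
      simp only [← map_mul, ← map_smul, ← map_sub, ← map_add]
      exact action_rel (.Kp_Km α β m k)
  | γ =>
    exact ⟨fun α => (hE α).of_commute fun m => commute_fγ _,
      fun α => (hF α).of_commute fun m => commute_fγ _,
      fun α => (hK α).of_commute fun m => commute_fγ _⟩
  | γinv =>
    exact ⟨fun α => (hE α).of_commute fun m => commute_fγinv _,
      fun α => (hF α).of_commute fun m => commute_fγinv _,
      fun α => (hK α).of_commute fun m => commute_fγinv _⟩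
  | D =>
    refine ⟨fun α => (hE α).of_degree fun m => ?_, fun α => (hF α).of_degree fun m => ?_,
      fun α => (hK α).of_degree fun m => ?_⟩
    · simpa only [map_sub, map_mul, map_smul] using
        action_rel (V := V) (AffRel.D_e (a := a) (d := d) (q := q) α m)
    · simpa only [map_sub, map_mul, map_smul] using
        action_rel (V := V) (AffRel.D_f (a := a) (d := d) (q := q) α m)
    · simpa only [map_sub, map_mul, map_smul] using
        action_rel (V := V) (AffRel.D_Kp (a := a) (d := d) (q := q) α m)

theorem IsSmoothVector.add {w w' : V} (h : IsSmoothVector a d q w) (h' : IsSmoothVector a d q w') :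
    IsSmoothVector a d q (w + w') :=
  ⟨fun α => (h.1 α).add (h'.1 α), fun α => (h.2.1 α).add (h'.2.1 α),
    fun α => (h.2.2 α).add (h'.2.2 α)⟩

theorem IsSmoothVector.action (hq : q ≠ 0) (s : FreeAlgebra ℂ (AffGen r)) {w : V}
    (hw : IsSmoothVector a d q w) : IsSmoothVector a d q (action a d q V s w) := by
  induction s using FreeAlgebra.induction generalizing w with
  | grade0 c =>
    rw [AlgHom.commutes]
    exact ⟨fun α => (hw.1 α).of_commute fun m => Algebra.commute_algebraMap_right _ _,
      fun α => (hw.2.1 α).of_commute fun m => Algebra.commute_algebraMap_right _ _,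
      fun α => (hw.2.2 α).of_commute fun m => Algebra.commute_algebraMap_right _ _⟩
  | grade1 g => exact hw.gen hq g
  | mul s t hs ht =>
    rw [map_mul, Module.End.mul_apply]
    exact hs (ht hw)
  | add s t hs ht =>
    rw [map_add, LinearMap.add_apply]
    exact (hs hw).add (ht hw)

/-- The highest weight vector is smooth by its annihilation conditions, and every vector is obtained
from it by applying sums of products of generators. -/
theorem IsHighestWeightModule.isSmoothVector (hq : q ≠ 0) (hV : IsHighestWeightModule a d q V)
    (w : V) : IsSmoothVector a d q w := by
  obtain ⟨v₀, -, -, hE, hF, hK, hspan⟩ := hV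
  have h₀ : IsSmoothVector a d q v₀ := by
    refine ⟨fun α => ⟨0, fun m hm => hE α m hm⟩, fun α => ⟨1, fun m hm => hF α m (by omega)⟩,
      fun α => ⟨1, fun m hm => ?_⟩⟩
    simp only [fKp, if_pos (show 0 ≤ m by omega)]
    exact hK α m.toNat (by omega)
  have hw : w ∈ Submodule.span (QAffine a d q) {v₀} := hspan ▸ Submodule.mem_top
  obtain ⟨t, rfl⟩ := Submodule.mem_span_singleton.1 hw
  obtain ⟨s, rfl⟩ := RingQuot.mkAlgHom_surjective ℂ (AffRel a d q) t
  exact h₀.action hq s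

theorem isSmoothAction (hq : q ≠ 0) (hV : IsHighestWeightModule a d q V) :
    IsSmoothAction a d q fun α m => Algebra.lsmul ℂ ℂ V (QAffine.e a d q α m) where
  vertex α β m k := by
    have h1 := exchange_action (V := V) (AffRel.e_e (a := a) (d := d) (q := q) α β m k)
    rwa [map_one] at h1
  serre α β hαβ k l w hw := by
    refine pow_apply_apply_eq_zero_of_serre (p := q ^ d α)
      (x := fun m => Algebra.lsmul ℂ ℂ V (QAffine.e a d q α m))
      (y := fun m => Algebra.lsmul ℂ ℂ V (QAffine.e a d q β m)) (fun k l => ?_) l hw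
    have h1 := action_rel (V := V) (AffRel.serre_e (a := a) (d := d) (q := q) α β hαβ k l)
    rwa [map_zero, map_serre] at h1
  smooth α w := (hV.isSmoothVector hq w).1 α

end QAffine

/-! ### Cartan data -/

section CartanData

variable {r : ℕ} {a : Fin r → Fin r → ℤ} {d : Fin r → ℕ}

theorem qExp_comm_of_symm (hda : ∀ α β, (d α : ℤ) * a α β = d β * a β α) (q : ℂ) (α β : Fin r) :
    qExp a d q α β = qExp a d q β α := by
  simp only [qExp, ← zpow_natCast, ← zpow_mul, hda α β]

theorem eq_zero_iff_of_symm (hd : ∀ α, 0 < d α) (hda : ∀ α β, (d α : ℤ) * a α β = d β * a β α)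
    (α β : Fin r) : a α β = 0 ↔ a β α = 0 := by
  have h (γ : Fin r) : (d γ : ℤ) ≠ 0 := by exact_mod_cast (hd γ).ne'
  rw [← mul_eq_zero_iff_left (h α), hda, mul_eq_zero_iff_left (h β)]

end CartanData

end DrinfeldCurrents

end

open DrinfeldCurrents LieAlgebra.IsKilling in
theorem mainTheorem1
    -- a simple complex Lie algebra, not of type `G₂`, with a base of its root system
    {L : Type*} [LieRing L] [LieAlgebra ℂ L] [FiniteDimensional ℂ L] [LieAlgebra.IsSimple ℂ L]
    (H : LieSubalgebra ℂ L) [H.IsCartanSubalgebra]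
    (hG₂ : ¬ (rootSystem H).IsG2)
    (b : (rootSystem H).Base)
    -- the simple roots, numbered in some order, and the Cartan matrix `a α β = ⟨β, α^∨⟩`
    {r : ℕ} (simple : Fin r ≃ b.support)
    (a : Fin r → Fin r → ℤ) (ha : ∀ α β, a α β = b.cartanMatrix (simple β) (simple α))
    -- symmetrizing factors
    (d : Fin r → ℕ) (hd : ∀ α, 0 < d α) (hda : ∀ α β, (d α : ℤ) * a α β = d β * a β α)
    (q : ℂ) (hq : q ≠ 0) (n : Fin r → ℕ) :
    -- correlation functions in highest weight modules over the quantum affine algebra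
    ((∀ α, (q ^ d α) ^ 2 ≠ 1) →
      ∀ (V : Type*) [AddCommGroup V] [Module ℂ V] [Module (QAffine a d q) V]
        [IsScalarTower ℂ (QAffine a d q) V],
        QAffine.IsHighestWeightModule a d q V →
        ∀ (v : V) (ξ : Module.Dual ℂ V), QAffine.IsWeightVector a d q v →
          QAffine.IsWeightCovector a d q ξ →
          HasCorrelationProperties a d q (correlation n (QAffine.e a d q) ξ v)) ∧
    -- and, for every `q ≠ 0`, in graded `U_q 𝔫₊`-modules whose degrees are bounded from above
    (∀ (V : Type*) [AddCommGroup V] [Module ℂ V] [Module (NPlus a d q) V]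
        [IsScalarTower ℂ (NPlus a d q) V]
        (V' : ℤ → Submodule ℂ V), DirectSum.IsInternal V' →
        (∃ N : ℤ, ∀ k, N < k → V' k = ⊥) →
        (∀ (α : Fin r) (m k : ℤ), ∀ u ∈ V' k, NPlus.e a d q α m • u ∈ V' (k + m)) →
        ∀ (v : V) (ξ : Module.Dual ℂ V), (∃ k, v ∈ V' k) →
          (∃ k, ∀ l, l ≠ k → ∀ u ∈ V' l, ξ u = 0) →
          HasCorrelationProperties a d q (correlation n (NPlus.e a d q) ξ v)) := by
  have ha2 (α : Fin r) : a α α = 2 := by rw [ha, b.cartanMatrix_apply_same]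
  have ha' (α β : Fin r) (hαβ : α ≠ β) : a α β ≤ 0 := by
    rw [ha]
    exact b.cartanMatrix_le_zero_of_ne _ _ fun h => hαβ (simple.injective h).symm
  have hsym := qExp_comm_of_symm hda q
  have ha0 := eq_zero_iff_of_symm hd hda
  refine ⟨fun _ V _ _ _ _ hV v ξ hv hξ => ?_, fun V _ _ _ _ V' hV hb he v ξ ⟨k, hv⟩ ⟨k', hξ⟩ => ?_⟩
  · rw [correlation_eq_wordCorr]
    obtain ⟨c, hc⟩ := hv.2.2
    obtain ⟨c', hc'⟩ := hξ.2.2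
    -- The eigenvalues of the degree operator on `v` and `ξ` fix the total degree of the series.
    obtain ⟨K, hK⟩ := exists_sum_eq_of_wordCorr_ne_zero (n := n)
      (D := QAffine.action a d q V AffGen.fD) (e := fun α m => Algebra.lsmul ℂ ℂ V
        (QAffine.e a d q α m)) (fun α m => by
          have h := QAffine.action_rel (V := V) (AffRel.D_e (a := a) (d := d) (q := q) α m)
          rwa [map_sub, map_mul, map_mul, map_smul] at h) hc hc'
    exact hasCorrelationProperties_wordCorr hq hsym ha2 ha' ha0 (QAffine.isSmoothAction hq hV) hK
  · rw [correlation_eq_wordCorr]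
    exact hasCorrelationProperties_wordCorr hq hsym ha2 ha' ha0
      (isSmoothAction_NPlus fun α w =>
        isSmoothAt_of_graded hV.submodule_iSup_eq_top hb (he α) w)
      (sum_eq_of_wordCorr_ne_zero_of_graded he hv hξ)
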